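/- **Setting.** Let $G$ be a connected graph with $m\ge 2$ nodes and Laplacian $\bar W$, let $n\ge1$, $W=\bar W\otimes I_n$, and $\chi=\lambda_{\max}(W)/\lambda^+_{\min}(W)$, the ratio of the largest to the smallest positive eigenvalue. Node $k$ holds $f_k:\mathbb R^n\to\mathbb R$. Let $Q\subseteq\mathbb R^n$ be closed and convex, $\|\cdot\|$ the Euclidean norm, $\mu,\varepsilon>0$. For $\mathbf x=(x_1,\dots,x_m)\in\mathbb R^{mn}$ put $F(\mathbf x)=\frac1m\sum_k f_k(x_k)$; the problem is to minimize $F$ over $\mathbf x\in Q^m$ subject to $\sqrt W\mathbf x=0$. Let $\varphi_k(\lambda)=\max_{x\in Q}\{\langle\lambda,x\rangle-f_k(x)\}$, $$\Phi(\boldsymbol\lambda)=\max_{\mathbf x\in Q^m}\{\langle\boldsymbol\lambda,\mathbf x\rangle-F(\mathbf x)\}=\frac1m\sum_{k}\varphi_k(m\lambda_k),\qquad \Psi(\mathbf y)=\Phi(\sqrt W\mathbf y),$$ and $\mathbf x(\boldsymbol\lambda)=\nabla\Phi(\boldsymbol\lambda)=(\nabla\varphi_k(m\lambda_k))_k$.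 The dual problem is to minimize $\Psi$. Put $L_\Psi=m\lambda_{\max}(W)/\mu$ and, if the $f_k$ are $L$-smooth, $\mu_\Psi=m\lambda^+_{\min}(W)/L$. Only the gradients $\nabla\varphi_k$ are available, each to its own node. **Decentralized computation.** All nodes run the same program synchronously on private memories. In one communication round every node sends one vector of $\mathbb R^n$ to all its neighbours; in one oracle call per node every node $k$ evaluates $\nabla\varphi_k$ at one point. The methods are run in the variables $\sqrt W\mathbf y$, so that each dual gradient takes one round and one oracle call per node. **Methods**, all started from $\mathbf y=0$. * $\mathrm{STM}(L,\mu)$ with start $\mathbf y^0$: $\mathbf z^0=\mathbf y^0$, $A_0=0$; $\alpha_{k+1}$ is the larger root of $L\alpha^2=(1+A_k\mu)(A_k+\alpha)$; $A_{k+1}=A_k+\alpha_{k+1}$; $\tilde{\mathbf y}^{k+1}=(A_k\mathbf y^k+\alpha_{k+1}\mathbf z^k)/A_{k+1}$; $\mathbf z^{k+1}=\frac{(1+A_k\mu)\mathbf z^k-\alpha_{k+1}(\nabla\Psi(\tilde{\mathbf y}^{k+1})-\mu\tilde{\mathbf y}^{k+1})}{1+A_{k+1}\mu}$; $\mathbf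 y^{k+1}=(A_k\mathbf y^k+\alpha_{k+1}\mathbf z^{k+1})/A_{k+1}$. * PDSTM with $N$ iterations: $\mathrm{STM}(L_\Psi,0)$, with output $\mathbf y=\mathbf y^N$ and $\mathbf x=\frac1{A_N}\sum_{k=1}^N\alpha_k\,\mathbf x(\sqrt W\tilde{\mathbf y}^k)$. * OGM-G with $N$ iterations: $N$ iterations of $\mathrm{STM}(L_\Psi,0)$ and then, from the point reached, $N$ iterations of the optimized gradient method for decreasing the gradient norm of an $L_\Psi$-smooth function: from $\mathbf u_0=\mathbf v_0$, $$\mathbf v_{i+1}=\mathbf u_i-\tfrac1{L_\Psi}\nabla\Psi(\mathbf u_i),\quad \mathbf u_{i+1}=\mathbf v_{i+1}+\tfrac{(\theta_i-1)(2\theta_{i+1}-1)}{\theta_i(2\theta_i-1)}(\mathbf v_{i+1}-\mathbf v_i)+\tfrac{2\theta_{i+1}-1}{2\theta_i-1}(\mathbf v_{i+1}-\mathbf u_i),$$ where $\theta_N=1$, $\theta_i=\frac{1+\sqrt{1+4\theta_{i+1}^2}}2$ for $1\le i<N$, $\theta_0=\frac{1+\sqrt{1+8\theta_1^2}}2$.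 The output is $\mathbf y=\mathbf u_N$ and $\mathbf x=\mathbf x(\sqrt W\mathbf y)$. * ROGM-G with parameters $N,l$: OGM-G with $N$ iterations, run $l$ times in succession, each time from the last dual output; then $\mathbf x=\mathbf x(\sqrt W\mathbf y)$. **Claim.** There is a universal constant $C>0$ such that in each of the two cases below $\Psi$ has a minimizer of smallest norm, with norm $R_y$ say, and each method named there computes in decentralized form (node $k$ ends with block $k$ of $\sqrt W\mathbf y$ and of $\mathbf x$) its outputs $\mathbf y$ and $\mathbf x\in Q^m$, which satisfy $$F(\mathbf x)+\Psi(\mathbf y)\le\varepsilon,\qquad R_y\,\|\sqrt W\mathbf x\|\le\varepsilon,$$ for suitable values of the iteration parameters and for all larger ones, where for the suitable values both the number of communication rounds and the number of oracle calls per node are bounded as stated. 1. *Each $f_k$ is $\mu$-strongly convex and $L$-smooth (differentiable with $L$-Lipschitz gradient), $Q=\mathbb R^n$.* For ROGM-G the bound is $$C\sqrt{\tfrac L\mu\chi}\;\ln\Big(2+\tfrac L\mu\chi\,\tfrac{\|\nabla\Psi(0)\|R_y}{\varepsilon}\Big),$$ and for $\mathrm{STM}(L_\Psi,\mu_\Psi)$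 with output $\mathbf y=\mathbf y^N$, $\mathbf x=\mathbf x(\sqrt W\mathbf y)$ (the form of PDSTM for strongly convex dual functions) it is $$C\sqrt{\tfrac L\mu\chi}\;\ln\Big(2+\tfrac L\mu\chi\,\tfrac{L_\Psi R_y^2}{\varepsilon}\Big).$$ 2. *Each $f_k$ is $\mu$-strongly convex and lower semicontinuous on $Q$, and $M$-Lipschitz on $Q$; more generally, $M$-Lipschitz on $\{x\in Q:\|x-x^*\|\le r\}$ for some $r>0$, where $x^*$ minimizes $\frac1m\sum_k f_k$ on $Q$.* For OGM-G and for PDSTM the bound is $$C\Big(1+\sqrt{\tfrac{M^2}{\mu\varepsilon}\chi}\Big).$$ -/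

import Mathlib

noncomputable section

namespace DualDecentralized

universe u

/-! ### The network and its Laplacian -/

section Network

variable {V : Type u} [Fintype V] [DecidableEq V]

/-- The largest eigenvalue of the graph Laplacian `W`. -/
def lamMax (G : SimpleGraph V) [DecidableRel G.Adj] : ℝ :=
  sSup (spectrum ℝ (G.lapMatrix ℝ))

/-- The smallest positive eigenvalue of the graph Laplacian `W`. -/
def lamMinPos (G : SimpleGraph V) [DecidableRel G.Adj] : ℝ :=
  sInf {l : ℝ | l ∈ spectrum ℝ (G.lapMatrix ℝ) ∧ 0 < l}

/-- The condition number `χ` of the network. -/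
def chi (G : SimpleGraph V) [DecidableRel G.Adj] : ℝ :=
  lamMax G / lamMinPos G

open scoped MatrixOrder in
/-- The positive semidefinite square root of the graph Laplacian. -/
def sqrtLap (G : SimpleGraph V) [DecidableRel G.Adj] : Matrix V V ℝ :=
  CFC.sqrt (G.lapMatrix ℝ)

end Network

open scoped MatrixOrder in
/-- `sqrtLap` is indeed the positive semidefinite square root. -/
theorem sqrtLap_spec {V : Type u} [Fintype V] [DecidableEq V]
    (G : SimpleGraph V) [DecidableRel G.Adj] :
    (sqrtLap G).PosSemidef ∧ sqrtLap G * sqrtLap G = G.lapMatrix ℝ := by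
  have h0 : 0 ≤ G.lapMatrix ℝ := (G.posSemidef_lapMatrix ℝ).nonneg
  have h1 : 0 ≤ sqrtLap G := CFC.sqrt_nonneg (G.lapMatrix ℝ)
  exact ⟨Matrix.nonneg_iff_posSemidef.mp h1, CFC.sqrt_mul_sqrt_self _ h0⟩

/-! ### The primal and the dual problem -/

/-- `ℝⁿ` with the Euclidean norm. -/
abbrev Vec (n : ℕ) : Type := EuclideanSpace ℝ (Fin n)

/-- Stacked vectors `𝐱 = (x_k)` with one block in `ℝⁿ` per node, with the Euclidean norm of
`ℝ^{mn}`. -/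
abbrev Stack (V : Type u) [Fintype V] (n : ℕ) : Type u := PiLp 2 (fun _ : V => Vec n)

section Problem

variable {V : Type u} [Fintype V] {n : ℕ}

/-- The action of `S ⊗ I_n` on stacked vectors. -/
def kron (S : Matrix V V ℝ) (y : Stack V n) : Stack V n :=
  WithLp.toLp 2 fun k => ∑ j, S k j • y j

/-- The conjugate `φ(l) = max_{x ∈ Q} {⟨l, x⟩ - h x}`. -/
def conjFn (Q : Set (Vec n)) (h : Vec n → ℝ) (l : Vec n) : ℝ :=
  ⨆ x : Q, (inner ℝ l (x : Vec n) - h x)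

/-- The primal objective `F(𝐱) = (1/m) ∑ f_k(x_k)`. -/
def primalObj (f : V → Vec n → ℝ) (x : Stack V n) : ℝ :=
  (∑ k, f k (x k)) / Fintype.card V

/-- The conjugate `Φ` of `F` on `Q^m`:
`Φ(𝐥) = max_{𝐱 ∈ Q^m} {⟨𝐥, 𝐱⟩ - F(𝐱)} = (1/m) ∑ φ_k(m l_k)`. -/
def conjObj (Q : Set (Vec n)) (f : V → Vec n → ℝ) (l : Stack V n) : ℝ :=
  (∑ k, conjFn Q (f k) ((Fintype.card V : ℝ) • l k)) / Fintype.card V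

/-- The gradient `∇Φ(𝐥)`, that is, the maximiser `𝐱(𝐥)`: its block `k` is `∇φ_k(m l_k)`. -/
def response (Q : Set (Vec n)) (f : V → Vec n → ℝ) (l : Stack V n) : Stack V n :=
  WithLp.toLp 2 fun k => gradient (conjFn Q (f k)) ((Fintype.card V : ℝ) • l k)

variable [DecidableEq V]

/-- The dual objective `Ψ(𝐲) = Φ(√W 𝐲)` of the problem `F(𝐱) → min`, `√W 𝐱 = 0`, `𝐱 ∈ Q^m`. -/
def dualObj (G : SimpleGraph V) [DecidableRel G.Adj] (Q : Set (Vec n)) (f : V → Vec n → ℝ)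
    (y : Stack V n) : ℝ :=
  conjObj Q f (kron (sqrtLap G) y)

/-- `R` is the norm of the smallest minimiser of the dual objective. -/
def IsDualRadius (G : SimpleGraph V) [DecidableRel G.Adj] (Q : Set (Vec n))
    (f : V → Vec n → ℝ) (R : ℝ) : Prop :=
  IsLeast {r : ℝ | ∃ y : Stack V n, IsMinOn (dualObj G Q f) Set.univ y ∧ ‖y‖ = r} R

/-- The smoothness constant `L_Ψ = λ_max(W) / μ_F`, `μ_F = μ / m`, of the dual objective. -/
def dualL (G : SimpleGraph V) [DecidableRel G.Adj] (μ : ℝ) : ℝ :=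
  lamMax G / (μ / Fintype.card V)

/-- The strong convexity constant `μ_Ψ = λ_min⁺(W) / L_F`, `L_F = L / m`, of the dual objective
on the range of `√W`. -/
def dualMu (G : SimpleGraph V) [DecidableRel G.Adj] (L : ℝ) : ℝ :=
  lamMinPos G / (L / Fintype.card V)

end Problem

/-! ### The methods, for a gradient map on a real vector space -/

/-- The root `α` of `L α² = (1 + A μ) (A + α)`. -/
def stmStep (L μ A : ℝ) : ℝ :=
  (1 + A * μ) / (2 * L) + √((1 + A * μ) ^ 2 / (4 * L ^ 2) + A * (1 + A * μ) / L)

/-- The numbers `A_k` of the similar triangles method: `A_0 = 0`, `A_{k+1} = A_k + α_{k+1}`. -/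
def stmA (L μ : ℝ) : ℕ → ℝ
  | 0 => 0
  | k + 1 => stmA L μ k + stmStep L μ (stmA L μ k)

/-- The numbers `α_{k+1}` of the similar triangles method. -/
def stmAlpha (L μ : ℝ) (k : ℕ) : ℝ := stmStep L μ (stmA L μ k)

/-- The variables `y^k`, `z^k` and `t = ỹ^k` of the similar triangles method. -/
structure StmState (H : Type u) where
  y : H
  z : H
  t : H

/-- The variables `x_i`, `y_i` of OGM-G. -/
structure OgmState (H : Type u) where
  x : H
  y : H

section Methods

variable {H : Type u} [AddCommGroup H] [Module ℝ H]

/-- First half of iteration `k`: the query point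
`ỹ^{k+1} = (A_k y^k + α_{k+1} z^k) / A_{k+1}`. -/
def stmPre (L μ : ℝ) (k : ℕ) (s : StmState H) : StmState H :=
  { s with t := (stmA L μ (k + 1))⁻¹ • (stmA L μ k • s.y + stmAlpha L μ k • s.z) }

/-- Second half of iteration `k`, given the gradient `g` at `ỹ^{k+1}`: here `z^{k+1}` minimises
`∑_{j ≤ k+1} α_j (⟨g_j, z⟩ + (μ/2) ‖z - ỹ^j‖²) + (1/2) ‖z - y^0‖²`, which for `μ = 0` reads
`z^{k+1} = z^k - α_{k+1} g`, and `y^{k+1} = (A_k y^k + α_{k+1} z^{k+1}) / A_{k+1}`. -/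
def stmPost (L μ : ℝ) (k : ℕ) (g : H) (s : StmState H) : StmState H :=
  let z' : H := (1 + stmA L μ (k + 1) * μ)⁻¹ •
    ((1 + stmA L μ k * μ) • s.z - stmAlpha L μ k • (g - μ • s.t))
  { s with
    z := z'
    y := (stmA L μ (k + 1))⁻¹ • (stmA L μ k • s.y + stmAlpha L μ k • z') }

/-- The similar triangles method STM(`L`, `μ`, `y0`) with gradient map `grad`. -/
def stm (grad : H → H) (L μ : ℝ) (y0 : H) : ℕ → StmState H
  | 0 => ⟨y0, y0, y0⟩
  | k + 1 =>
    let s := stmPre L μ k (stm grad L μ y0 k)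
    stmPost L μ k (grad s.t) s

/-- The numbers `1 = θ̃_N, θ̃_{N-1}, θ̃_{N-2}, …` of OGM-G, counted backwards. -/
def ogmBack : ℕ → ℝ
  | 0 => 1
  | j + 1 => (1 + √(1 + 4 * ogmBack j ^ 2)) / 2

/-- The numbers `θ̃_i`, `0 ≤ i ≤ N`, of OGM-G with `N` iterations. -/
def ogmTheta (N i : ℕ) : ℝ :=
  if i = 0 then (1 + √(1 + 8 * ogmBack (N - 1) ^ 2)) / 2 else ogmBack (N - i)

/-- Iteration `i` of OGM-G with `N` iterations, given the gradient `g` at `x_i`. -/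
def ogmStep (L : ℝ) (N i : ℕ) (g : H) (s : OgmState H) : OgmState H :=
  let a := ogmTheta N i
  let b := ogmTheta N (i + 1)
  let y' : H := s.x - L⁻¹ • g
  { x := y' + ((a - 1) * (2 * b - 1) / (a * (2 * a - 1))) • (y' - s.y)
        + ((2 * b - 1) / (2 * a - 1)) • (y' - s.x)
    y := y' }

/-- The first `i` iterations of the gradient norm phase of OGM-G with `N` iterations. -/
def ogmPhase (grad : H → H) (L : ℝ) (N : ℕ) (x0 : H) : ℕ → OgmState H
  | 0 => ⟨x0, x0⟩
  | i + 1 =>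
    let s := ogmPhase grad L N x0 i
    ogmStep L N i (grad s.x) s

/-- OGM-G in the form that has the rate `‖∇Ψ(y)‖ = O(L ‖y0 - y*‖ / N²)`: `N` accelerated gradient
iterations (they decrease the function value) and then the `N` iterations of OGM-G (they turn
the small function value into a small gradient). -/
def ogmG (grad : H → H) (L : ℝ) (N : ℕ) (y0 : H) : H :=
  (ogmPhase grad L N (stm grad L 0 y0 N).y N).x

/-- ROGM-G: OGM-G is run `l` times, each time from the last output. -/
def rogmG (grad : H → H) (L : ℝ) (N : ℕ) (y0 : H) : ℕ → H
  | 0 => y0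
  | l + 1 => ogmG grad L N (rogmG grad L N y0 l)

end Methods

section Pdstm

variable {V : Type u} [Fintype V] [DecidableEq V] {n : ℕ}

/-- The primal output of PDSTM(`L`) from `𝐲^0 = 0`:
`𝐱^N = (1/A_N) ∑_{k=1}^{N} α_k 𝐱(√W ỹ^k)`. -/
def pdstmPrimal (G : SimpleGraph V) [DecidableRel G.Adj] (Q : Set (Vec n))
    (f : V → Vec n → ℝ) (L : ℝ) (N : ℕ) : Stack V n :=
  (stmA L 0 N)⁻¹ • ∑ k ∈ Finset.range N, stmAlpha L 0 k •
    response Q f (kron (sqrtLap G) (stm (gradient (dualObj G Q f)) L 0 0 (k + 1)).t)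

end Pdstm

/-! ### Decentralized computation

All nodes run the same program synchronously. Each has a private memory, a private oracle for
vectors of type `E`, and sees of the other nodes only the messages of its neighbours. -/

/-- One instruction, for private memories of type `σ`. -/
inductive Instr (E σ : Type) : Type
  /-- A computation of each node on its own memory. -/
  | compute (u : σ → σ)
  /-- Every node calls its own oracle once. -/
  | oracle (query : σ → E) (store : σ → E → σ)
  /-- One communication round: every node sends one vector to all its neighbours and receives
  the vectors of all its neighbours. -/
  | exchange (message : σ → E) (store : σ → Multiset E → σ)

/-- The effect of an instruction on the memories of all nodes; `o k` is the oracle of node `k`. -/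
def Instr.exec {V : Type u} [Fintype V] (G : SimpleGraph V) [DecidableRel G.Adj] {E σ : Type}
    (o : V → E → E) (i : Instr E σ) (s : V → σ) : V → σ :=
  match i with
  | .compute u => fun k => u (s k)
  | .oracle query store => fun k => store (s k) (o k (query (s k)))
  | .exchange message store =>
    fun k => store (s k) ((G.neighborFinset k).val.map fun j => message (s j))

/-- A program is a list of instructions, executed from left to right. -/
def run {V : Type u} [Fintype V] (G : SimpleGraph V) [DecidableRel G.Adj] {E σ : Type}
    (o : V → E → E) (P : List (Instr E σ)) (s : V → σ) : V → σ :=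
  P.foldl (fun s i => i.exec G o s) s

/-- The number of communication rounds of a program. -/
def commRounds {E σ : Type} (P : List (Instr E σ)) : ℕ :=
  P.countP fun i => match i with
    | .exchange _ _ => true
    | _ => false

/-- The number of oracle calls per node of a program. -/
def oracleCalls {E σ : Type} (P : List (Instr E σ)) : ℕ :=
  P.countP fun i => match i with
    | .oracle _ _ => true
    | _ => false

/-- The private memory of a node in the programs below. All dual variables are kept after the
change of variables `𝐲 ↦ √W 𝐲`. -/
structure Mem (E : Type) where
  /-- variables of the similar triangles method -/
  stm : StmState E
  /-- variables of OGM-G -/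
  ogm : OgmState E
  /-- last oracle answer -/
  ans : E
  /-- block of `W 𝐱`, where `𝐱` is the stack of the last oracle answers -/
  lap : E
  /-- accumulated primal sum -/
  acc : E
  /-- dual output: block of `√W 𝐲` -/
  dual : E
  /-- primal output: block of `𝐱` -/
  primal : E

section Programs

variable {E : Type} [AddCommGroup E] [Module ℝ E]

/-- The initial memory: everything is zero. -/
def Mem.init : Mem E := ⟨⟨0, 0, 0⟩, ⟨0, 0⟩, 0, 0, 0, 0, 0⟩

/-- Oracle call at `m • p`, where `p` is a point in the memory. -/
def callAt (m : ℝ) (p : Mem E → E) : Instr E (Mem E) :=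
  .oracle (fun s => m • p s) (fun s a => { s with ans := a })

/-- Multiplication of the stack of the last answers by `W` in one communication round: block `k`
of `W 𝐱` is `deg(k) x_k` minus the sum of `x_j` over the neighbours `j` of `k`. -/
def multiplyW : Instr E (Mem E) :=
  .exchange (fun s => s.ans) (fun s r => { s with lap := r.card • s.ans - r.sum })

/-- Iteration `k` of the similar triangles method, in the variables `√W 𝐲`. -/
def stmIter (m L μ : ℝ) (k : ℕ) : List (Instr E (Mem E)) :=
  [.compute (fun s => { s with stm := stmPre L μ k s.stm }),
   callAt m (fun s => s.stm.t),
   multiplyW,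
   .compute (fun s => { s with
     stm := stmPost L μ k s.lap s.stm
     acc := s.acc + stmAlpha L μ k • s.ans })]

/-- `N` iterations of the similar triangles method. -/
def stmLoop (m L μ : ℝ) (N : ℕ) : List (Instr E (Mem E)) :=
  (List.range N).flatMap (stmIter m L μ)

/-- Iteration `i` of the gradient norm phase of OGM-G, in the variables `√W 𝐲`. -/
def ogmIter (m L : ℝ) (N i : ℕ) : List (Instr E (Mem E)) :=
  [callAt m (fun s => s.ogm.x),
   multiplyW,
   .compute (fun s => { s with ogm := ogmStep L N i s.lap s.ogm })]

/-- One run of OGM-G from the current point `ogm.x`. -/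
def ogmLoop (m L : ℝ) (N : ℕ) : List (Instr E (Mem E)) :=
  [.compute (fun s => { s with stm := ⟨s.ogm.x, s.ogm.x, s.ogm.x⟩ })] ++
  stmLoop m L 0 N ++
  [.compute (fun s => { s with ogm := ⟨s.stm.y, s.stm.y⟩ })] ++
  (List.range N).flatMap (ogmIter m L N)

/-- Output of a dual point `p` and of the oracle answer `𝐱(p)` there. -/
def output (m : ℝ) (p : Mem E → E) : List (Instr E (Mem E)) :=
  [callAt m p, .compute (fun s => { s with dual := p s, primal := s.ans })]

/-- Decentralized PDSTM(`L`) with `N` iterations. -/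
def pdstmProgram (m L : ℝ) (N : ℕ) : List (Instr E (Mem E)) :=
  stmLoop m L 0 N ++
  [.compute (fun s => { s with dual := s.stm.y, primal := (stmA L 0 N)⁻¹ • s.acc })]

/-- Decentralized STM(`L`, `μ`) with `N` iterations. -/
def stmProgram (m L μ : ℝ) (N : ℕ) : List (Instr E (Mem E)) :=
  stmLoop m L μ N ++ output m (fun s => s.stm.y)

/-- Decentralized ROGM-G with `l` runs of OGM-G of length `N`; OGM-G is the case `l = 1`. -/
def rogmProgram (m L : ℝ) (N l : ℕ) : List (Instr E (Mem E)) :=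
  (List.replicate l (ogmLoop m L N)).flatten ++ output m (fun s => s.ogm.x)

end Programs

section Goal

variable {V : Type u} [Fintype V] [DecidableEq V] {n : ℕ}

/-- The program `P`, started from zero with the oracles `∇φ_k`, ends with the blocks of `√W 𝐲` and
`𝐱` at the nodes. -/
def Computes (G : SimpleGraph V) [DecidableRel G.Adj] (Q : Set (Vec n)) (f : V → Vec n → ℝ)
    (P : List (Instr (Vec n) (Mem (Vec n)))) (y x : Stack V n) : Prop :=
  ∀ k, (run G (fun j => gradient (conjFn Q (f j))) P (fun _ => Mem.init) k).dual
        = kron (sqrtLap G) y k ∧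
    (run G (fun j => gradient (conjFn Q (f j))) P (fun _ => Mem.init) k).primal = x k

/-- `𝐱 ∈ Q^m`, the duality gap is at most `ε` and the feasibility gap `‖√W 𝐱‖` is at most `ε / R`
(no condition if `R = 0`). -/
def GapsLE (G : SimpleGraph V) [DecidableRel G.Adj] (Q : Set (Vec n)) (f : V → Vec n → ℝ)
    (R ε : ℝ) (y x : Stack V n) : Prop :=
  (∀ k, x k ∈ Q) ∧ primalObj f x + dualObj G Q f y ≤ ε ∧ R * ‖kron (sqrtLap G) x‖ ≤ ε

end Goal

end DualDecentralized

end

/-! The theorem reduces to accelerated gradient methods for one smooth convex function, the dual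
objective Ψ. Strong convexity of the f_k gives every conjugate a unique maximiser with quadratic
growth around it. Comparing the maximisers at two dual points yields the interpolation inequality
`Cocoercive` for Ψ, with constant L_Ψ and gradient √W x(√W y) (`conjSpec_of_strongConvexOn`,
`dual_cocoercive`). If the f_k are L-smooth and Q is the whole space, Ψ is also strongly convex, but
only along vectors of zero block sum (`dual_strongly_convex`). These contain the range of √W, hence
all iterates started at 0, and also the shortest dual solution.

For x = x(√W y) both errors are controlled by the gradient: F(x) + Ψ(y) = ⟨y, ∇Ψ(y)⟩ and √W x =
∇Ψ(y). So a small gradient at a point of norm O(R_y) suffices. In OGM-G the similar triangles phase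
makes the value gap O(L_Ψ R_y²/N²), and a potential function converts this gap into a squared
gradient norm smaller by a further factor of order L_Ψ/N² (`ogmPotential_le`). A separate energy
argument bounds the momenta, so that the iterates travel only O(R_y) (`ogm_momentum_le_of_one`).
Under strong convexity the distance to the solution is at most the gradient norm over μ_Ψ, so a run
with N² ≥ 6 L_Ψ/μ_Ψ halves the gradient and restarts converge linearly.

PDSTM averages primal responses instead. Its estimate sequence holds at every test point; the choice
-A_N √W x gives F + Ψ ≤ -(A_N/2)‖√W x‖², and weak duality then bounds ‖√W x‖ (`pdstm_rate`).

In the Lipschitz case the rates involve L_Ψ R_y². The Lipschitz bound near the solution and the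
spectral gap show that violating consensus lowers F at most linearly in ‖√W x‖; separation turns
this into a multiplier with R_y² ≤ M²/(m λ_min⁺) (`primalObj_lower_bound`, `exists_multiplier`).
Hence L_Ψ R_y²/ε ≤ (M²/(με)) χ.

The programs are correct because every update is linear in iterates and gradients and so commutes
with √W. In the new variables the gradient is W x, which each node assembles from the blocks of its
neighbours. -/

noncomputable section

namespace DualDecentralized

universe u

section FirstOrder

variable {H : Type*} [NormedAddCommGroup H] [InnerProductSpace ℝ H]

/-! ### Convex functions with a Lipschitz gradient -/

/-- The interpolation inequality of an `L`-smooth convex function `ψ` with gradient `s`. -/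
def Cocoercive (ψ : H → ℝ) (s : H → H) (L : ℝ) : Prop :=
  ∀ y y', ψ y' + inner ℝ (s y') (y - y') + 1 / (2 * L) * ‖s y - s y'‖ ^ 2 ≤ ψ y

variable {ψ : H → ℝ} {s : H → H} {L : ℝ}

theorem Cocoercive.subgradient (h : Cocoercive ψ s L) (hL : 0 < L) (y y' : H) :
    ψ y' + inner ℝ (s y') (y - y') ≤ ψ y := by
  have h1 := h y y'
  have h2 : 0 ≤ 1 / (2 * L) * ‖s y - s y'‖ ^ 2 := by positivity
  linarith

theorem Cocoercive.inner_sub (h : Cocoercive ψ s L) (y y' : H) :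
    1 / L * ‖s y - s y'‖ ^ 2 ≤ inner ℝ (s y - s y') (y - y') := by
  have h1 := h y y'
  have h2 := h y' y
  rw [norm_sub_rev] at h2
  have h3 : inner ℝ (s y) (y' - y) = - inner ℝ (s y) (y - y') := by
    rw [← inner_neg_right, neg_sub]
  have h4 : 1 / L * ‖s y - s y'‖ ^ 2 = 2 * (1 / (2 * L) * ‖s y - s y'‖ ^ 2) := by
    field_simp
  rw [inner_sub_left, h4]
  linarith

theorem Cocoercive.lipschitz (h : Cocoercive ψ s L) (hL : 0 < L) (y y' : H) :
    ‖s y - s y'‖ ≤ L * ‖y - y'‖ := by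
  have h1 := h.inner_sub y y'
  have h2 := real_inner_le_norm (s y - s y') (y - y')
  have h3 : 1 / L * ‖s y - s y'‖ ^ 2 ≤ ‖s y - s y'‖ * ‖y - y'‖ := h1.trans h2
  rw [div_mul_eq_mul_div, one_mul, div_le_iff₀ hL] at h3
  rcases (norm_nonneg (s y - s y')).eq_or_lt with h0 | h0
  · rw [← h0]; positivity
  · nlinarith

/-- Exchange the two points in the interpolation inequality and absorb the cross term by Young's
inequality. -/
theorem Cocoercive.le_quadratic (h : Cocoercive ψ s L) (hL : 0 < L) (y y' : H) :
    ψ y ≤ ψ y' + inner ℝ (s y') (y - y') + L / 2 * ‖y - y'‖ ^ 2 := by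
  have h1 := h y' y
  have h3 : inner ℝ (s y) (y' - y) = - inner ℝ (s y) (y - y') := by
    rw [← inner_neg_right, neg_sub]
  have h2 : inner ℝ (s y) (y - y') = inner ℝ (s y') (y - y') + inner ℝ (s y - s y') (y - y') := by
    rw [inner_sub_left]; ring
  have h4 := real_inner_le_norm (s y - s y') (y - y')
  rw [norm_sub_rev] at h1
  have h5 : ‖s y - s y'‖ * ‖y - y'‖ ≤
      1 / (2 * L) * ‖s y - s y'‖ ^ 2 + L / 2 * ‖y - y'‖ ^ 2 := by
    have : 1 / (2 * L) * ‖s y - s y'‖ ^ 2 + L / 2 * ‖y - y'‖ ^ 2 - ‖s y - s y'‖ * ‖y - y'‖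
        = 1 / (2 * L) * (‖s y - s y'‖ - L * ‖y - y'‖) ^ 2 := by
      field_simp; ring
    have h6 : 0 ≤ 1 / (2 * L) * (‖s y - s y'‖ - L * ‖y - y'‖) ^ 2 := by positivity
    linarith
  linarith

/-- A gradient step of length 1/L lowers the value by at least ‖s y‖²/(2L), and the value cannot
fall below m. -/
theorem Cocoercive.norm_sq_le (h : Cocoercive ψ s L) (hL : 0 < L) {m : ℝ} (hm : ∀ y, m ≤ ψ y)
    (y : H) : ‖s y‖ ^ 2 ≤ 2 * L * (ψ y - m) := by
  have h1 := h.le_quadratic hL (y - L⁻¹ • s y) y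
  have h2 := hm (y - L⁻¹ • s y)
  have h3 : y - L⁻¹ • s y - y = -(L⁻¹ • s y) := by abel
  rw [h3, inner_neg_right, real_inner_smul_right, norm_neg, norm_smul, Real.norm_eq_abs,
    abs_of_pos (inv_pos.mpr hL), real_inner_self_eq_norm_sq] at h1
  have h4 : L / 2 * (L⁻¹ * ‖s y‖) ^ 2 = L⁻¹ * ‖s y‖ ^ 2 / 2 := by field_simp
  rw [h4] at h1
  have h5 : L⁻¹ * ‖s y‖ ^ 2 ≤ 2 * (ψ y - m) := by linarith
  rw [inv_mul_le_iff₀ hL] at h5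
  linarith

/-- The map s is not assumed to be a gradient. The affine minorant and the quadratic majorant leave
an error of order ‖x - y‖², which forces differentiability. -/
theorem Cocoercive.hasGradientAt [CompleteSpace H] (h : Cocoercive ψ s L) (hL : 0 < L) (y : H) :
    HasGradientAt ψ (s y) y := by
  rw [hasGradientAt_iff_isLittleO]
  have h1 : (fun x => ψ x - ψ y - inner ℝ (s y) (x - y)) =O[nhds y]
      fun x => ‖x - y‖ ^ 2 := by
    refine Asymptotics.IsBigO.of_bound (L / 2) (Filter.Eventually.of_forall fun x => ?_)
    have h2 := h.le_quadratic hL x y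
    have h3 := h.subgradient hL x y
    rw [Real.norm_eq_abs, abs_of_nonneg (by linarith), Real.norm_eq_abs,
      abs_of_nonneg (by positivity)]
    linarith
  refine h1.trans_isLittleO ?_
  have h2 : (fun x : H => ‖x - y‖ ^ 2) =o[nhds y] fun x => ‖x - y‖ := by
    have := (Asymptotics.isLittleO_norm_pow_id (E' := H) one_lt_two).comp_tendsto
      (show Filter.Tendsto (fun x => x - y) (nhds y) (nhds 0) by
        have : Filter.Tendsto (fun x => x - y) (nhds y) (nhds (y - y)) :=
          (continuous_id.sub continuous_const).tendsto y
        simpa using this)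
    exact this.norm_right
  exact h2.norm_right.trans_isBigO (by simpa using Asymptotics.isBigO_refl _ _) |>.of_norm_right

theorem Cocoercive.gradient_eq [CompleteSpace H] (h : Cocoercive ψ s L) (hL : 0 < L) :
    gradient ψ = s :=
  funext fun y => (h.hasGradientAt hL y).gradient

theorem Cocoercive.eq_zero_of_isMinOn (h : Cocoercive ψ s L) (hL : 0 < L) {y : H}
    (hy : ∀ x, ψ y ≤ ψ x) : s y = 0 := by
  have := h.norm_sq_le hL hy y
  rw [sub_self, mul_zero] at this
  exact norm_eq_zero.mp (pow_eq_zero_iff two_ne_zero |>.mp (le_antisymm this (by positivity)))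

end FirstOrder

/-! ### The similar triangles method -/

theorem stmA_nonneg {L μ : ℝ} (hL : 0 < L) (hμ : 0 ≤ μ) (k : ℕ) : 0 ≤ stmA L μ k := by
  induction k with
  | zero => exact le_rfl
  | succ k ih =>
    have : 0 ≤ stmStep L μ (stmA L μ k) := by unfold stmStep; positivity
    exact add_nonneg ih this

theorem stmAlpha_pos {L μ : ℝ} (hL : 0 < L) (hμ : 0 ≤ μ) (k : ℕ) : 0 < stmAlpha L μ k := by
  have := stmA_nonneg hL hμ k
  unfold stmAlpha stmStep
  positivity

theorem stmA_succ (L μ : ℝ) (k : ℕ) : stmA L μ (k + 1) = stmA L μ k + stmAlpha L μ k := rfl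

theorem stmA_succ_pos {L μ : ℝ} (hL : 0 < L) (hμ : 0 ≤ μ) (k : ℕ) : 0 < stmA L μ (k + 1) :=
  add_pos_of_nonneg_of_pos (stmA_nonneg hL hμ k) (stmAlpha_pos hL hμ k)

theorem stmAlpha_sq {L μ : ℝ} (hL : 0 < L) (hμ : 0 ≤ μ) (k : ℕ) :
    L * stmAlpha L μ k ^ 2 = (1 + stmA L μ k * μ) * stmA L μ (k + 1) := by
  have hA := stmA_nonneg hL hμ k
  rw [stmA_succ]
  unfold stmAlpha stmStep
  set A := stmA L μ k
  have h := Real.sq_sqrt (show 0 ≤ (1 + A * μ) ^ 2 / (4 * L ^ 2) + A * (1 + A * μ) / L by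
    positivity)
  set r := √((1 + A * μ) ^ 2 / (4 * L ^ 2) + A * (1 + A * μ) / L)
  have h2 : L * r ^ 2 = (1 + A * μ) ^ 2 / (4 * L) + A * (1 + A * μ) := by
    rw [h]; field_simp
  have h3 : L * ((1 + A * μ) / (2 * L) + r) ^ 2
      = (1 + A * μ) ^ 2 / (4 * L) + (1 + A * μ) * r + L * r ^ 2 := by
    field_simp; ring
  rw [h3, h2]
  field_simp; ring

/-- Each step is at least 1/(2L) + √(A/L), which exceeds the increment 1/(4L) + k/(2L) from k² to
(k+1)². -/
theorem sq_le_stmA {L : ℝ} (hL : 0 < L) (k : ℕ) : (k : ℝ) ^ 2 / (4 * L) ≤ stmA L 0 k := by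
  induction k with
  | zero => simp [stmA]
  | succ k ih =>
    have h1 : (k : ℝ) / (2 * L) ≤
        √((1 + stmA L 0 k * 0) ^ 2 / (4 * L ^ 2) + stmA L 0 k * (1 + stmA L 0 k * 0) / L) := by
      apply Real.le_sqrt_of_sq_le
      have : stmA L 0 k / L ≥ (k : ℝ) ^ 2 / (4 * L) / L := by gcongr
      have h2 : ((k : ℝ) / (2 * L)) ^ 2 = (k : ℝ) ^ 2 / (4 * L) / L := by field_simp; norm_num
      have h3 : 0 ≤ (1 + stmA L 0 k * 0) ^ 2 / (4 * L ^ 2) := by positivity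
      have h4 : stmA L 0 k * (1 + stmA L 0 k * 0) / L = stmA L 0 k / L := by ring
      rw [h4]; linarith
    rw [stmA_succ]
    unfold stmAlpha stmStep
    have h5 : ((k + 1 : ℕ) : ℝ) ^ 2 / (4 * L)
        = (k : ℝ) ^ 2 / (4 * L) + (1 / (4 * L) + (k : ℝ) / (2 * L)) := by
      push_cast; field_simp; ring
    have h6 : 1 / (4 * L) ≤ (1 + stmA L 0 k * 0) / (2 * L) := by
      rw [mul_zero, add_zero]
      gcongr; norm_num
    rw [h5]; linarith

/-- Keeping only the term μA²/L under the root gives α ≥ √(μ/L) A, hence geometric growth from A_1 =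
1/L. The exponent therefore lags the index by one. -/
theorem pow_le_stmA {L μ : ℝ} (hL : 0 < L) (hμ : 0 ≤ μ) (k : ℕ) :
    (1 + √(μ / L)) ^ k / L ≤ stmA L μ (k + 1) := by
  induction k with
  | zero =>
    have h := stmAlpha_sq hL hμ 0
    have h0 := stmAlpha_pos hL hμ 0
    rw [stmA_succ] at *
    simp only [stmA, zero_mul, add_zero, zero_add, one_mul] at *
    have : L * stmAlpha L μ 0 = 1 := by
      apply mul_right_cancel₀ h0.ne'
      linarith
    rw [pow_zero, div_le_iff₀ hL]; linarith
  | succ k ih =>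
    rw [stmA_succ]
    have hA := stmA_succ_pos hL hμ k
    set A := stmA L μ (k + 1) with hAdef
    have h1 : √(μ / L) * A ≤ stmAlpha L μ (k + 1) := by
      unfold stmAlpha stmStep
      rw [← hAdef]
      have h2 : √(μ / L) * A ≤ √((1 + A * μ) ^ 2 / (4 * L ^ 2) + A * (1 + A * μ) / L) := by
        apply Real.le_sqrt_of_sq_le
        rw [mul_pow, Real.sq_sqrt (by positivity)]
        have h3 : 0 ≤ (1 + A * μ) ^ 2 / (4 * L ^ 2) := by positivity
        have h4 : A * (1 + A * μ) / L = A / L + μ / L * A ^ 2 := by field_simp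
        have h5 : 0 ≤ A / L := by positivity
        linarith
      have : 0 ≤ (1 + A * μ) / (2 * L) := by positivity
      linarith
    calc (1 + √(μ / L)) ^ (k + 1) / L = (1 + √(μ / L)) * ((1 + √(μ / L)) ^ k / L) := by
          rw [pow_succ]; ring
      _ ≤ (1 + √(μ / L)) * A := by gcongr
      _ ≤ _ := by linarith

section

variable {H : Type*} [NormedAddCommGroup H] [InnerProductSpace ℝ H]
  {ψ : H → ℝ} {s : H → H} {L μ : ℝ}

theorem stm_z_succ (L μ : ℝ) (y0 : H) (k : ℕ) :
    (stm s L μ y0 (k + 1)).z = (1 + stmA L μ (k + 1) * μ)⁻¹ •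
      ((1 + stmA L μ k * μ) • (stm s L μ y0 k).z - stmAlpha L μ k •
        (s (stm s L μ y0 (k + 1)).t - μ • (stm s L μ y0 (k + 1)).t)) := rfl

theorem stm_t_succ (L μ : ℝ) (y0 : H) (k : ℕ) :
    (stm s L μ y0 (k + 1)).t = (stmA L μ (k + 1))⁻¹ •
      (stmA L μ k • (stm s L μ y0 k).y + stmAlpha L μ k • (stm s L μ y0 k).z) := rfl

theorem stm_y_succ (L μ : ℝ) (y0 : H) (k : ℕ) :
    (stm s L μ y0 (k + 1)).y = (stmA L μ (k + 1))⁻¹ •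
      (stmA L μ k • (stm s L μ y0 k).y + stmAlpha L μ k • (stm s L μ y0 (k + 1)).z) := rfl

/-- The quadratic lower model of `ψ` at `t`. -/
def model (ψ : H → ℝ) (s : H → H) (μ : ℝ) (t y : H) : ℝ :=
  ψ t + inner ℝ (s t) (y - t) + μ / 2 * ‖y - t‖ ^ 2

/-- The estimate sequence step: completing the square. -/
theorem quadratic_complete_square {a b α : ℝ} (hb : b = a + α * μ) (z t g z' y : H)
    (hz' : b • z' = a • z - α • (g - μ • t)) :
    a / 2 * ‖z' - z‖ ^ 2 + α * (inner ℝ g (z' - t) + μ / 2 * ‖z' - t‖ ^ 2)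
        + b / 2 * ‖y - z'‖ ^ 2
      = a / 2 * ‖y - z‖ ^ 2 + α * (inner ℝ g (y - t) + μ / 2 * ‖y - t‖ ^ 2) := by
  have h1 : ‖y - z‖ ^ 2 = ‖y - z'‖ ^ 2 + 2 * inner ℝ (y - z') (z' - z) + ‖z' - z‖ ^ 2 := by
    rw [← norm_add_sq_real, sub_add_sub_cancel]
  have h2 : ‖y - t‖ ^ 2 = ‖y - z'‖ ^ 2 + 2 * inner ℝ (y - z') (z' - t) + ‖z' - t‖ ^ 2 := by
    rw [← norm_add_sq_real, sub_add_sub_cancel]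
  have h3 : inner ℝ g (y - t) = inner ℝ (y - z') g + inner ℝ g (z' - t) := by
    rw [real_inner_comm g (y - z'), ← inner_add_right, sub_add_sub_cancel]
  have h4 : a • (z' - z) + α • g + (α * μ) • (z' - t) = 0 := by
    have : a • (z' - z) + α • g + (α * μ) • (z' - t)
        = b • z' - (a • z - α • (g - μ • t)) := by
      rw [hb]; module
    rw [this, hz', sub_self]
  have h5 : a * inner ℝ (y - z') (z' - z) + α * inner ℝ (y - z') g
      + α * μ * inner ℝ (y - z') (z' - t) = 0 := by
    have := congrArg (fun v => inner ℝ (y - z') v) h4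
    simpa only [inner_add_right, real_inner_smul_right, inner_zero_right] using this
  rw [h1, h2, h3, hb]
  linear_combination (-1 : ℝ) * h5

/-- Since y' - t = (α/A')(z' - z), the equation Lα² = (1 + Aμ)A' makes the quadratic term of the
descent lemma equal the proximal term left by completing the square. -/
theorem stm_estimate_step (h : Cocoercive ψ s L) (hL : 0 < L) (hμ : 0 ≤ μ) (y0 : H) (k : ℕ)
    (y : H) :
    stmA L μ (k + 1) * ψ (stm s L μ y0 (k + 1)).y
        + (1 + stmA L μ (k + 1) * μ) / 2 * ‖y - (stm s L μ y0 (k + 1)).z‖ ^ 2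
      ≤ stmA L μ k * ψ (stm s L μ y0 k).y
        + (1 + stmA L μ k * μ) / 2 * ‖y - (stm s L μ y0 k).z‖ ^ 2
        + stmAlpha L μ k * model ψ s μ (stm s L μ y0 (k + 1)).t y := by
  have hA := stmA_nonneg hL hμ k
  have hα := stmAlpha_pos hL hμ k
  have hA' := stmA_succ_pos hL hμ k
  have hsum := stmA_succ L μ k
  have hsq := stmAlpha_sq hL hμ k
  have hz := stm_z_succ (s := s) L μ y0 k
  have ht := stm_t_succ (s := s) L μ y0 k
  have hy := stm_y_succ (s := s) L μ y0 k
  set A := stmA L μ k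
  set α := stmAlpha L μ k
  set A' := stmA L μ (k + 1)
  set z := (stm s L μ y0 k).z
  set yk := (stm s L μ y0 k).y
  set z' := (stm s L μ y0 (k + 1)).z
  set t := (stm s L μ y0 (k + 1)).t
  set y' := (stm s L μ y0 (k + 1)).y
  have hb0 : 0 < 1 + A' * μ := by positivity
  have hq := quadratic_complete_square (μ := μ) (a := 1 + A * μ) (b := 1 + A' * μ) (α := α)
    (by rw [hsum]; ring) z t (s t) z' y (by rw [hz, smul_inv_smul₀ hb0.ne'])
  have hy't : y' - t = (α / A') • (z' - z) := by
    rw [hy, ht, ← smul_sub, add_sub_add_left_eq_sub, ← smul_sub, smul_smul]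
    congr 1; field_simp
  have hdesc := h.le_quadratic hL y' t
  have hconv := h.subgradient hL yk t
  have hlin : A' * inner ℝ (s t) (y' - t)
      = A * inner ℝ (s t) (yk - t) + α * inner ℝ (s t) (z' - t) := by
    rw [← real_inner_smul_right, ← real_inner_smul_right, ← real_inner_smul_right,
      ← inner_add_right]
    congr 1
    rw [hy, smul_sub, smul_inv_smul₀ hA'.ne', hsum]
    module
  have hquad : A' * (L / 2 * ‖y' - t‖ ^ 2) = (1 + A * μ) / 2 * ‖z' - z‖ ^ 2 := by
    rw [hy't, norm_smul, mul_pow, Real.norm_eq_abs, sq_abs]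
    have : A' * (L / 2 * ((α / A') ^ 2 * ‖z' - z‖ ^ 2))
      = (L * α ^ 2) / A' / 2 * ‖z' - z‖ ^ 2 := by field_simp
    rw [this, hsq]; field_simp
  have h1 : A' * ψ y' ≤ A' * ψ t + A' * inner ℝ (s t) (y' - t) + A' * (L / 2 * ‖y' - t‖ ^ 2) := by
    rw [← mul_add, ← mul_add]
    exact mul_le_mul_of_nonneg_left hdesc hA'.le
  have h2 : A * (ψ t + inner ℝ (s t) (yk - t)) ≤ A * ψ yk := mul_le_mul_of_nonneg_left hconv hA
  have h3 : 0 ≤ α * (μ / 2 * ‖z' - t‖ ^ 2) := by positivity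
  have h4 : A' * ψ t = A * ψ t + α * ψ t := by rw [hsum]; ring
  unfold model
  linarith [hq, mul_add α (inner ℝ (s t) (z' - t)) (μ / 2 * ‖z' - t‖ ^ 2)]

/-- The telescoped bound holds at every y, without the model lying below ψ. This freedom is what the
primal-dual analysis uses. -/
theorem stm_estimate (h : Cocoercive ψ s L) (hL : 0 < L) (hμ : 0 ≤ μ) (y0 : H) (N : ℕ) (y : H) :
    stmA L μ N * ψ (stm s L μ y0 N).y
        + (1 + stmA L μ N * μ) / 2 * ‖y - (stm s L μ y0 N).z‖ ^ 2
      ≤ ∑ k ∈ Finset.range N, stmAlpha L μ k * model ψ s μ (stm s L μ y0 (k + 1)).t y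
        + ‖y - y0‖ ^ 2 / 2 := by
  induction N with
  | zero =>
    simp only [stmA, stm, zero_mul, zero_add, add_zero, Finset.range_zero, Finset.sum_empty]
    linarith
  | succ N ih =>
    rw [Finset.sum_range_succ]
    linarith [stm_estimate_step h hL hμ y0 N y]

theorem sum_stmAlpha (L μ : ℝ) (N : ℕ) :
    ∑ k ∈ Finset.range N, stmAlpha L μ k = stmA L μ N := by
  induction N with
  | zero => rfl
  | succ N ih => rw [Finset.sum_range_succ, ih, stmA_succ]

/-- Convergence of the similar triangles method, when the lower model is valid at `ys`. -/
theorem stm_rate (h : Cocoercive ψ s L) (hL : 0 < L) (hμ : 0 ≤ μ) (y0 ys : H)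
    (hm : ∀ k, model ψ s μ (stm s L μ y0 (k + 1)).t ys ≤ ψ ys) (N : ℕ) :
    stmA L μ N * (ψ (stm s L μ y0 N).y - ψ ys)
        + (1 + stmA L μ N * μ) / 2 * ‖ys - (stm s L μ y0 N).z‖ ^ 2 ≤ ‖ys - y0‖ ^ 2 / 2 := by
  have h1 := stm_estimate h hL hμ y0 N ys
  have h2 : ∑ k ∈ Finset.range N, stmAlpha L μ k * model ψ s μ (stm s L μ y0 (k + 1)).t ys
      ≤ stmA L μ N * ψ ys := by
    rw [← sum_stmAlpha, Finset.sum_mul]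
    exact Finset.sum_le_sum fun k _ =>
      mul_le_mul_of_nonneg_left (hm k) (stmAlpha_pos hL hμ k).le
  linarith [mul_sub (stmA L μ N) (ψ (stm s L μ y0 N).y) (ψ ys)]

/-- The rate contains the distance of z to the minimiser, which therefore never exceeds the initial
one; y is a convex combination of the points z. -/
theorem stm_norm_sub_le (h : Cocoercive ψ s L) (hL : 0 < L) (hμ : 0 ≤ μ) (y0 ys : H)
    (hs : ∀ y, ψ ys ≤ ψ y)
    (hm : ∀ k, model ψ s μ (stm s L μ y0 (k + 1)).t ys ≤ ψ ys) (N : ℕ) :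
    ‖(stm s L μ y0 N).y - ys‖ ≤ ‖y0 - ys‖ := by
  have hz : ∀ N, ‖(stm s L μ y0 N).z - ys‖ ≤ ‖y0 - ys‖ := fun N => by
    have h1 := stm_rate h hL hμ y0 ys hm N
    have hA := stmA_nonneg hL hμ N
    have h2 : 0 ≤ stmA L μ N * (ψ (stm s L μ y0 N).y - ψ ys) :=
      mul_nonneg hA (sub_nonneg.mpr (hs _))
    have h3 : 0 ≤ stmA L μ N * μ * ‖ys - (stm s L μ y0 N).z‖ ^ 2 := by positivity
    rw [norm_sub_rev _ ys, norm_sub_rev y0]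
    refine le_of_sq_le_sq ?_ (norm_nonneg _)
    linarith
  induction N with
  | zero => exact le_rfl
  | succ N ih =>
    have hA := stmA_nonneg hL hμ N
    have hα := stmAlpha_pos hL hμ N
    have hA' := stmA_succ_pos hL hμ N
    have h1 : (stm s L μ y0 (N + 1)).y - ys = (stmA L μ (N + 1))⁻¹ •
        (stmA L μ N • ((stm s L μ y0 N).y - ys)
          + stmAlpha L μ N • ((stm s L μ y0 (N + 1)).z - ys)) := by
      rw [eq_inv_smul_iff₀ hA'.ne', smul_sub, stm_y_succ, smul_inv_smul₀ hA'.ne', stmA_succ]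
      module
    rw [h1, norm_smul, Real.norm_eq_abs, abs_of_pos (inv_pos.mpr hA'), inv_mul_le_iff₀ hA',
      stmA_succ, add_mul]
    refine (norm_add_le _ _).trans ?_
    rw [norm_smul, norm_smul, Real.norm_eq_abs, Real.norm_eq_abs, abs_of_nonneg hA,
      abs_of_pos hα]
    gcongr
    exact hz _

theorem Cocoercive.model_zero_le (h : Cocoercive ψ s L) (hL : 0 < L) (t y : H) :
    model ψ s 0 t y ≤ ψ y := by
  have := h.subgradient hL y t
  unfold model
  linarith

theorem stm_zero_rate (h : Cocoercive ψ s L) (hL : 0 < L) (y0 ys : H) {N : ℕ} (hN : 1 ≤ N) :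
    ψ (stm s L 0 y0 N).y - ψ ys ≤ 2 * L * ‖y0 - ys‖ ^ 2 / N ^ 2 := by
  have h1 := stm_rate h hL le_rfl y0 ys (fun k => h.model_zero_le hL _ _) N
  have hN0 : (0 : ℝ) < N := by exact_mod_cast hN
  -- Replacing A_N by its lower bound needs a nonnegative value gap, and `ys` is arbitrary here. The
  -- contrary assumption supplies the sign.
  by_contra! hcon
  have hpos : 0 < ψ (stm s L 0 y0 N).y - ψ ys := lt_of_le_of_lt (by positivity) hcon
  have h2 : (N : ℝ) ^ 2 / (4 * L) * (ψ (stm s L 0 y0 N).y - ψ ys)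
      ≤ stmA L 0 N * (ψ (stm s L 0 y0 N).y - ψ ys) := by
    gcongr
    exact sq_le_stmA hL N
  have h3 : (N : ℝ) ^ 2 / (4 * L) * (2 * L * ‖y0 - ys‖ ^ 2 / N ^ 2)
      < (N : ℝ) ^ 2 / (4 * L) * (ψ (stm s L 0 y0 N).y - ψ ys) := by gcongr
  have h4 : (N : ℝ) ^ 2 / (4 * L) * (2 * L * ‖y0 - ys‖ ^ 2 / N ^ 2) = ‖y0 - ys‖ ^ 2 / 2 := by
    field_simp; norm_num
  have h5 : 0 ≤ (1 + stmA L 0 N * 0) / 2 * ‖ys - (stm s L 0 y0 N).z‖ ^ 2 := by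
    rw [mul_zero]; positivity
  rw [norm_sub_rev ys y0] at h1
  linarith

end

/-! ### The gradient norm phase of OGM-G -/

theorem one_le_ogmBack (j : ℕ) : 1 + (j : ℝ) / 2 ≤ ogmBack j := by
  induction j with
  | zero => simp [ogmBack]
  | succ j ih =>
    have h1 : 2 * ogmBack j ≤ √(1 + 4 * ogmBack j ^ 2) := by
      apply Real.le_sqrt_of_sq_le; nlinarith
    unfold ogmBack
    push_cast
    linarith

theorem ogmBack_succ_sq (j : ℕ) : ogmBack (j + 1) ^ 2 - ogmBack (j + 1) = ogmBack j ^ 2 := by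
  have h := Real.sq_sqrt (show 0 ≤ 1 + 4 * ogmBack j ^ 2 by positivity)
  rw [ogmBack]
  linear_combination h / 4

theorem ogmTheta_self {N : ℕ} (hN : 1 ≤ N) : ogmTheta N N = 1 := by
  rw [ogmTheta, if_neg (by omega), Nat.sub_self, ogmBack]

theorem ogmTheta_sq {N i : ℕ} (hi : 1 ≤ i) (hiN : i < N) :
    ogmTheta N i ^ 2 - ogmTheta N i = ogmTheta N (i + 1) ^ 2 := by
  rw [ogmTheta, if_neg (by omega), ogmTheta, if_neg (by omega),
    show N - i = (N - (i + 1)) + 1 by omega, ogmBack_succ_sq]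

theorem ogmTheta_zero_sq (N : ℕ) :
    ogmTheta N 0 ^ 2 - ogmTheta N 0 = 2 * ogmTheta N 1 ^ 2 := by
  have h := Real.sq_sqrt (show 0 ≤ 1 + 8 * ogmBack (N - 1) ^ 2 by positivity)
  rw [ogmTheta, if_pos rfl, ogmTheta, if_neg one_ne_zero]
  linear_combination h / 4

theorem one_le_ogmTheta {N i : ℕ} (hi : 1 ≤ i) : 1 ≤ ogmTheta N i := by
  rw [ogmTheta, if_neg (by omega)]
  have := one_le_ogmBack (N - i)
  have h2 : (0 : ℝ) ≤ ((N - i : ℕ) : ℝ) := Nat.cast_nonneg _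
  linarith

theorem ogmTheta_zero_ge {N : ℕ} (hN : 1 ≤ N) : ((N : ℝ) + 1) ^ 2 / 2 ≤ ogmTheta N 0 ^ 2 := by
  have h := ogmTheta_zero_sq N
  have h0 : 0 ≤ ogmTheta N 0 := by rw [ogmTheta, if_pos rfl]; positivity
  have h1 : ((N : ℝ) + 1) / 2 ≤ ogmTheta N 1 := by
    rw [ogmTheta, if_neg one_ne_zero]
    have := one_le_ogmBack (N - 1)
    rw [Nat.cast_sub hN] at this
    push_cast at this
    linarith
  have h2 : (((N : ℝ) + 1) / 2) ^ 2 ≤ ogmTheta N 1 ^ 2 := by gcongr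
  linarith [show ((N : ℝ) + 1) ^ 2 / 2 = 2 * (((N : ℝ) + 1) / 2) ^ 2 by ring]

theorem ogmTheta_zero_gt_one (N : ℕ) : 1 < ogmTheta N 0 := by
  have h := ogmTheta_zero_sq N
  have h0 : 0 ≤ ogmTheta N 0 := by rw [ogmTheta, if_pos rfl]; positivity
  have h1 := one_le_ogmTheta (N := N) (i := 1) le_rfl
  by_contra! hc
  nlinarith

theorem one_lt_of_sq_sub_eq {a b : ℝ} (ha : 0 ≤ a) (hb : 1 ≤ b) (h : a ^ 2 - a = b ^ 2) :
    1 < a := by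
  by_contra! hc
  nlinarith

section

variable {H : Type*} [NormedAddCommGroup H] [InnerProductSpace ℝ H]

/-- Recursion of the momentum `p_i = x_i - y_i` of OGM-G. -/
def ogmMomentum (a b : ℝ) (p g : H) : H :=
  ((a - 1) * (2 * b - 1) / (a * (2 * a - 1))) • p - ((2 * b - 1) / a) • g

/-- The potential function of OGM-G. -/
def ogmPotential (a h : ℝ) (p x Y : H) : ℝ :=
  h / a ^ 2 + inner ℝ ((a ^ 2 / (2 * a - 1)) • p) (x - p + (a ^ 2 / (2 * a - 1)) • p - Y) / a ^ 4

/-- The decrease is an exact nonnegative combination of two interpolation inequalities: `hJ` links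
the current point to the final iterate, whose gradient step is Y, and `h` links it to the next
point. -/
theorem ogmPotential_step {a b e h' : ℝ} {p g x Y : H} (ha : 1 < a) (hb : 1 ≤ b)
    (hab : a ^ 2 - a = b ^ 2)
    (hJ : e + 1 / 2 * ‖g‖ ^ 2 + inner ℝ g (Y - x) ≤ 0) (h : h' ≤ e - 1 / 2 * ‖g‖ ^ 2) :
    ogmPotential b h' (ogmMomentum a b p g) (x - g + ogmMomentum a b p g) Y
      ≤ ogmPotential a (e + 1 / 2 * ‖g‖ ^ 2 - inner ℝ g p) p x Y := by
  have hw : (b ^ 2 / (2 * b - 1)) • ogmMomentum a b p g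
      = ((a - 1) ^ 2 / (2 * a - 1)) • p - (a - 1) • g := by
    unfold ogmMomentum
    rw [← hab, smul_sub, smul_smul, smul_smul]
    have h1 : 2 * b - 1 ≠ 0 := by linarith
    have h2 : 2 * a - 1 ≠ 0 := by linarith
    congr 2 <;> field_simp
  have h4 : b ^ 4 = (a * (a - 1)) ^ 2 := by
    rw [show b ^ 4 = (b ^ 2) ^ 2 by ring, ← hab]; ring
  unfold ogmPotential
  rw [hw, add_sub_cancel_right, h4, ← hab]
  have hB0 : 0 < 2 * a - 1 := by linarith
  have hA0 : 0 < a - 1 := by linarith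
  have hx : x - g + (((a - 1) ^ 2 / (2 * a - 1)) • p - (a - 1) • g) - Y
      = (x - Y) + ((a - 1) ^ 2 / (2 * a - 1)) • p - a • g := by module
  have hx2 : x - p + (a ^ 2 / (2 * a - 1)) • p - Y
      = (x - Y) + ((a - 1) ^ 2 / (2 * a - 1)) • p := by
    have : (a - 1) ^ 2 / (2 * a - 1) = a ^ 2 / (2 * a - 1) - 1 := by
      rw [div_sub_one hB0.ne']; ring
    rw [this]; module
  rw [hx, hx2]
  rw [← neg_sub x Y, inner_neg_right] at hJ
  have haA : a ^ 2 - a = a * (a - 1) := by ring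
  rw [haA, ← sub_nonneg]
  generalize x - Y = D at *
  simp only [inner_add_right, inner_sub_left, inner_sub_right, real_inner_smul_left,
    real_inner_smul_right, real_inner_comm g p]
  simp only [real_inner_self_eq_norm_sq]
  -- The multipliers 1/(a²(a-1)) and 1/(a(a-1)) are those for which the difference of potentials
  -- becomes an algebraic identity.
  have h1 : 0 ≤ (1 / (a ^ 2 * (a - 1))) * (-(e + 1 / 2 * ‖g‖ ^ 2 + -inner ℝ g D)) :=
    mul_nonneg (by positivity) (by linarith)
  have h2 : 0 ≤ (1 / (a * (a - 1))) * (e - 1 / 2 * ‖g‖ ^ 2 - h') :=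
    mul_nonneg (by positivity) (by linarith)
  refine le_of_le_of_eq (add_nonneg h1 h2) ?_
  generalize ‖g‖ ^ 2 = G
  generalize ‖p‖ ^ 2 = P
  generalize inner ℝ g p = c
  generalize inner ℝ p D = d
  generalize inner ℝ g D = k
  have hA' := hA0.ne'
  have hB' := hB0.ne'
  have ha0 : a ≠ 0 := by linarith
  generalize hB : 2 * a - 1 = B at *
  generalize hA : a - 1 = A at *
  field_simp
  subst hA hB
  ring

/-- The energy `ψ(x_i) - ‖g_i‖² / 2 + c_i ‖p_{i+1}‖²` does not increase. -/
theorem ogm_energy_step {a b e e' : ℝ} {p g : H} (ha : 1 < a) (hb : 1 ≤ b)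
    (hab : a ^ 2 - a = b ^ 2) (h : e + 1 / 2 * ‖g‖ ^ 2 - inner ℝ g p ≤ e') :
    e - 1 / 2 * ‖g‖ ^ 2 + (b / (2 * b - 1)) ^ 2 * ‖ogmMomentum a b p g‖ ^ 2
      ≤ e' + (a / (2 * a - 1)) ^ 2 * ‖p‖ ^ 2 := by
  have hB0 : 0 < 2 * a - 1 := by linarith
  have hb0 : 2 * b - 1 ≠ 0 := by linarith
  have ha0 : a ≠ 0 := by linarith
  have h1 : (b / (2 * b - 1)) ^ 2 * ‖ogmMomentum a b p g‖ ^ 2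
      = (b ^ 2 / a ^ 2) * ‖((a - 1) / (2 * a - 1)) • p - g‖ ^ 2 := by
    have : ogmMomentum a b p g = ((2 * b - 1) / a) • (((a - 1) / (2 * a - 1)) • p - g) := by
      unfold ogmMomentum
      rw [smul_sub, smul_smul]
      congr 2
      field_simp
    rw [this, norm_smul, mul_pow, Real.norm_eq_abs, sq_abs]
    generalize 2 * b - 1 = B at *
    field_simp
  have h2 : b ^ 2 / a ^ 2 = (a - 1) / a := by
    rw [← hab]; field_simp
  -- Sum-of-squares form of the energy decrease; `h4` checks the identity.
  have h3 : 0 ≤ 1 / a * (‖g - ((3 * a - 2) / (2 * (2 * a - 1))) • p‖ ^ 2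
      + 3 * a ^ 2 / (4 * (2 * a - 1) ^ 2) * ‖p‖ ^ 2) := by
    have : 0 < a := by linarith
    positivity
  rw [h1, h2, norm_sub_sq_real, norm_smul, real_inner_smul_left, mul_pow, Real.norm_eq_abs,
    sq_abs, real_inner_comm]
  rw [norm_sub_sq_real, norm_smul, real_inner_smul_right, mul_pow, Real.norm_eq_abs,
    sq_abs] at h3
  generalize ‖g‖ ^ 2 = G at *
  generalize ‖p‖ ^ 2 = P at *
  generalize inner ℝ g p = c at *
  have h4 : (a / (2 * a - 1)) ^ 2 * P - (c - G) - (a - 1) / a * (((a - 1) / (2 * a - 1)) ^ 2 * P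
      - 2 * ((a - 1) / (2 * a - 1) * c) + G) = 1 / a * (G
      - 2 * ((3 * a - 2) / (2 * (2 * a - 1)) * c)
      + ((3 * a - 2) / (2 * (2 * a - 1))) ^ 2 * P + 3 * a ^ 2 / (4 * (2 * a - 1) ^ 2) * P) := by
    have hB' := hB0.ne'
    generalize hB : 2 * a - 1 = B at *
    field_simp
    subst hB
    ring
  linarith

/-- Solving the momentum recursion for g expresses a gradient by two successive momenta, with
coefficients at most 1/2 and 2. Bounded momenta thus bound the gradient steps. -/
theorem norm_le_of_ogmMomentum {a b : ℝ} {p g : H} (ha : 1 < a) (hb : 1 ≤ b)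
    (hab : a ≤ 2 * (2 * b - 1)) :
    ‖g‖ ≤ ‖p‖ / 2 + 2 * ‖ogmMomentum a b p g‖ := by
  have hB0 : 0 < 2 * a - 1 := by linarith
  have hb0 : 0 < 2 * b - 1 := by linarith
  have ha0 : 0 < a := by linarith
  have h1 : g = ((a - 1) / (2 * a - 1)) • p - (a / (2 * b - 1)) • ogmMomentum a b p g := by
    unfold ogmMomentum
    rw [smul_sub, smul_smul, smul_smul]
    have h2 : a / (2 * b - 1) * ((2 * b - 1) / a) = 1 := by field_simp
    have h3 : a / (2 * b - 1) * ((a - 1) * (2 * b - 1) / (a * (2 * a - 1)))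
        = (a - 1) / (2 * a - 1) := by field_simp
    rw [h2, h3]; module
  have h4 : ‖((a - 1) / (2 * a - 1)) • p‖ ≤ ‖p‖ / 2 := by
    rw [norm_smul, Real.norm_eq_abs, abs_of_nonneg (div_nonneg (by linarith) hB0.le)]
    have : (a - 1) / (2 * a - 1) ≤ 1 / 2 := by rw [div_le_div_iff₀ hB0 two_pos]; linarith
    nlinarith [norm_nonneg p]
  have h5 : ‖(a / (2 * b - 1)) • ogmMomentum a b p g‖ ≤ 2 * ‖ogmMomentum a b p g‖ := by
    rw [norm_smul, Real.norm_eq_abs, abs_of_nonneg (by positivity)]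
    gcongr
    rw [div_le_iff₀ hb0]; exact hab
  calc ‖g‖ = ‖((a - 1) / (2 * a - 1)) • p - (a / (2 * b - 1)) • ogmMomentum a b p g‖ :=
        congrArg _ h1
    _ ≤ _ := (norm_sub_le _ _).trans (add_le_add h4 h5)

variable {ψ : H → ℝ} {s : H → H} {L : ℝ}

/-- The interpolation inequality for L = 1, rewritten around the gradient step y - s y, the form in
which OGM-G uses it. -/
theorem Cocoercive.shift (h : Cocoercive ψ s 1) (y y' : H) :
    ψ y' + 1 / 2 * ‖s y'‖ ^ 2 + inner ℝ (s y') (y - s y - y') ≤ ψ y - 1 / 2 * ‖s y‖ ^ 2 := by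
  have h1 := h y y'
  have h2 : y - s y - y' = (y - y') - s y := by abel
  have h3 := real_inner_comm (s y) (s y')
  rw [norm_sub_sq_real] at h1
  rw [h2, inner_sub_right (s y') (y - y')]
  linarith

theorem Cocoercive.normalize (h : Cocoercive ψ s L) (hL : 0 < L) :
    Cocoercive (fun y => ψ y / L) (fun y => L⁻¹ • s y) 1 := by
  intro y y'
  have h1 := h y y'
  rw [← smul_sub, norm_smul, mul_pow, Real.norm_eq_abs, sq_abs, real_inner_smul_left,
    le_div_iff₀ hL]
  refine le_of_eq_of_le ?_ h1
  field_simp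

theorem ogmPhase_normalize (s : H → H) (L : ℝ) (N : ℕ) (x0 : H) (i : ℕ) :
    ogmPhase (fun y => L⁻¹ • s y) 1 N x0 i = ogmPhase s L N x0 i := by
  induction i with
  | zero => rfl
  | succ i ih => simp only [ogmPhase, ih, ogmStep, inv_one, one_smul]

/-! ### Iterates of OGM-G, normalised to smoothness constant 1 -/

section Sequence

variable {N : ℕ} {x0 : H}

theorem ogmPhase_x_succ (s : H → H) (i : ℕ) :
    (ogmPhase s 1 N x0 (i + 1)).x = (ogmPhase s 1 N x0 i).x - s (ogmPhase s 1 N x0 i).x +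
      ((ogmPhase s 1 N x0 (i + 1)).x - (ogmPhase s 1 N x0 (i + 1)).y) := by
  simp only [ogmPhase, ogmStep, inv_one, one_smul]
  abel

theorem ogmPhase_momentum_succ (s : H → H) (i : ℕ) (ha : 1 < ogmTheta N i) :
    (ogmPhase s 1 N x0 (i + 1)).x - (ogmPhase s 1 N x0 (i + 1)).y
      = ogmMomentum (ogmTheta N i) (ogmTheta N (i + 1))
        ((ogmPhase s 1 N x0 i).x - (ogmPhase s 1 N x0 i).y) (s (ogmPhase s 1 N x0 i).x) := by
  simp only [ogmPhase, ogmStep, inv_one, one_smul, ogmMomentum]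
  generalize (ogmPhase s 1 N x0 i).x = x
  generalize (ogmPhase s 1 N x0 i).y = y
  generalize ogmTheta N (i + 1) = b
  generalize ogmTheta N i = a at *
  have h1 : a ≠ 0 := by linarith
  have h2 : 2 * a - 1 ≠ 0 := by linarith
  have h3 : (2 * b - 1) / a = (a - 1) * (2 * b - 1) / (a * (2 * a - 1))
      + (2 * b - 1) / (2 * a - 1) := by
    generalize hB : 2 * a - 1 = B at *
    field_simp
    subst hB
    ring
  rw [h3]
  module

theorem ogmTheta_gt_one {i : ℕ} (hi : 1 ≤ i) (hiN : i < N) : 1 < ogmTheta N i :=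
  one_lt_of_sq_sub_eq (zero_le_one.trans (one_le_ogmTheta hi)) (one_le_ogmTheta (by omega))
    (ogmTheta_sq hi hiN)

/-- The gradient step from x_i is y_{i+1}, so the shifted inequality between consecutive points
involves only the momentum x_{i+1} - y_{i+1}. -/
theorem Cocoercive.ogm_descent (h : Cocoercive ψ s 1) (i : ℕ) :
    ψ (ogmPhase s 1 N x0 (i + 1)).x + 1 / 2 * ‖s (ogmPhase s 1 N x0 (i + 1)).x‖ ^ 2
      - inner ℝ (s (ogmPhase s 1 N x0 (i + 1)).x)
        ((ogmPhase s 1 N x0 (i + 1)).x - (ogmPhase s 1 N x0 (i + 1)).y)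
      ≤ ψ (ogmPhase s 1 N x0 i).x - 1 / 2 * ‖s (ogmPhase s 1 N x0 i).x‖ ^ 2 := by
  have h1 := h.shift (ogmPhase s 1 N x0 i).x (ogmPhase s 1 N x0 (i + 1)).x
  have h2 : (ogmPhase s 1 N x0 i).x - s (ogmPhase s 1 N x0 i).x - (ogmPhase s 1 N x0 (i + 1)).x
      = -((ogmPhase s 1 N x0 (i + 1)).x - (ogmPhase s 1 N x0 (i + 1)).y) := by
    have hx := ogmPhase_x_succ (N := N) (x0 := x0) s i
    generalize (ogmPhase s 1 N x0 (i + 1)).x - (ogmPhase s 1 N x0 (i + 1)).y = D at *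
    rw [hx]
    abel
  rw [h2, inner_neg_right] at h1
  linarith

/-- The reference value and the point Y are built from the last iterate, so they stay fixed along
the run and the potential decreases from index 1 to N. -/
theorem ogmPotential_le (h : Cocoercive ψ s 1) {k : ℕ} (hk : 1 ≤ k) (hkN : k ≤ N) :
    ogmPotential (ogmTheta N k)
      (ψ (ogmPhase s 1 N x0 k).x - (ψ (ogmPhase s 1 N x0 N).x
        - 1 / 2 * ‖s (ogmPhase s 1 N x0 N).x‖ ^ 2) + 1 / 2 * ‖s (ogmPhase s 1 N x0 k).x‖ ^ 2
        - inner ℝ (s (ogmPhase s 1 N x0 k).x)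
          ((ogmPhase s 1 N x0 k).x - (ogmPhase s 1 N x0 k).y))
      ((ogmPhase s 1 N x0 k).x - (ogmPhase s 1 N x0 k).y) (ogmPhase s 1 N x0 k).x
      ((ogmPhase s 1 N x0 N).x - s (ogmPhase s 1 N x0 N).x)
    ≤ 2 / ogmTheta N 0 ^ 2 * (ψ x0 - (ψ (ogmPhase s 1 N x0 N).x
        - 1 / 2 * ‖s (ogmPhase s 1 N x0 N).x‖ ^ 2)) := by
  have hN : 1 ≤ N := hk.trans hkN
  have hJ := fun k => h.shift (ogmPhase s 1 N x0 N).x (ogmPhase s 1 N x0 k).x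
  set Y := (ogmPhase s 1 N x0 N).x - s (ogmPhase s 1 N x0 N).x with hY
  set eN := ψ (ogmPhase s 1 N x0 N).x - 1 / 2 * ‖s (ogmPhase s 1 N x0 N).x‖ ^ 2 with heN
  clear_value Y eN
  induction k, hk using Nat.le_induction with
  -- The relation between θ_0 and θ_1 carries a factor 2 and the initial momentum is zero, so the
  -- first step needs its own certificate, from the same two kinds of inequality.
  | base =>
    have ha := ogmTheta_zero_gt_one N
    have hp := ogmPhase_momentum_succ (x0 := x0) s 0 ha
    have hx := ogmPhase_x_succ (N := N) (x0 := x0) s 0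
    have hd := h.ogm_descent (N := N) (x0 := x0) 0
    have hab := ogmTheta_zero_sq N
    have hb := one_le_ogmTheta (N := N) (i := 1) le_rfl
    have hJ0 := hJ 0
    simp only [zero_add] at hp hx hd
    rw [hp] at hx hd ⊢
    simp only [ogmPhase] at hx hd hp hJ0 ⊢
    set x1 := (ogmStep 1 N 0 (s x0) ⟨x0, x0⟩).x
    rw [sub_self] at hx hd ⊢
    set a := ogmTheta N 0
    set b := ogmTheta N 1
    have hm : ogmMomentum a b (0 : H) (s x0) = -(((2 * b - 1) / a) • s x0) := by
      simp [ogmMomentum]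
    have hw : (b ^ 2 / (2 * b - 1)) • ogmMomentum a b (0 : H) (s x0)
        = -(((a - 1) / 2) • s x0) := by
      rw [hm, smul_neg, smul_smul]
      congr 2
      have h1 : 2 * b - 1 ≠ 0 := by linarith
      have h2 : a ≠ 0 := by linarith
      generalize 2 * b - 1 = B at *
      field_simp
      linear_combination (-1 : ℝ) * hab
    unfold ogmPotential
    rw [hw, hx, add_sub_cancel_right, ← hx]
    have h3 : x0 - s x0 + -(((a - 1) / 2) • s x0) - Y
        = -((Y - x0) + ((a + 1) / 2) • s x0) := by module
    rw [h3, inner_neg_neg, real_inner_smul_left, inner_add_right, real_inner_smul_right,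
      real_inner_self_eq_norm_sq]
    have hb2 : b ^ 2 = a * (a - 1) / 2 := by linear_combination (-1 / 2 : ℝ) * hab
    have hb4 : b ^ 4 = (a * (a - 1) / 2) ^ 2 := by rw [← hb2]; ring
    have hJ0' : ψ x0 + 1 / 2 * ‖s x0‖ ^ 2 + inner ℝ (s x0) (Y - x0) ≤ eN := hJ0
    have hd' : ψ x1 - eN + 1 / 2 * ‖s x1‖ ^ 2 - inner ℝ (s x1) (ogmMomentum a b 0 (s x0))
        ≤ ψ x0 - 1 / 2 * ‖s x0‖ ^ 2 - eN := by linarith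
    generalize ψ x1 - eN + 1 / 2 * ‖s x1‖ ^ 2
      - inner ℝ (s x1) (ogmMomentum a b 0 (s x0)) = hh at *
    rw [hb2, hb4]
    generalize inner ℝ (s x0) (Y - x0) = c at *
    generalize ‖s x0‖ ^ 2 = G at *
    generalize ψ x0 = e at *
    have hA0 : 0 < a - 1 := by linarith
    have h4 : 0 ≤ (2 / (a * (a - 1))) * (e - 1 / 2 * G - eN - hh) :=
      mul_nonneg (by positivity) (by linarith)
    have h5 : 0 ≤ (2 / (a ^ 2 * (a - 1))) * (eN - (e + 1 / 2 * G + c)) :=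
      mul_nonneg (by positivity) (by linarith)
    rw [← sub_nonneg]
    refine le_of_le_of_eq (add_nonneg h4 h5) ?_
    have hA' := hA0.ne'
    have ha0 : a ≠ 0 := by linarith
    generalize hA : a - 1 = A at *
    field_simp
    subst hA
    ring
  | succ k hk ih =>
    refine le_trans ?_ (ih (by omega))
    have ha := ogmTheta_gt_one (N := N) hk (by omega)
    have hb := one_le_ogmTheta (N := N) (i := k + 1) (by omega)
    have hab := ogmTheta_sq (N := N) hk (by omega)
    have hp := ogmPhase_momentum_succ (x0 := x0) s k ha
    have hx := ogmPhase_x_succ (N := N) (x0 := x0) s k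
    have hd := h.ogm_descent (N := N) (x0 := x0) k
    have hstep := ogmPotential_step (p := (ogmPhase s 1 N x0 k).x - (ogmPhase s 1 N x0 k).y)
      (g := s (ogmPhase s 1 N x0 k).x) (x := (ogmPhase s 1 N x0 k).x) (Y := Y)
      (e := ψ (ogmPhase s 1 N x0 k).x - eN) ha hb hab (by linarith [hJ k])
      (h' := ψ (ogmPhase s 1 N x0 (k + 1)).x - eN
        + 1 / 2 * ‖s (ogmPhase s 1 N x0 (k + 1)).x‖ ^ 2
        - inner ℝ (s (ogmPhase s 1 N x0 (k + 1)).x)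
          ((ogmPhase s 1 N x0 (k + 1)).x - (ogmPhase s 1 N x0 (k + 1)).y)) (by linarith)
    rw [← hp, ← hx] at hstep
    exact hstep

/-- At the last index θ_N = 1 the inner products cancel and the potential is exactly the squared
gradient norm. The reference value is at least m, by the gradient step bound. -/
theorem ogm_norm_sq_le_of_one (h : Cocoercive ψ s 1) (hN : 1 ≤ N) {m : ℝ} (hm : ∀ y, m ≤ ψ y) :
    ‖s (ogmPhase s 1 N x0 N).x‖ ^ 2 ≤ 2 / ogmTheta N 0 ^ 2 * (ψ x0 - m) := by
  have h1 := ogmPotential_le (x0 := x0) h hN le_rfl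
  have h2 := h.norm_sq_le one_pos hm (ogmPhase s 1 N x0 N).x
  rw [ogmTheta_self hN] at h1
  generalize (ogmPhase s 1 N x0 N).x = x at *
  generalize (ogmPhase s 1 N x0 N).y = y at *
  have h3 : ogmPotential 1 (ψ x - (ψ x - 1 / 2 * ‖s x‖ ^ 2) + 1 / 2 * ‖s x‖ ^ 2
      - inner ℝ (s x) (x - y)) (x - y) x (x - s x) = ‖s x‖ ^ 2 := by
    unfold ogmPotential
    have : ((1 : ℝ) ^ 2 / (2 * 1 - 1)) = 1 := by norm_num
    rw [this, one_smul, sub_add_cancel, sub_sub_cancel x, real_inner_comm]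
    ring
  rw [h3] at h1
  refine h1.trans ?_
  gcongr
  linarith

/-- In the monotone energy, the part ψ - ‖g‖²/2 is at least m and the coefficient of the squared
momentum is at least 1/4. -/
theorem ogm_momentum_le_of_one (h : Cocoercive ψ s 1) {m : ℝ} (hm : ∀ y, m ≤ ψ y)
    {i : ℕ} (hi : i < N) :
    ‖(ogmPhase s 1 N x0 (i + 1)).x - (ogmPhase s 1 N x0 (i + 1)).y‖ ^ 2 ≤ 4 * (ψ x0 - m) := by
  have hN : 1 ≤ N := by omega
  have key : ψ (ogmPhase s 1 N x0 i).x - 1 / 2 * ‖s (ogmPhase s 1 N x0 i).x‖ ^ 2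
      + (ogmTheta N (i + 1) / (2 * ogmTheta N (i + 1) - 1)) ^ 2 *
        ‖(ogmPhase s 1 N x0 (i + 1)).x - (ogmPhase s 1 N x0 (i + 1)).y‖ ^ 2 ≤ ψ x0 := by
    induction i with
    | zero =>
      have ha := ogmTheta_zero_gt_one N
      have hb := one_le_ogmTheta (N := N) (i := 1) le_rfl
      have hab := ogmTheta_zero_sq N
      have hp := ogmPhase_momentum_succ (x0 := x0) s 0 ha
      rw [hp]
      simp only [ogmPhase, sub_self, zero_add, ogmMomentum, smul_zero, zero_sub, norm_neg]
      rw [norm_smul, mul_pow, Real.norm_eq_abs, sq_abs]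
      have h1 : 2 * ogmTheta N 1 - 1 ≠ 0 := by linarith
      have h2 : ogmTheta N 0 ≠ 0 := by linarith
      have h3 : (ogmTheta N 1 / (2 * ogmTheta N 1 - 1)) ^ 2
          * (((2 * ogmTheta N 1 - 1) / ogmTheta N 0) ^ 2 * ‖s x0‖ ^ 2)
          = ogmTheta N 1 ^ 2 / ogmTheta N 0 ^ 2 * ‖s x0‖ ^ 2 := by
        generalize 2 * ogmTheta N 1 - 1 = B at *
        field_simp
      have h4 : ogmTheta N 1 ^ 2 / ogmTheta N 0 ^ 2 ≤ 1 / 2 := by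
        rw [div_le_div_iff₀ (by positivity) two_pos]; linarith
      rw [h3]
      nlinarith [sq_nonneg ‖s x0‖]
    | succ i ih =>
      have ha := ogmTheta_gt_one (N := N) (i := i + 1) (by omega) hi
      have hb := one_le_ogmTheta (N := N) (i := i + 1 + 1) (by omega)
      have hab := ogmTheta_sq (N := N) (i := i + 1) (by omega) hi
      have hp := ogmPhase_momentum_succ (x0 := x0) s (i + 1) ha
      have hd := h.ogm_descent (N := N) (x0 := x0) i
      rw [hp]
      exact (ogm_energy_step ha hb hab hd).trans (ih (by omega))
  have h1 := h.norm_sq_le one_pos hm (ogmPhase s 1 N x0 i).x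
  have hb := one_le_ogmTheta (N := N) (i := i + 1) (by omega)
  have h2 : (1 / 2 : ℝ) ≤ ogmTheta N (i + 1) / (2 * ogmTheta N (i + 1) - 1) := by
    rw [div_le_div_iff₀ two_pos (by linarith)]; linarith
  have h3 : (1 / 2 : ℝ) ^ 2 ≤ (ogmTheta N (i + 1) / (2 * ogmTheta N (i + 1) - 1)) ^ 2 := by
    gcongr
  have h4 := mul_le_mul_of_nonneg_right h3
    (sq_nonneg ‖(ogmPhase s 1 N x0 (i + 1)).x - (ogmPhase s 1 N x0 (i + 1)).y‖)
  linarith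

/-- This bounds the coefficient of the new momentum in `norm_le_of_ogmMomentum`. Equality occurs for
N = 1, where θ_0 = 2 and θ_1 = 1. -/
theorem ogmTheta_le {i : ℕ} (hi : i < N) :
    ogmTheta N i ≤ 2 * (2 * ogmTheta N (i + 1) - 1) := by
  have hb := one_le_ogmTheta (N := N) (i := i + 1) (by omega)
  by_contra! hc
  rcases Nat.eq_zero_or_pos i with rfl | hi0
  · have hab := ogmTheta_zero_sq N
    rw [zero_add] at *
    nlinarith
  · have hab := ogmTheta_sq hi0 hi
    nlinarith

/-- A step is a momentum minus a gradient, of norm at most r + (r/2 + 2r) = 7r/2. -/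
theorem ogm_norm_sub_le_of_one (h : Cocoercive ψ s 1) {m r : ℝ} (hm : ∀ y, m ≤ ψ y)
    (hr : 0 ≤ r) (hr2 : 4 * (ψ x0 - m) ≤ r ^ 2) {i : ℕ} (hi : i ≤ N) :
    ‖(ogmPhase s 1 N x0 i).x - x0‖ ≤ i * (7 / 2 * r) := by
  have hp : ∀ i ≤ N, ‖(ogmPhase s 1 N x0 i).x - (ogmPhase s 1 N x0 i).y‖ ≤ r := by
    intro i hi
    rcases i with _ | i
    · simpa [ogmPhase] using hr
    · exact le_of_sq_le_sq ((ogm_momentum_le_of_one h hm (by omega)).trans hr2) hr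
  induction i with
  | zero => simp [ogmPhase]
  | succ i ih =>
    have ha : 1 < ogmTheta N i := by
      rcases Nat.eq_zero_or_pos i with rfl | hi0
      · exact ogmTheta_zero_gt_one N
      · exact ogmTheta_gt_one hi0 (by omega)
    have h1 := norm_le_of_ogmMomentum (p := (ogmPhase s 1 N x0 i).x - (ogmPhase s 1 N x0 i).y)
      (g := s (ogmPhase s 1 N x0 i).x) ha (one_le_ogmTheta (N := N) (i := i + 1) (by omega))
      (ogmTheta_le (N := N) (by omega))
    rw [← ogmPhase_momentum_succ s i ha] at h1
    have h2 := hp i (by omega)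
    have h3 := hp (i + 1) hi
    have h4 : (ogmPhase s 1 N x0 (i + 1)).x - x0 = ((ogmPhase s 1 N x0 i).x - x0)
        + (((ogmPhase s 1 N x0 (i + 1)).x - (ogmPhase s 1 N x0 (i + 1)).y)
          - s (ogmPhase s 1 N x0 i).x) := by
      nth_rw 1 [ogmPhase_x_succ]
      abel
    rw [h4]
    refine (norm_add_le _ _).trans ?_
    have h5 := norm_sub_le ((ogmPhase s 1 N x0 (i + 1)).x - (ogmPhase s 1 N x0 (i + 1)).y)
      (s (ogmPhase s 1 N x0 i).x)
    have h6 := ih (by omega)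
    push_cast
    linarith

end Sequence

end

theorem norm_le_two_mul_of_norm_sub_le {H : Type*} [NormedAddCommGroup H] {y ys : H}
    (h : ‖y - ys‖ ≤ ‖(0 : H) - ys‖) :
    ‖y‖ ≤ 2 * ‖ys‖ := by
  rw [zero_sub, norm_neg] at h
  have := norm_add_le (y - ys) ys
  rw [sub_add_cancel] at this
  linarith

/-! ### Rates of OGM-G and of its restarts -/

section

variable {H : Type*} [NormedAddCommGroup H] [InnerProductSpace ℝ H]
  {ψ : H → ℝ} {s : H → H} {L : ℝ}

theorem Cocoercive.stm_zero_norm_sub_le (h : Cocoercive ψ s L) (hL : 0 < L) {ys : H}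
    (hs : ∀ y, ψ ys ≤ ψ y) (y0 : H) (N : ℕ) : ‖(stm s L 0 y0 N).y - ys‖ ≤ ‖y0 - ys‖ :=
  stm_norm_sub_le h hL le_rfl y0 ys hs (fun _ => h.model_zero_le hL _ _) N

/-- The rate of OGM-G for the gradient norm. -/
theorem norm_gradient_ogmG_le (h : Cocoercive ψ s L) (hL : 0 < L) {ys : H}
    (hs : ∀ y, ψ ys ≤ ψ y) (y0 : H) {N : ℕ} (hN : 1 ≤ N) :
    ‖s (ogmG s L N y0)‖ ≤ 3 * L * ‖y0 - ys‖ / N ^ 2 := by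
  have h1 := ogm_norm_sq_le_of_one (x0 := (stm s L 0 y0 N).y) (h.normalize hL) hN
    (m := ψ ys / L) (fun y => by have := hs y; gcongr)
  rw [ogmPhase_normalize, norm_smul, mul_pow, Real.norm_eq_abs, sq_abs] at h1
  have h2 := stm_zero_rate h hL y0 ys hN
  have h3 := ogmTheta_zero_ge hN
  have hN0 : (0 : ℝ) < N := by exact_mod_cast hN
  change ‖s (ogmPhase s L N (stm s L 0 y0 N).y N).x‖ ≤ _
  have hd : 0 ≤ ψ (stm s L 0 y0 N).y - ψ ys := sub_nonneg.mpr (hs _)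
  have h4 : (N : ℝ) ^ 2 / 2 ≤ ogmTheta N 0 ^ 2 := by nlinarith
  refine le_of_sq_le_sq ?_ (by positivity)
  -- The value gap 2LD²/N² and θ_0² ≥ N²/2 give a squared norm of at most 8L²D²/N⁴; √8 is rounded up
  -- to 3.
  have h5 : L⁻¹ ^ 2 * ‖s (ogmPhase s L N (stm s L 0 y0 N).y N).x‖ ^ 2
      ≤ 2 / ((N : ℝ) ^ 2 / 2) * (2 * L * ‖y0 - ys‖ ^ 2 / N ^ 2 / L) := by
    refine h1.trans ?_
    rw [← sub_div]
    gcongr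
  have h6 : 2 / ((N : ℝ) ^ 2 / 2) * (2 * L * ‖y0 - ys‖ ^ 2 / N ^ 2 / L)
      = L⁻¹ ^ 2 * (8 * L ^ 2 * ‖y0 - ys‖ ^ 2 / N ^ 4) := by
    field_simp; ring
  rw [h6] at h5
  refine (le_of_mul_le_mul_left h5 (by positivity)).trans ?_
  rw [div_pow, mul_pow, mul_pow, ← pow_mul]
  gcongr
  norm_num

/-- The output of OGM-G stays near the minimizer. -/
theorem norm_ogmG_sub_le (h : Cocoercive ψ s L) (hL : 0 < L) {ys : H}
    (hs : ∀ y, ψ ys ≤ ψ y) (y0 : H) {N : ℕ} (hN : 1 ≤ N) :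
    ‖ogmG s L N y0 - ys‖ ≤ 12 * ‖y0 - ys‖ := by
  have hN0 : (0 : ℝ) < N := by exact_mod_cast hN
  have h2 := stm_zero_rate h hL y0 ys hN
  -- The choice r = 3D/N dominates the momentum bound √8 D/N. Then N steps travel at most 21D/2 from
  -- a point within D of the minimiser, less than 12D in total.
  have h1 := ogm_norm_sub_le_of_one (x0 := (stm s L 0 y0 N).y) (h.normalize hL)
    (m := ψ ys / L) (r := 3 * ‖y0 - ys‖ / N) (fun y => by have := hs y; gcongr) (by positivity)
    (by
      rw [← sub_div]
      have h3 : 4 * ((ψ (stm s L 0 y0 N).y - ψ ys) / L)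
          ≤ 4 * ((2 * L * ‖y0 - ys‖ ^ 2 / N ^ 2) / L) := by gcongr
      refine h3.trans ?_
      have h4 : 4 * ((2 * L * ‖y0 - ys‖ ^ 2 / N ^ 2) / L) = 8 * ‖y0 - ys‖ ^ 2 / N ^ 2 := by
        field_simp; ring
      rw [h4, div_pow, mul_pow]
      gcongr
      norm_num) (le_refl N)
  rw [ogmPhase_normalize] at h1
  have h3 := h.stm_zero_norm_sub_le hL hs y0 N
  have h4 : (N : ℝ) * (7 / 2 * (3 * ‖y0 - ys‖ / N)) = 21 / 2 * ‖y0 - ys‖ := by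
    field_simp; ring
  rw [h4] at h1
  have h5 := norm_add_le (ogmG s L N y0 - (stm s L 0 y0 N).y) ((stm s L 0 y0 N).y - ys)
  rw [sub_add_sub_cancel] at h5
  change ‖ogmG s L N y0 - (stm s L 0 y0 N).y‖ ≤ _ at h1
  linarith [norm_nonneg (y0 - ys)]

section Submodule

variable {K : Submodule ℝ H}

/-- Strong convexity of the dual holds only on a subspace. The updates are linear combinations, so
the iterates stay in any subspace containing the start and all gradients. -/
theorem stm_mem (hK : ∀ y, s y ∈ K) {L μ : ℝ} {y0 : H} (h0 : y0 ∈ K) (N : ℕ) :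
    (stm s L μ y0 N).y ∈ K ∧ (stm s L μ y0 N).z ∈ K ∧ (stm s L μ y0 N).t ∈ K := by
  induction N with
  | zero => exact ⟨h0, h0, h0⟩
  | succ N ih =>
    obtain ⟨hy, hz, ht⟩ := ih
    have ht' : (stm s L μ y0 (N + 1)).t ∈ K := by
      rw [stm_t_succ]
      exact K.smul_mem _ (K.add_mem (K.smul_mem _ hy) (K.smul_mem _ hz))
    have hz' : (stm s L μ y0 (N + 1)).z ∈ K := by
      rw [stm_z_succ]
      exact K.smul_mem _ (K.sub_mem (K.smul_mem _ hz)
        (K.smul_mem _ (K.sub_mem (hK _) (K.smul_mem _ ht'))))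
    refine ⟨?_, hz', ht'⟩
    rw [stm_y_succ]
    exact K.smul_mem _ (K.add_mem (K.smul_mem _ hy) (K.smul_mem _ hz'))

theorem ogmPhase_mem (hK : ∀ y, s y ∈ K) {L : ℝ} {x0 : H} (h0 : x0 ∈ K) (N i : ℕ) :
    (ogmPhase s L N x0 i).x ∈ K ∧ (ogmPhase s L N x0 i).y ∈ K := by
  induction i with
  | zero => exact ⟨h0, h0⟩
  | succ i ih =>
    obtain ⟨hx, hy⟩ := ih
    have hy' : (ogmPhase s L N x0 (i + 1)).y ∈ K := K.sub_mem hx (K.smul_mem _ (hK _))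
    refine ⟨?_, hy'⟩
    exact K.add_mem (K.add_mem hy' (K.smul_mem _ (K.sub_mem hy' hy)))
      (K.smul_mem _ (K.sub_mem hy' hx))

theorem rogmG_mem (hK : ∀ y, s y ∈ K) {L : ℝ} {N : ℕ} {y0 : H}
    (h0 : y0 ∈ K) (l : ℕ) : rogmG s L N y0 l ∈ K := by
  induction l with
  | zero => exact h0
  | succ l ih => exact (ogmPhase_mem hK (stm_mem hK ih N).1 N N).1

end Submodule

/-- Restarts of OGM-G halve the gradient, for a function that is strongly convex on a subspace. -/
theorem norm_gradient_rogmG_le (h : Cocoercive ψ s L) (hL : 0 < L) {ys : H}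
    (hs : ∀ y, ψ ys ≤ ψ y) {K : Submodule ℝ H} (hK : ∀ y, s y ∈ K) {m : ℝ} (hm : 0 < m)
    (hsc : ∀ y ∈ K, m * ‖y - ys‖ ≤ ‖s y‖) {y0 : H} (h0 : y0 ∈ K) {N : ℕ} (hN : 1 ≤ N)
    (hN2 : 6 * (L / m) ≤ (N : ℝ) ^ 2) (l : ℕ) :
    ‖s (rogmG s L N y0 l)‖ ≤ (1 / 2) ^ l * ‖s y0‖ := by
  have hN0 : (0 : ℝ) < N := by exact_mod_cast hN
  induction l with
  | zero => rw [pow_zero, one_mul]; exact le_rfl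
  | succ l ih =>
    have h1 := norm_gradient_ogmG_le h hL hs (rogmG s L N y0 l) hN
    have h2 := hsc _ (rogmG_mem hK (L := L) (N := N) h0 l)
    refine h1.trans ?_
    rw [div_le_iff₀ (by positivity), pow_succ]
    set D := ‖rogmG s L N y0 l - ys‖
    -- The condition N² ≥ 6L/m turns the rate 3LD/N² into mD/2, and mD is at most the current
    -- gradient norm.
    have h3 : 3 * L * D ≤ 1 / 2 * (N : ℝ) ^ 2 * (m * D) := by
      have h4 : 6 * (L / m) * (m * D) ≤ (N : ℝ) ^ 2 * (m * D) := by gcongr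
      have h5 : 6 * (L / m) * (m * D) = 6 * L * D := by field_simp
      linarith
    have h4 : 1 / 2 * (N : ℝ) ^ 2 * (m * D) ≤ 1 / 2 * (N : ℝ) ^ 2 * ((1 / 2) ^ l * ‖s y0‖) := by
      exact mul_le_mul_of_nonneg_left (h2.trans ih) (by positivity)
    linarith

end

/-! ### The spectrum of the Laplacian -/

section Spectrum

open Matrix

variable {V : Type u} [Fintype V] [DecidableEq V] (G : SimpleGraph V) [DecidableRel G.Adj]

/-- The eigenvalues of the Laplacian. -/
def lapEig : V → ℝ := (G.posSemidef_lapMatrix ℝ).1.eigenvalues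

theorem spectrum_lap : spectrum ℝ (G.lapMatrix ℝ) = Set.range (lapEig G) :=
  (G.posSemidef_lapMatrix ℝ).1.spectrum_real_eq_range_eigenvalues

theorem lapEig_nonneg (i : V) : 0 ≤ lapEig G i := (G.posSemidef_lapMatrix ℝ).eigenvalues_nonneg i

theorem lapEig_le_lamMax (i : V) : lapEig G i ≤ lamMax G := by
  unfold lamMax
  rw [spectrum_lap]
  exact le_csSup (Set.finite_range _).bddAbove ⟨i, rfl⟩

theorem lamMinPos_le_lapEig {i : V} (hi : 0 < lapEig G i) : lamMinPos G ≤ lapEig G i := by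
  unfold lamMinPos
  rw [spectrum_lap]
  exact csInf_le ⟨0, fun x hx => hx.2.le⟩ ⟨⟨i, rfl⟩, hi⟩

/-- Coefficients in the basis of eigenvectors of the Laplacian. -/
def lapCoef (v : V → ℝ) (i : V) : ℝ :=
  inner ℝ ((G.posSemidef_lapMatrix ℝ).1.eigenvectorBasis i) (WithLp.toLp 2 v)

theorem sum_lapCoef_mul (v w : V → ℝ) : ∑ i, lapCoef G v i * lapCoef G w i = v ⬝ᵥ w := by
  have h := (G.posSemidef_lapMatrix ℝ).1.eigenvectorBasis.sum_inner_mul_inner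
    (WithLp.toLp 2 v) (WithLp.toLp 2 w)
  have h2 : inner ℝ (WithLp.toLp 2 v) (WithLp.toLp 2 w : EuclideanSpace ℝ V) = v ⬝ᵥ w := by
    simp [PiLp.inner_apply, dotProduct, mul_comm]
  rw [← h2, ← h]
  refine Finset.sum_congr rfl fun i _ => ?_
  rw [lapCoef, lapCoef, real_inner_comm]

theorem lapCoef_mulVec (v : V → ℝ) (i : V) :
    lapCoef G (G.lapMatrix ℝ *ᵥ v) i = lapEig G i * lapCoef G v i := by
  have h := (G.posSemidef_lapMatrix ℝ).1.mulVec_eigenvectorBasis i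
  set b := (G.posSemidef_lapMatrix ℝ).1.eigenvectorBasis i with hb
  have h1 : ∀ w : V → ℝ, lapCoef G w i = (b : V → ℝ) ⬝ᵥ w := fun w => by
    rw [lapCoef, ← hb]
    simp [PiLp.inner_apply, dotProduct, mul_comm]
  rw [h1, h1, dotProduct_mulVec, ← mulVec_transpose, (G.isSymm_lapMatrix (R := ℝ)).eq, h, smul_dotProduct,
    smul_eq_mul]
  rfl

theorem dotProduct_lap (v : V → ℝ) :
    v ⬝ᵥ (G.lapMatrix ℝ *ᵥ v) = ∑ i, lapEig G i * lapCoef G v i ^ 2 := by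
  rw [← sum_lapCoef_mul G]
  refine Finset.sum_congr rfl fun i _ => ?_
  rw [lapCoef_mulVec]; ring

theorem dotProduct_lap_le (v : V → ℝ) :
    v ⬝ᵥ (G.lapMatrix ℝ *ᵥ v) ≤ lamMax G * (v ⬝ᵥ v) := by
  rw [dotProduct_lap, ← sum_lapCoef_mul G, Finset.mul_sum]
  refine Finset.sum_le_sum fun i _ => ?_
  rw [← sq]
  exact mul_le_mul_of_nonneg_right (lapEig_le_lamMax G i) (sq_nonneg _)

variable {G}

/-- On a connected graph a null eigenvector of the Laplacian is constant, hence orthogonal to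
vectors of zero sum. -/
theorem lapCoef_eq_zero (hG : G.Connected) {v : V → ℝ} (hv : ∑ k, v k = 0) {i : V}
    (hi : lapEig G i = 0) : lapCoef G v i = 0 := by
  have h := (G.posSemidef_lapMatrix ℝ).1.mulVec_eigenvectorBasis i
  change _ = lapEig G i • _ at h
  rw [hi, zero_smul, G.lapMatrix_mulVec_eq_zero_iff_forall_reachable] at h
  set b := (G.posSemidef_lapMatrix ℝ).1.eigenvectorBasis i with hb
  obtain ⟨k0⟩ := hG.nonempty
  have h1 : lapCoef G v i = ∑ k, b k0 * v k := by
    rw [lapCoef, ← hb, PiLp.inner_apply]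
    refine Finset.sum_congr rfl fun k _ => ?_
    rw [h k0 k (hG.preconnected k0 k)]
    simp [mul_comm]
  rw [h1, ← Finset.mul_sum, hv, mul_zero]

theorem lamMinPos_mul_le_dotProduct (hG : G.Connected) {v : V → ℝ} (hv : ∑ k, v k = 0) :
    lamMinPos G * (v ⬝ᵥ v) ≤ v ⬝ᵥ (G.lapMatrix ℝ *ᵥ v) := by
  rw [dotProduct_lap, ← sum_lapCoef_mul G, Finset.mul_sum]
  refine Finset.sum_le_sum fun i _ => ?_
  rw [← sq]
  rcases (lapEig_nonneg G i).eq_or_lt with h | h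
  · rw [lapCoef_eq_zero hG hv h.symm]; simp
  · exact mul_le_mul_of_nonneg_right (lamMinPos_le_lapEig G h) (sq_nonneg _)

theorem lamMinPos_pos_and_le [Nontrivial V] (hG : G.Connected) :
    0 < lamMinPos G ∧ lamMinPos G ≤ lamMax G := by
  obtain ⟨i, hi⟩ : ∃ i, 0 < lapEig G i := by
    -- If no eigenvalue were positive, all coefficients of e_a - e_b would vanish, although its
    -- squared norm is 2.
    by_contra! hc
    have h0 : ∀ i, lapEig G i = 0 := fun i => le_antisymm (hc i) (lapEig_nonneg G i)
    obtain ⟨a, b, hab⟩ := exists_pair_ne V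
    have hv : ∑ k, (Pi.single a 1 - Pi.single b 1 : V → ℝ) k = 0 := by simp
    have h1 := sum_lapCoef_mul G (Pi.single a 1 - Pi.single b 1) (Pi.single a 1 - Pi.single b 1)
    simp [lapCoef_eq_zero hG hv (h0 _), hab, hab.symm] at h1
    norm_num at h1
  constructor
  · unfold lamMinPos
    rw [spectrum_lap]
    have hfin : {l : ℝ | l ∈ Set.range (lapEig G) ∧ 0 < l}.Finite :=
      (Set.finite_range _).subset fun x hx => hx.1
    have hne : {l : ℝ | l ∈ Set.range (lapEig G) ∧ 0 < l}.Nonempty := ⟨_, ⟨i, rfl⟩, hi⟩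
    exact (hne.csInf_mem hfin).2
  · exact (lamMinPos_le_lapEig G hi).trans (lapEig_le_lamMax G i)

end Spectrum

/-! ### The operator `√W ⊗ I` -/

section Kron

open Matrix

variable {V : Type u} [Fintype V] {n : ℕ}

theorem kron_apply (S : Matrix V V ℝ) (y : Stack V n) (k : V) :
    kron S y k = ∑ j, S k j • y j := rfl

/-- `kron S` as a linear map. -/
def kronLin (S : Matrix V V ℝ) : Stack V n →ₗ[ℝ] Stack V n where
  toFun := kron S
  map_add' x y := by
    ext k i
    simp [kron_apply, Finset.sum_add_distrib]
  map_smul' c x := by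
    ext k i
    simp only [kron_apply, PiLp.smul_apply, WithLp.ofLp_sum, Finset.sum_apply, smul_eq_mul,
      RingHom.id_apply, Finset.mul_sum]
    exact Finset.sum_congr rfl fun j _ => by ring

theorem kronLin_apply (S : Matrix V V ℝ) (y : Stack V n) : kronLin S y = kron S y := rfl

/-- A coordinate of a stacked vector as a function of the node. -/
def col (y : Stack V n) (i : Fin n) : V → ℝ := fun k => y k i

theorem col_kron (S : Matrix V V ℝ) (y : Stack V n) (i : Fin n) :
    col (kron S y) i = S *ᵥ col y i := by
  ext k
  simp [col, kron_apply, mulVec, dotProduct]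

theorem inner_stack (x y : Stack V n) : inner ℝ x y = ∑ i, col x i ⬝ᵥ col y i := by
  rw [PiLp.inner_apply]
  simp_rw [PiLp.inner_apply, dotProduct, col]
  rw [Finset.sum_comm]
  simp [mul_comm]

theorem kron_mul (S T : Matrix V V ℝ) (y : Stack V n) : kron (S * T) y = kron S (kron T y) := by
  ext k i
  have := congrFun (show col (kron (S * T) y) i = col (kron S (kron T y)) i by
    rw [col_kron, col_kron, col_kron, mulVec_mulVec]) k
  exact this

theorem inner_kron_left {S : Matrix V V ℝ} (hS : Sᵀ = S) (x y : Stack V n) :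
    inner ℝ (kron S x) y = inner ℝ x (kron S y) := by
  rw [inner_stack, inner_stack]
  refine Finset.sum_congr rfl fun i _ => ?_
  rw [col_kron, col_kron, dotProduct_mulVec, ← mulVec_transpose, hS]

/-- The stacked vectors whose blocks sum to zero. -/
def sumZero (V : Type u) [Fintype V] (n : ℕ) : Submodule ℝ (Stack V n) where
  carrier := {y | ∑ k, y k = 0}
  add_mem' {x y} hx hy := by
    simp only [Set.mem_ofPred_eq, PiLp.add_apply, Finset.sum_add_distrib] at *
    rw [hx, hy, add_zero]
  zero_mem' := by simp
  smul_mem' c x hx := by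
    simp only [Set.mem_ofPred_eq, PiLp.smul_apply] at *
    rw [← Finset.smul_sum, hx, smul_zero]

theorem mem_sumZero {y : Stack V n} : y ∈ sumZero V n ↔ ∑ k, y k = 0 := Iff.rfl

theorem sum_col_of_mem {y : Stack V n} (hy : y ∈ sumZero V n) (i : Fin n) :
    ∑ k, col y i k = 0 := by
  have := congrArg (fun v : Vec n => v i) (mem_sumZero.mp hy)
  simpa [col] using this

/-- The stacked vector with all blocks equal to `c`. -/
def constStack (V : Type u) [Fintype V] (c : Vec n) : Stack V n := WithLp.toLp 2 fun _ => c

theorem inner_constStack (c : Vec n) (y : Stack V n) :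
    inner ℝ (constStack V c) y = inner ℝ c (∑ k, y k) := by
  rw [PiLp.inner_apply, inner_sum]
  rfl

variable [DecidableEq V] (G : SimpleGraph V) [DecidableRel G.Adj]

theorem sqrtLap_transpose : (sqrtLap G)ᵀ = sqrtLap G := by
  have := (sqrtLap_spec G).1.1
  rwa [IsHermitian, conjTranspose_eq_transpose_of_trivial] at this

theorem inner_sqrtLap_left (x y : Stack V n) :
    inner ℝ (kron (sqrtLap G) x) y = inner ℝ x (kron (sqrtLap G) y) :=
  inner_kron_left (sqrtLap_transpose G) x y

theorem kron_sqrtLap_sqrtLap (x : Stack V n) :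
    kron (sqrtLap G) (kron (sqrtLap G) x) = kron (G.lapMatrix ℝ) x := by
  rw [← kron_mul, (sqrtLap_spec G).2]

theorem norm_sqrtLap_sq (x : Stack V n) :
    ‖kron (sqrtLap G) x‖ ^ 2 = ∑ i, col x i ⬝ᵥ (G.lapMatrix ℝ *ᵥ col x i) := by
  rw [← real_inner_self_eq_norm_sq, inner_sqrtLap_left, kron_sqrtLap_sqrtLap, inner_stack]
  simp_rw [col_kron]

theorem norm_sqrtLap_sq_le (x : Stack V n) :
    ‖kron (sqrtLap G) x‖ ^ 2 ≤ lamMax G * ‖x‖ ^ 2 := by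
  rw [norm_sqrtLap_sq, ← real_inner_self_eq_norm_sq, inner_stack, Finset.mul_sum]
  exact Finset.sum_le_sum fun i _ => dotProduct_lap_le G _

theorem kron_sqrtLap_const (c : Vec n) : kron (sqrtLap G) (constStack V c) = 0 := by
  have h : ‖kron (sqrtLap G) (constStack V c)‖ ^ 2 = 0 := by
    rw [norm_sqrtLap_sq]
    refine Finset.sum_eq_zero fun i _ => ?_
    have : G.lapMatrix ℝ *ᵥ col (constStack V c) i = 0 :=
      (G.lapMatrix_mulVec_eq_zero_iff_forall_adj).mpr fun _ _ _ => rfl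
    rw [this, dotProduct_zero]
  exact norm_eq_zero.mp (pow_eq_zero_iff two_ne_zero |>.mp h)

/-- Since √W is symmetric and kills constant stacks, its range is orthogonal to them. -/
theorem kron_sqrtLap_mem (x : Stack V n) : kron (sqrtLap G) x ∈ sumZero V n := by
  rw [mem_sumZero, ← inner_self_eq_zero (𝕜 := ℝ), ← inner_constStack, ← inner_sqrtLap_left,
    kron_sqrtLap_const, inner_zero_left]

variable {G}

theorem lamMinPos_mul_norm_sq_le (hG : G.Connected) {y : Stack V n} (hy : y ∈ sumZero V n) :
    lamMinPos G * ‖y‖ ^ 2 ≤ ‖kron (sqrtLap G) y‖ ^ 2 := by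
  rw [norm_sqrtLap_sq, ← real_inner_self_eq_norm_sq, inner_stack, Finset.mul_sum]
  exact Finset.sum_le_sum fun i _ => lamMinPos_mul_le_dotProduct hG (sum_col_of_mem hy i)

end Kron

/-! ### Strongly convex functions and their conjugates -/

section Strong

variable {E : Type*} [NormedAddCommGroup E] [InnerProductSpace ℝ E] {Q : Set E} {h : E → ℝ} {μ : ℝ}

theorem strongConvexOn_le (hc : StrongConvexOn Q μ h) {x y : E} (hx : x ∈ Q) (hy : y ∈ Q) {t : ℝ}
    (h0 : 0 ≤ t) (h1 : t ≤ 1) :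
    h (x + t • (y - x)) ≤ (1 - t) * h x + t * h y - (1 - t) * t * (μ / 2 * ‖x - y‖ ^ 2) := by
  have := hc.2 hx hy (sub_nonneg.mpr h1) h0 (sub_add_cancel 1 t)
  have h2 : (1 - t) • x + t • y = x + t • (y - x) := by module
  rw [h2] at this
  simpa only [smul_eq_mul] using this

theorem add_smul_sub_mem (hc : Convex ℝ Q) {x y : E} (hx : x ∈ Q) (hy : y ∈ Q) {t : ℝ}
    (h0 : 0 ≤ t) (h1 : t ≤ 1) : x + t • (y - x) ∈ Q := by
  have := hc hx hy (sub_nonneg.mpr h1) h0 (sub_add_cancel 1 t)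
  have h2 : (1 - t) • x + t • y = x + t • (y - x) := by module
  rwa [h2] at this

theorem strongConvexOn_sub_inner (hc : StrongConvexOn Q μ h) (l : E) :
    StrongConvexOn Q μ fun x => h x - inner ℝ l x := by
  refine ⟨hc.1, fun x hx y hy a b ha hb hab => ?_⟩
  have := hc.2 hx hy ha hb hab
  simp only [smul_eq_mul, inner_add_right, real_inner_smul_right] at *
  linarith

/-- Quadratic growth around a minimizer. -/
theorem add_norm_sq_le_of_isMinOn (hc : StrongConvexOn Q μ h) {x0 : E} (h0 : x0 ∈ Q)
    (hmin : ∀ x ∈ Q, h x0 ≤ h x) {x : E} (hx : x ∈ Q) :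
    h x0 + μ / 2 * ‖x - x0‖ ^ 2 ≤ h x := by
  rw [norm_sub_rev]
  set K := μ / 2 * ‖x0 - x‖ ^ 2 with hK
  by_contra! hcon
  have hge := hmin x hx
  have hKpos : 0 < K := by linarith
  set δ := K - (h x - h x0) with hδ
  have hδ0 : 0 < δ := by linarith
  -- Moving a fraction t towards x changes the value by at most t(tK - δ), negative for tK < δ. The
  -- choice tK = δ/2 contradicts minimality.
  have ht0 : 0 < δ / (2 * K) := by positivity
  have ht1 : δ / (2 * K) ≤ 1 := by rw [div_le_one (by positivity)]; linarith
  have h1 := strongConvexOn_le hc h0 hx ht0.le ht1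
  have h2 := hmin _ (add_smul_sub_mem hc.1 h0 hx ht0.le ht1)
  rw [← hK] at h1
  set t := δ / (2 * K) with ht
  have h3 : t * K = δ / 2 := by rw [ht]; field_simp
  have h4 : 0 ≤ t * ((h x - h x0) - (1 - t) * K) := by linarith
  have h5 : 0 ≤ (h x - h x0) - (1 - t) * K := nonneg_of_mul_nonneg_right h4 ht0
  linarith

/-- A strongly convex lower semicontinuous function attains its minimum on a closed set. -/
theorem exists_min_of_strongConvexOn [ProperSpace E] (hQ : IsClosed Q) (hne : Q.Nonempty)
    (hc : StrongConvexOn Q μ h) (hμ : 0 < μ) (hl : LowerSemicontinuousOn h Q) :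
    ∃ x ∈ Q, ∀ y ∈ Q, h x ≤ h y := by
  obtain ⟨q, hq⟩ := hne
  have hcomp : ∀ r, IsCompact (Q ∩ Metric.closedBall q r) := fun r =>
    (isCompact_closedBall q r).inter_left hQ
  have hball : ∀ r, 0 ≤ r → ∃ a ∈ Q ∩ Metric.closedBall q r,
      IsMinOn h (Q ∩ Metric.closedBall q r) a := fun r hr =>
    LowerSemicontinuousOn.exists_isMinOn ⟨q, hq, Metric.mem_closedBall_self hr⟩ (hcomp r)
      (hl.mono Set.inter_subset_left)
  obtain ⟨a, ha, hamin⟩ := hball 1 zero_le_one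
  have hb := fun x hx => isMinOn_iff.mp hamin x hx
  have haq : h a ≤ h q := hb q ⟨hq, Metric.mem_closedBall_self zero_le_one⟩
  -- The minimum `h a` over the unit ball fixes the radius: strong convexity on the segment from q
  -- to a point beyond distance D forces its value to be at least h q, so a minimiser on the ball of
  -- radius D is global.
  set D := 1 + (h q - h a) * 2 / μ with hD
  have hD1 : 1 ≤ D := by
    have : 0 ≤ (h q - h a) * 2 / μ := div_nonneg (by linarith) hμ.le
    linarith
  obtain ⟨x, hx, hxmin⟩ := hball D (by linarith)
  have hxm := fun y hy => isMinOn_iff.mp hxmin y hy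
  refine ⟨x, hx.1, fun y hy => ?_⟩
  by_cases hyD : ‖y - q‖ ≤ D
  · exact hxm y ⟨hy, by rwa [Metric.mem_closedBall, dist_eq_norm]⟩
  push Not at hyD
  have hxq : h x ≤ h q := hxm q ⟨hq, Metric.mem_closedBall_self (by linarith)⟩
  set d := ‖y - q‖ with hd
  have hd1 : 1 < d := by linarith
  have hd0 : 0 < d := by linarith
  have hw := hb (q + d⁻¹ • (y - q)) ⟨add_smul_sub_mem hc.1 hq hy (by positivity)
    (inv_le_one_of_one_le₀ hd1.le), by
      rw [Metric.mem_closedBall, dist_eq_norm, add_sub_cancel_left, norm_smul, ← hd, norm_inv,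
        Real.norm_eq_abs, abs_of_pos hd0, inv_mul_cancel₀ hd0.ne']⟩
  have h1 := strongConvexOn_le hc hq hy (t := d⁻¹) (by positivity) (inv_le_one_of_one_le₀ hd1.le)
  rw [norm_sub_rev q y, ← hd] at h1
  have h2 : h a ≤ (1 - d⁻¹) * h q + d⁻¹ * h y - (1 - d⁻¹) * d⁻¹ * (μ / 2 * d ^ 2) := hw.trans h1
  have h3 : d * h a ≤ (d - 1) * h q + h y - (d - 1) * (μ / 2 * d) := by
    have := mul_le_mul_of_nonneg_left h2 hd0.le
    refine this.trans_eq ?_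
    field_simp
  have h4 : (h q - h a) ≤ (d - 1) * (μ / 2) := by
    have h5 : (h q - h a) * 2 / μ ≤ d - 1 := by linarith
    rw [div_le_iff₀ hμ] at h5
    linarith
  nlinarith

end Strong

section Conj

variable {n : ℕ} {Q : Set (Vec n)} {h : Vec n → ℝ} {μ : ℝ}

/-- The gradient of the conjugate is the maximizer, with quadratic growth. -/
def ConjSpec (Q : Set (Vec n)) (h : Vec n → ℝ) (μ : ℝ) : Prop :=
  ∀ l, gradient (conjFn Q h) l ∈ Q ∧
    conjFn Q h l = inner ℝ l (gradient (conjFn Q h) l) - h (gradient (conjFn Q h) l) ∧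
    ∀ y ∈ Q, inner ℝ l y - h y + μ / 2 * ‖y - gradient (conjFn Q h) l‖ ^ 2 ≤ conjFn Q h l

/-- Quadratic growth around the maximisers X is the interpolation inequality of the conjugate with
constant 1/μ. It identifies X with the gradient, which is a priori only a formal object. -/
theorem conjSpec_of_strongConvexOn (hQ : IsClosed Q) (hne : Q.Nonempty)
    (hc : StrongConvexOn Q μ h) (hμ : 0 < μ) (hl : LowerSemicontinuousOn h Q) :
    ConjSpec Q h μ := by
  have hex : ∀ l : Vec n, ∃ x ∈ Q, ∀ y ∈ Q, h x - inner ℝ l x ≤ h y - inner ℝ l y := fun l => by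
    refine exists_min_of_strongConvexOn hQ hne (strongConvexOn_sub_inner hc l) hμ ?_
    have h1 : Continuous fun y : Vec n => - inner ℝ l y := by fun_prop
    simpa only [sub_eq_add_neg] using hl.add (h1.lowerSemicontinuous.lowerSemicontinuousOn Q)
  choose X hXQ hX using hex
  have hgrow : ∀ l, ∀ y ∈ Q,
      inner ℝ l y - h y + μ / 2 * ‖y - X l‖ ^ 2 ≤ inner ℝ l (X l) - h (X l) := fun l y hy => by
    have := add_norm_sq_le_of_isMinOn (strongConvexOn_sub_inner hc l) (hXQ l) (hX l) hy
    linarith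
  have hval : ∀ l, conjFn Q h l = inner ℝ l (X l) - h (X l) := fun l => by
    have hle : ∀ x : Q, inner ℝ l (x : Vec n) - h x ≤ inner ℝ l (X l) - h (X l) := fun x => by
      have := hX l x x.2
      linarith
    have : Nonempty Q := hne.to_subtype
    exact le_antisymm (ciSup_le hle)
      (le_ciSup (f := fun x : Q => inner ℝ l (x : Vec n) - h x) ⟨_, by
        rintro _ ⟨x, rfl⟩; exact hle x⟩ ⟨X l, hXQ l⟩)
  have hco : Cocoercive (conjFn Q h) X (1 / μ) := fun y y' => by
    have h1 := hgrow y (X y') (hXQ y')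
    rw [hval, hval, inner_sub_right, real_inner_comm y, real_inner_comm y', norm_sub_rev]
    have : 1 / (2 * (1 / μ)) = μ / 2 := by field_simp
    rw [this]
    linarith
  have hgrad : gradient (conjFn Q h) = X := hco.gradient_eq (by positivity)
  intro l
  rw [hgrad]
  exact ⟨hXQ l, hval l, fun y hy => by rw [hval]; exact hgrow l y hy⟩

end Conj

/-! ### Smooth functions and strong convexity of their conjugates -/

section Smooth

variable {n : ℕ} {h : Vec n → ℝ} {μ L : ℝ}

/-- The quadratic upper bound of a function with Lipschitz gradient. -/
theorem le_quadratic_of_lipschitz_gradient (hd : Differentiable ℝ h)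
    (hL : ∀ x y, ‖gradient h x - gradient h y‖ ≤ L * ‖x - y‖) (x y : Vec n) :
    h y ≤ h x + inner ℝ (gradient h x) (y - x) + L / 2 * ‖y - x‖ ^ 2 := by
  set d := y - x with hdef
  set φ : ℝ → ℝ := fun t => h (x + t • d) - t * inner ℝ (gradient h x) d - L / 2 * t ^ 2 * ‖d‖ ^ 2
    with hφ
  have hderiv : ∀ t, HasDerivAt φ (inner ℝ (gradient h (x + t • d)) d
      - inner ℝ (gradient h x) d - L * t * ‖d‖ ^ 2) t := fun t => by
    have h1 : HasDerivAt (fun t : ℝ => x + t • d) d t := by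
      simpa using ((hasDerivAt_id t).smul_const d).const_add x
    have h2 : HasDerivAt (fun t : ℝ => h (x + t • d)) (inner ℝ (gradient h (x + t • d)) d) t := by
      have := (hd (x + t • d)).hasGradientAt.hasFDerivAt.comp_hasDerivAt t h1
      exact this.congr_deriv (by rw [InnerProductSpace.toDual_apply_apply])
    have h3 : HasDerivAt (fun t : ℝ => t * inner ℝ (gradient h x) d)
        (inner ℝ (gradient h x) d) t := by
      simpa using (hasDerivAt_id t).mul_const (inner ℝ (gradient h x) d)
    have h4 : HasDerivAt (fun t : ℝ => L / 2 * t ^ 2 * ‖d‖ ^ 2) (L * t * ‖d‖ ^ 2) t := by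
      have := (((hasDerivAt_id t).pow 2).const_mul (L / 2)).mul_const (‖d‖ ^ 2)
      refine this.congr_deriv ?_
      simp only [id_eq, Nat.cast_ofNat]; ring
    exact (h2.sub h3).sub h4
  have hanti : AntitoneOn φ (Set.Icc 0 1) := by
    refine antitoneOn_of_deriv_nonpos (convex_Icc 0 1)
      (fun t _ => (hderiv t).continuousAt.continuousWithinAt)
      (fun t _ => (hderiv t).differentiableAt.differentiableWithinAt) fun t ht => ?_
    rw [interior_Icc] at ht
    rw [(hderiv t).deriv, ← inner_sub_left]
    have h1 := real_inner_le_norm (gradient h (x + t • d) - gradient h x) d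
    have h2 := hL (x + t • d) x
    rw [add_sub_cancel_left, norm_smul, Real.norm_eq_abs, abs_of_pos ht.1] at h2
    have h3 := mul_le_mul_of_nonneg_right h2 (norm_nonneg d)
    nlinarith
  have := hanti (Set.left_mem_Icc.mpr zero_le_one) (Set.right_mem_Icc.mpr zero_le_one) zero_le_one
  simp only [hφ, zero_smul, add_zero, one_smul, zero_mul, sub_zero, one_mul, one_pow, mul_one] at this
  have hy : x + d = y := by rw [hdef]; abel
  rw [hy] at this
  linarith

/-- Test the supremum defining the conjugate at l with the point X + (l - l')/L, where X is the
maximiser at l'. Optimality gives ∇h(X) = l', and the quadratic upper bound of h finishes. -/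
theorem conj_strongly_convex (hμ : 0 < μ) (hL0 : 0 < L) (hd : Differentiable ℝ h)
    (hL : ∀ x y, ‖gradient h x - gradient h y‖ ≤ L * ‖x - y‖)
    (hs : ConjSpec Set.univ h μ) (l l' : Vec n) :
    conjFn Set.univ h l' + inner ℝ (gradient (conjFn Set.univ h) l') (l - l')
      + 1 / (2 * L) * ‖l - l'‖ ^ 2 ≤ conjFn Set.univ h l := by
  obtain ⟨-, h2, h3⟩ := hs l'
  set X := gradient (conjFn Set.univ h) l'
  have hgrad : gradient h X = l' := by
    have hmin : IsLocalMin (fun x => h x - inner ℝ l' x) X := by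
      refine Filter.Eventually.of_forall fun y => ?_
      have := h3 y trivial
      have h4 : 0 ≤ μ / 2 * ‖y - X‖ ^ 2 := by positivity
      linarith
    have h5 : HasFDerivAt (fun x => h x - inner ℝ l' x)
        (InnerProductSpace.toDual ℝ (Vec n) (gradient h X) - innerSL ℝ l') X :=
      (hd X).hasGradientAt.hasFDerivAt.sub (innerSL ℝ l').hasFDerivAt
    have h6 := hmin.hasFDerivAt_eq_zero h5
    have h7 := congrArg (fun T => T (gradient h X - l')) h6
    simp only [sub_apply, InnerProductSpace.toDual_apply_apply,
      innerSL_apply_apply, zero_apply, ← inner_sub_left] at h7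
    exact sub_eq_zero.mp (inner_self_eq_zero.mp h7)
  have h4 := le_quadratic_of_lipschitz_gradient hd hL X (X + L⁻¹ • (l - l'))
  have h5 := (hs l).2.2 (X + L⁻¹ • (l - l')) trivial
  have h6 : 0 ≤ μ / 2 * ‖X + L⁻¹ • (l - l') - gradient (conjFn Set.univ h) l‖ ^ 2 := by positivity
  rw [hgrad, add_sub_cancel_left, norm_smul, mul_pow, Real.norm_eq_abs, sq_abs,
    real_inner_smul_right] at h4
  rw [inner_add_right, real_inner_smul_right] at h5
  have h7 : inner ℝ X (l - l') = inner ℝ l X - inner ℝ l' X := by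
    rw [real_inner_comm, inner_sub_left]
  have h8 : L⁻¹ * inner ℝ l (l - l') = L⁻¹ * inner ℝ l' (l - l') + L⁻¹ * ‖l - l'‖ ^ 2 := by
    rw [← real_inner_self_eq_norm_sq, inner_sub_left (𝕜 := ℝ) l l' (l - l')]; ring
  have h9 : L / 2 * (L⁻¹ ^ 2 * ‖l - l'‖ ^ 2) = L⁻¹ * ‖l - l'‖ ^ 2 / 2 := by field_simp
  have h10 : 1 / (2 * L) * ‖l - l'‖ ^ 2 = L⁻¹ * ‖l - l'‖ ^ 2 / 2 := by field_simp
  linarith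

/-- The smoothness constant is at least the strong convexity constant. -/
theorem strong_le_smooth (hn : 1 ≤ n) (hc : StrongConvexOn Set.univ μ h) (hμ : 0 < μ)
    (hd : Differentiable ℝ h)
    (hL : ∀ x y, ‖gradient h x - gradient h y‖ ≤ L * ‖x - y‖) : μ ≤ L := by
  obtain ⟨x, -, hx⟩ := exists_min_of_strongConvexOn isClosed_univ Set.univ_nonempty hc hμ
    (hd.continuous.lowerSemicontinuous.lowerSemicontinuousOn _)
  have hg : gradient h x = 0 := by
    have hmin : IsLocalMin h x := Filter.Eventually.of_forall fun y => hx y trivial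
    rw [gradient, hmin.fderiv_eq_zero, map_zero]
  have : Nonempty (Fin n) := ⟨⟨0, hn⟩⟩
  obtain ⟨v, hv⟩ := exists_ne (0 : Vec n)
  have h1 := add_norm_sq_le_of_isMinOn hc (Set.mem_univ x) hx (Set.mem_univ (x + v))
  have h2 := le_quadratic_of_lipschitz_gradient hd hL x (x + v)
  rw [hg, inner_zero_left, add_sub_cancel_left] at h2
  rw [add_sub_cancel_left] at h1
  have h3 : 0 < ‖v‖ ^ 2 := by positivity
  by_contra! hcon
  nlinarith

end Smooth

/-! ### The dual objective -/

section Dual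

variable {V : Type u} [Fintype V] {n : ℕ} {Q : Set (Vec n)} {f : V → Vec n → ℝ} {μ : ℝ}

theorem norm_sq_stack (x : Stack V n) : ‖x‖ ^ 2 = ∑ k, ‖x k‖ ^ 2 := PiLp.norm_sq_eq_of_L2 _ x

theorem response_apply (l : Stack V n) (k : V) :
    response Q f l k = gradient (conjFn Q (f k)) ((Fintype.card V : ℝ) • l k) := rfl

theorem response_mem (hs : ∀ k, ConjSpec Q (f k) μ) (l : Stack V n) (k : V) :
    response Q f l k ∈ Q := (hs k _).1

theorem card_mul_inner_div [Nonempty V] (l x : Stack V n) :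
    (∑ k, inner ℝ ((Fintype.card V : ℝ) • l k) (x k)) / Fintype.card V = inner ℝ l x := by
  have hm : (Fintype.card V : ℝ) ≠ 0 := by exact_mod_cast Fintype.card_ne_zero
  simp_rw [real_inner_smul_left]
  rw [← Finset.mul_sum, PiLp.inner_apply, mul_div_cancel_left₀ _ hm]

theorem conjObj_eq [Nonempty V] (hs : ∀ k, ConjSpec Q (f k) μ) (l : Stack V n) :
    conjObj Q f l = inner ℝ l (response Q f l) - primalObj f (response Q f l) := by
  rw [← card_mul_inner_div, conjObj, primalObj, ← sub_div, ← Finset.sum_sub_distrib]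
  congr 1
  exact Finset.sum_congr rfl fun k _ => (hs k _).2.1

theorem le_conjObj [Nonempty V] (hs : ∀ k, ConjSpec Q (f k) μ) (l x : Stack V n)
    (hx : ∀ k, x k ∈ Q) :
    inner ℝ l x - primalObj f x + μ / Fintype.card V / 2 * ‖x - response Q f l‖ ^ 2
      ≤ conjObj Q f l := by
  have h1 : μ / Fintype.card V / 2 * ‖x - response Q f l‖ ^ 2
      = (∑ k, μ / 2 * ‖x k - response Q f l k‖ ^ 2) / Fintype.card V := by
    rw [← Finset.mul_sum, norm_sq_stack]
    simp only [PiLp.sub_apply]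
    ring
  rw [← card_mul_inner_div, primalObj, h1, ← sub_div, ← Finset.sum_sub_distrib, ← add_div,
    ← Finset.sum_add_distrib, conjObj]
  gcongr with k
  exact (hs k _).2.2 _ (hx k)

theorem kron_sub (S : Matrix V V ℝ) (x y : Stack V n) :
    kron S (x - y) = kron S x - kron S y := map_sub (kronLin S) x y

theorem kron_add (S : Matrix V V ℝ) (x y : Stack V n) :
    kron S (x + y) = kron S x + kron S y := map_add (kronLin S) x y

variable [DecidableEq V] (G : SimpleGraph V) [DecidableRel G.Adj]

/-- The gradient of the dual objective. -/
def dualGrad (Q : Set (Vec n)) (f : V → Vec n → ℝ) (y : Stack V n) : Stack V n :=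
  kron (sqrtLap G) (response Q f (kron (sqrtLap G) y))

theorem dualGrad_mem (y : Stack V n) : dualGrad G Q f y ∈ sumZero V n := kron_sqrtLap_mem G _

variable {G}

/-- Use the response at y' as a competitor in the maximum at y. Its quadratic growth term dominates
the squared gradient difference because ‖√W v‖² ≤ λ_max ‖v‖². -/
theorem dual_cocoercive [Nontrivial V] (hG : G.Connected) (hμ : 0 < μ)
    (hs : ∀ k, ConjSpec Q (f k) μ) :
    Cocoercive (dualObj G Q f) (dualGrad G Q f) (dualL G μ) := by
  intro y y'
  have hlam : 0 < lamMax G := (lamMinPos_pos_and_le hG).1.trans_le (lamMinPos_pos_and_le hG).2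
  have hm : (0 : ℝ) < Fintype.card V := by exact_mod_cast Fintype.card_pos
  have h1 := conjObj_eq hs (kron (sqrtLap G) y')
  have h2 := le_conjObj hs (kron (sqrtLap G) y) (response Q f (kron (sqrtLap G) y'))
    (response_mem hs _)
  have h3 := norm_sqrtLap_sq_le G
    (response Q f (kron (sqrtLap G) y) - response Q f (kron (sqrtLap G) y'))
  have h4 : inner ℝ (dualGrad G Q f y') (y - y')
      = inner ℝ (kron (sqrtLap G) y) (response Q f (kron (sqrtLap G) y'))
        - inner ℝ (kron (sqrtLap G) y') (response Q f (kron (sqrtLap G) y')) := by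
    rw [dualGrad, inner_sqrtLap_left, kron_sub, inner_sub_right, real_inner_comm,
      real_inner_comm (kron (sqrtLap G) y')]
  rw [norm_sub_rev] at h2
  unfold dualObj
  rw [h4, dualGrad, dualGrad, ← kron_sub]
  have h5 : 1 / (2 * dualL G μ) * ‖kron (sqrtLap G)
      (response Q f (kron (sqrtLap G) y) - response Q f (kron (sqrtLap G) y'))‖ ^ 2
      ≤ μ / Fintype.card V / 2 *
        ‖response Q f (kron (sqrtLap G) y) - response Q f (kron (sqrtLap G) y')‖ ^ 2 := by
    have h6 : 1 / (2 * dualL G μ) = μ / Fintype.card V / 2 / lamMax G := by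
      unfold dualL; field_simp
    rw [h6, div_mul_eq_mul_div, div_le_iff₀ hlam, mul_assoc]
    gcongr
    linarith
  linarith

theorem dualL_pos [Nontrivial V] (hG : G.Connected) (hμ : 0 < μ) : 0 < dualL G μ := by
  have hlam : 0 < lamMax G := (lamMinPos_pos_and_le hG).1.trans_le (lamMinPos_pos_and_le hG).2
  have hm : (0 : ℝ) < Fintype.card V := by exact_mod_cast Fintype.card_pos
  unfold dualL
  positivity

theorem gradient_dualObj [Nontrivial V] (hG : G.Connected) (hμ : 0 < μ)
    (hs : ∀ k, ConjSpec Q (f k) μ) : gradient (dualObj G Q f) = dualGrad G Q f :=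
  (dual_cocoercive hG hμ hs).gradient_eq (dualL_pos hG hμ)

/-- Strong convexity of the dual objective along the range of `√W`. -/
theorem dual_strongly_convex [Nontrivial V] (hG : G.Connected) (hμ : 0 < μ) {L : ℝ} (hL0 : 0 < L)
    (hd : ∀ k, Differentiable ℝ (f k))
    (hL : ∀ k x y, ‖gradient (f k) x - gradient (f k) y‖ ≤ L * ‖x - y‖)
    (hs : ∀ k, ConjSpec Set.univ (f k) μ) {y y' : Stack V n} (hy : y - y' ∈ sumZero V n) :
    model (dualObj G Set.univ f) (dualGrad G Set.univ f) (dualMu G L) y' y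
      ≤ dualObj G Set.univ f y := by
  have hm : (0 : ℝ) < Fintype.card V := by exact_mod_cast Fintype.card_pos
  unfold model
  have h4 : inner ℝ (dualGrad G Set.univ f y') (y - y')
      = (∑ k, inner ℝ (gradient (conjFn Set.univ (f k))
          ((Fintype.card V : ℝ) • kron (sqrtLap G) y' k))
          ((Fintype.card V : ℝ) • kron (sqrtLap G) y k
            - (Fintype.card V : ℝ) • kron (sqrtLap G) y' k)) / Fintype.card V := by
    rw [dualGrad, inner_sqrtLap_left, kron_sub, real_inner_comm, ← card_mul_inner_div]
    congr 1
    refine Finset.sum_congr rfl fun k _ => ?_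
    rw [real_inner_comm, PiLp.sub_apply, smul_sub, response_apply]
  have h5 : dualMu G L / 2 * ‖y - y'‖ ^ 2 ≤
      (∑ k, 1 / (2 * L) * ‖(Fintype.card V : ℝ) • kron (sqrtLap G) y k
            - (Fintype.card V : ℝ) • kron (sqrtLap G) y' k‖ ^ 2) / Fintype.card V := by
    have h6 := lamMinPos_mul_norm_sq_le hG hy
    have h7 : (∑ k, 1 / (2 * L) * ‖(Fintype.card V : ℝ) • kron (sqrtLap G) y k
            - (Fintype.card V : ℝ) • kron (sqrtLap G) y' k‖ ^ 2) / Fintype.card V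
        = Fintype.card V / (2 * L) * ‖kron (sqrtLap G) (y - y')‖ ^ 2 := by
      rw [← Finset.mul_sum, norm_sq_stack, kron_sub]
      have : ∀ k, ‖(Fintype.card V : ℝ) • kron (sqrtLap G) y k
            - (Fintype.card V : ℝ) • kron (sqrtLap G) y' k‖ ^ 2
            = (Fintype.card V : ℝ) ^ 2 *
              ‖(kron (sqrtLap G) y - kron (sqrtLap G) y') k‖ ^ 2 := fun k => by
        rw [← smul_sub, norm_smul, mul_pow, Real.norm_eq_abs, sq_abs, PiLp.sub_apply]
      simp_rw [this]
      rw [← Finset.mul_sum]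
      field_simp
    rw [h7]
    have h8 : dualMu G L / 2 * ‖y - y'‖ ^ 2
        = Fintype.card V / (2 * L) * (lamMinPos G * ‖y - y'‖ ^ 2) := by
      unfold dualMu; field_simp
    rw [h8]
    gcongr
  refine (add_le_add_right h5 _).trans ?_
  rw [h4, dualObj, dualObj, conjObj, conjObj, ← add_div, ← Finset.sum_add_distrib, ← add_div,
    ← Finset.sum_add_distrib]
  gcongr with k
  exact conj_strongly_convex hμ hL0 (hd k) (hL k) (hs k) _ _

theorem dualMu_pos [Nontrivial V] (hG : G.Connected) {L : ℝ} (hL : 0 < L) : 0 < dualMu G L := by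
  have hlam : 0 < lamMinPos G := (lamMinPos_pos_and_le hG).1
  have hm : (0 : ℝ) < Fintype.card V := by exact_mod_cast Fintype.card_pos
  unfold dualMu
  positivity

theorem dualL_div_dualMu [Nontrivial V] (hG : G.Connected) (hμ : 0 < μ) {L : ℝ} (hL : 0 < L) :
    dualL G μ / dualMu G L = L / μ * chi G := by
  have hlam : 0 < lamMinPos G := (lamMinPos_pos_and_le hG).1
  have hm : (0 : ℝ) < Fintype.card V := by exact_mod_cast Fintype.card_pos
  unfold dualL dualMu chi
  field_simp

theorem one_le_chi [Nontrivial V] (hG : G.Connected) : 1 ≤ chi G :=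
  (one_le_div (lamMinPos_pos_and_le hG).1).mpr (lamMinPos_pos_and_le hG).2

/-- The duality gap at a dual point and its response. -/
theorem gap_response [Nonempty V] (hs : ∀ k, ConjSpec Q (f k) μ) (y : Stack V n) :
    primalObj f (response Q f (kron (sqrtLap G) y)) + dualObj G Q f y
      = inner ℝ y (dualGrad G Q f y) := by
  rw [dualObj, conjObj_eq hs, dualGrad, ← inner_sqrtLap_left]
  ring

/-! ### Existence and size of the dual solution -/

/-- A minimizer of the dual objective of smallest norm. -/
theorem exists_dualRadius [Nontrivial V] (hG : G.Connected) (hμ : 0 < μ)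
    (hs : ∀ k, ConjSpec Q (f k) μ) {y₀ : Stack V n}
    (h0 : ∀ y, dualObj G Q f y₀ ≤ dualObj G Q f y) :
    ∃ ys : Stack V n, (∀ y, dualObj G Q f ys ≤ dualObj G Q f y) ∧ ys ∈ sumZero V n ∧
      IsDualRadius G Q f ‖ys‖ ∧ ‖ys‖ ≤ ‖y₀‖ := by
  have hcont : Continuous (dualObj G Q f) := continuous_iff_continuousAt.mpr fun y =>
    ((dual_cocoercive hG hμ hs).hasGradientAt (dualL_pos hG hμ) y).continuousAt
  -- A shortest minimiser exists because only minimisers no longer than `y₀` compete, and these form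
  -- a compact set.
  have hcomp : IsCompact ({y | dualObj G Q f y ≤ dualObj G Q f y₀} ∩
      Metric.closedBall 0 ‖y₀‖) :=
    (isCompact_closedBall 0 ‖y₀‖).inter_left (isClosed_le hcont continuous_const)
  obtain ⟨ys, ⟨hys1, hys2⟩, hmin⟩ := hcomp.exists_isMinOn (f := fun y => ‖y‖)
    ⟨y₀, le_refl (dualObj G Q f y₀), by simp⟩ continuous_norm.continuousOn
  have hys : ∀ y, dualObj G Q f ys ≤ dualObj G Q f y := fun y => le_trans hys1 (h0 y)
  have hle : ‖ys‖ ≤ ‖y₀‖ := by simpa using hys2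
  have hsmall : ∀ y, dualObj G Q f y ≤ dualObj G Q f y₀ → ‖ys‖ ≤ ‖y‖ := fun y hy => by
    by_cases hyn : ‖y‖ ≤ ‖y₀‖
    · exact isMinOn_iff.mp hmin y ⟨hy, by simpa using hyn⟩
    · exact hle.trans (le_of_not_ge hyn)
  refine ⟨ys, hys, ?_, ⟨⟨ys, fun y _ => hys y, rfl⟩, ?_⟩, hle⟩
  · have hm : (0 : ℝ) < Fintype.card V := by exact_mod_cast Fintype.card_pos
    -- Removing the block mean leaves Ψ unchanged, as √W kills constants, and shortens the vector
    -- unless the mean is zero.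
    set c : Vec n := (Fintype.card V : ℝ)⁻¹ • ∑ k, ys k with hc
    have hsum : ∑ k, ys k = (Fintype.card V : ℝ) • c := by rw [hc, smul_inv_smul₀ hm.ne']
    have h1 : dualObj G Q f (ys - constStack V c) = dualObj G Q f ys := by
      rw [dualObj, kron_sub, kron_sqrtLap_const, sub_zero, dualObj]
    have h2 := hsmall (ys - constStack V c) (h1.trans_le hys1)
    have h3 : ‖ys - constStack V c‖ ^ 2 = ‖ys‖ ^ 2 - Fintype.card V * ‖c‖ ^ 2 := by
      have h4 : ‖constStack V c‖ ^ 2 = Fintype.card V * ‖c‖ ^ 2 := by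
        rw [norm_sq_stack]; simp [constStack]
      rw [norm_sub_sq_real, real_inner_comm, inner_constStack, hsum, real_inner_smul_right,
        real_inner_self_eq_norm_sq, h4]
      ring
    have h4 : ‖ys‖ ^ 2 ≤ ‖ys - constStack V c‖ ^ 2 := by gcongr
    have h5 : ‖c‖ ^ 2 ≤ 0 := by
      by_contra! hcon
      nlinarith
    have h6 : c = 0 := norm_eq_zero.mp (pow_eq_zero_iff two_ne_zero |>.mp
      (le_antisymm h5 (by positivity)))
    rw [mem_sumZero, hsum, h6, smul_zero]
  · rintro r ⟨y, hy, rfl⟩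
    exact hsmall y (hy (Set.mem_univ _))

/-- Lagrange multipliers of bounded size, by separation. -/
theorem exists_multiplier {E F : Type*} [AddCommGroup E] [Module ℝ E] [NormedAddCommGroup F]
    [InnerProductSpace ℝ F] [CompleteSpace F] {S : Set E} {φ : E → ℝ} (T : E →ₗ[ℝ] F)
    (hφ : ConvexOn ℝ S φ) {x₀ : E} (hx₀ : x₀ ∈ S) (hT : T x₀ = 0) {ρ : ℝ} (hρ : 0 ≤ ρ)
    (hlow : ∀ x ∈ S, φ x₀ - ρ * ‖T x‖ ≤ φ x) :
    ∃ y : F, ‖y‖ ≤ ρ ∧ ∀ x ∈ S, φ x₀ ≤ φ x - inner ℝ y (T x) := by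
  -- A is the epigraph of the value function of the perturbed problem, and the open convex cone B
  -- lies below -ρ‖·‖. The slope of a separating hyperplane is the multiplier.
  set A : Set (F × ℝ) := {p | ∃ x ∈ S, T x = p.1 ∧ φ x - φ x₀ ≤ p.2}
  set B : Set (F × ℝ) := {p | p.2 < -(ρ * ‖p.1‖)}
  have hB : Convex ℝ B := by
    intro p hp q hq a b ha hb hab
    simp only [B, Set.mem_ofPred_eq, Prod.snd_add, Prod.smul_snd, Prod.fst_add, Prod.smul_fst,
      smul_eq_mul] at *
    have h1 : ‖a • p.1 + b • q.1‖ ≤ a * ‖p.1‖ + b * ‖q.1‖ := by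
      refine (norm_add_le _ _).trans_eq ?_
      rw [norm_smul, norm_smul, Real.norm_eq_abs, Real.norm_eq_abs, abs_of_nonneg ha,
        abs_of_nonneg hb]
    have h2 := mul_le_mul_of_nonneg_left h1 hρ
    rcases ha.eq_or_lt with rfl | ha'
    · have : b = 1 := by linarith
      subst this
      linarith
    · have h3 := mul_lt_mul_of_pos_left hp ha'
      have h4 := mul_le_mul_of_nonneg_left hq.le hb
      linarith
  have hBo : IsOpen B := isOpen_lt continuous_snd (by fun_prop)
  have hA : Convex ℝ A := by
    rintro p ⟨x, hx, hxp, hxp2⟩ q ⟨x', hx', hxq, hxq2⟩ a b ha hb hab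
    refine ⟨a • x + b • x', hφ.1 hx hx' ha hb hab, by simp [hxp, hxq], ?_⟩
    have h1 := hφ.2 hx hx' ha hb hab
    simp only [Prod.snd_add, Prod.smul_snd, smul_eq_mul] at *
    have h2 := mul_le_mul_of_nonneg_left hxp2 ha
    have h3 := mul_le_mul_of_nonneg_left hxq2 hb
    have h4 : φ x₀ = a * φ x₀ + b * φ x₀ := by rw [← add_mul, hab, one_mul]
    linarith
  have hdisj : Disjoint B A := by
    rw [Set.disjoint_left]
    rintro p hp ⟨x, hx, hxp, hxp2⟩
    have h1 := hlow x hx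
    simp only [B, Set.mem_ofPred_eq] at hp
    rw [hxp] at h1
    linarith
  obtain ⟨ℓ, u, hℓB, hℓA⟩ := geometric_hahn_banach_open hB hBo hA hdisj
  set c := ℓ (0, 1) with hc
  set y' : F := (InnerProductSpace.toDual ℝ F).symm (ℓ.comp (ContinuousLinearMap.inl ℝ F ℝ))
  have hℓ : ∀ v t, ℓ (v, t) = inner ℝ y' v + t * c := fun v t => by
    have h1 : (v, t) = (v, (0 : ℝ)) + t • ((0 : F), (1 : ℝ)) := by simp
    rw [h1, map_add, map_smul, smul_eq_mul, InnerProductSpace.toDual_symm_apply]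
    rfl
  have hu : u ≤ 0 := by
    have := hℓA (0, 0) ⟨x₀, hx₀, hT, by simp⟩
    rwa [hℓ, inner_zero_right, zero_mul, add_zero] at this
  -- The hyperplane is not vertical, because B contains (0, -1).
  have hc0 : 0 < c := by
    have := hℓB (0, -1) (by simp [B])
    rw [hℓ, inner_zero_right] at this
    linarith
  -- Approaching the boundary of B above v bounds the slope, which gives the norm bound ρ.
  have hy' : ∀ v, inner ℝ y' v ≤ c * (ρ * ‖v‖) := fun v => by
    refine le_of_forall_pos_lt_add fun ε hε => ?_
    have := hℓB (v, -(ρ * ‖v‖) - ε / c) (by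
      simp only [B, Set.mem_ofPred_eq]
      have : 0 < ε / c := by positivity
      linarith)
    rw [hℓ] at this
    have h2 : ε / c * c = ε := by field_simp
    have h3 : (-(ρ * ‖v‖) - ε / c) * c = -(c * (ρ * ‖v‖)) - ε := by rw [sub_mul, h2]; ring
    linarith
  refine ⟨-(c⁻¹ • y'), ?_, fun x hx => ?_⟩
  · rw [norm_neg, norm_smul, norm_inv, Real.norm_eq_abs, abs_of_pos hc0, inv_mul_le_iff₀ hc0]
    have h1 := hy' y'
    rw [real_inner_self_eq_norm_sq] at h1
    rcases (norm_nonneg y').eq_or_lt with h | h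
    · rw [← h]; positivity
    · nlinarith
  · have hu0 : 0 ≤ u := by
      refine le_of_forall_pos_lt_add fun ε hε => ?_
      have := hℓB (0, -(ε / c)) (by simp only [B, Set.mem_ofPred_eq]; simp; positivity)
      rw [hℓ, inner_zero_right] at this
      have h2 : -(ε / c) * c = -ε := by field_simp
      linarith
    have := hℓA (T x, φ x - φ x₀) ⟨x, hx, rfl, le_rfl⟩
    rw [hℓ] at this
    rw [inner_neg_left, real_inner_smul_left]
    have h3 : 0 ≤ c⁻¹ * (inner ℝ y' (T x) + (φ x - φ x₀) * c) :=
      mul_nonneg (by positivity) (hu0.trans this)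
    have h4 : c⁻¹ * (inner ℝ y' (T x) + (φ x - φ x₀) * c)
        = c⁻¹ * inner ℝ y' (T x) + (φ x - φ x₀) := by field_simp
    linarith

end Dual

/-! ### Size of the dual solution and the primal-dual rate -/

section Solution

variable {V : Type u} [Fintype V] {n : ℕ} {Q : Set (Vec n)} {f : V → Vec n → ℝ} {μ : ℝ}

/-- The set `Q^m`. -/
def stackSet (V : Type u) [Fintype V] (Q : Set (Vec n)) : Set (Stack V n) := {x | ∀ k, x k ∈ Q}

theorem primalObj_convexOn (hQ : Convex ℝ Q) (hf : ∀ k, ConvexOn ℝ Q (f k)) :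
    ConvexOn ℝ (stackSet V Q) (primalObj f) := by
  refine ⟨fun x hx y hy a b ha hb hab k => hQ (hx k) (hy k) ha hb hab,
    fun x hx y hy a b ha hb hab => ?_⟩
  unfold primalObj
  rw [smul_eq_mul, smul_eq_mul, ← mul_div_assoc, ← mul_div_assoc, ← add_div, Finset.mul_sum,
    Finset.mul_sum, ← Finset.sum_add_distrib]
  gcongr with k
  exact (hf k).2 (hx k) (hy k) ha hb hab

theorem strongConvexOn_convexOn {h : Vec n → ℝ} (hμ : 0 < μ) (hc : StrongConvexOn Q μ h) :
    ConvexOn ℝ Q h :=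
  strongConvexOn_zero.mp (hc.mono hμ.le)

/-- The average of the blocks. -/
def blockMean (x : Stack V n) : Vec n := (Fintype.card V : ℝ)⁻¹ • ∑ k, x k

theorem blockMean_mem [Nonempty V] {S : Set (Vec n)} (hS : Convex ℝ S) {x : Stack V n}
    (hx : ∀ k, x k ∈ S) : blockMean x ∈ S := by
  have hm : (Fintype.card V : ℝ) ≠ 0 := by exact_mod_cast Fintype.card_ne_zero
  unfold blockMean
  rw [Finset.smul_sum]
  exact hS.sum_mem (fun _ _ => by positivity) (by simp [hm]) fun k _ => hx k

theorem sub_blockMean_mem [Nonempty V] (x : Stack V n) :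
    x - constStack V (blockMean x) ∈ sumZero V n := by
  have hm : (Fintype.card V : ℝ) ≠ 0 := by exact_mod_cast Fintype.card_ne_zero
  rw [mem_sumZero]
  simp only [PiLp.sub_apply, constStack, Finset.sum_sub_distrib, Finset.sum_const,
    Finset.card_univ, blockMean]
  rw [← Nat.cast_smul_eq_nsmul ℝ, smul_inv_smul₀ hm, sub_self]

variable [DecidableEq V] {G : SimpleGraph V} [DecidableRel G.Adj]

/-- The distance to consensus is controlled by `‖√W 𝐱‖`. -/
theorem sum_norm_sub_blockMean_le [Nontrivial V] (hG : G.Connected) (x : Stack V n) :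
    ∑ k, ‖x k - blockMean x‖ ≤ √(Fintype.card V / lamMinPos G) * ‖kron (sqrtLap G) x‖ := by
  have hlam := (lamMinPos_pos_and_le hG).1
  have h1 := lamMinPos_mul_norm_sq_le hG (sub_blockMean_mem x)
  rw [kron_sub, kron_sqrtLap_const, sub_zero, norm_sq_stack] at h1
  have h2 := sq_sum_le_card_mul_sum_sq (s := (Finset.univ : Finset V))
    (f := fun k => ‖x k - blockMean x‖)
  rw [Finset.card_univ] at h2
  refine le_of_sq_le_sq ?_ (by positivity)
  rw [mul_pow, Real.sq_sqrt (by positivity)]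
  refine h2.trans ?_
  rw [div_mul_eq_mul_div, mul_div_assoc]
  gcongr
  rw [le_div_iff₀ hlam, mul_comm]
  exact h1

/-- This is the linear lower bound required by the separation argument: a point off consensus gains
at most the Lipschitz constant times its distance to consensus. -/
theorem primalObj_lower_bound [Nontrivial V] (hG : G.Connected) {M r : ℝ} {xs : Vec n}
    (hμ : 0 < μ) (hc : ∀ k, StrongConvexOn Q μ (f k)) (hxs : xs ∈ Q)
    (hmin : IsMinOn (fun x => (∑ k, f k x) / Fintype.card V) Q xs) (hr : 0 < r)
    (hM : ∀ k, ∀ x ∈ Q ∩ Metric.closedBall xs r, ∀ y ∈ Q ∩ Metric.closedBall xs r,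
      |f k x - f k y| ≤ M * ‖x - y‖) {x : Stack V n} (hx : x ∈ stackSet V Q) :
    primalObj f (constStack V xs)
      - |M| / Fintype.card V * √(Fintype.card V / lamMinPos G) * ‖kron (sqrtLap G) x‖
      ≤ primalObj f x := by
  have hm : (0 : ℝ) < Fintype.card V := by exact_mod_cast Fintype.card_pos
  obtain ⟨k0⟩ : Nonempty V := inferInstance
  have hQ : Convex ℝ Q := (hc k0).1
  have hconv := primalObj_convexOn hQ fun k => strongConvexOn_convexOn hμ (hc k)
  -- Near the solution, compare x with its block mean, which lies in Q and in the ball by convexity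
  -- and cannot beat the optimum.
  have hlocal : ∀ x ∈ stackSet V Q, (∀ k, x k ∈ Metric.closedBall xs r) →
      primalObj f (constStack V xs)
        - |M| / Fintype.card V * √(Fintype.card V / lamMinPos G) * ‖kron (sqrtLap G) x‖
      ≤ primalObj f x := fun x hx hxr => by
    have hmean : blockMean x ∈ Q ∩ Metric.closedBall xs r :=
      ⟨blockMean_mem hQ hx, blockMean_mem (convex_closedBall _ _) hxr⟩
    have h1 : primalObj f (constStack V xs) ≤ primalObj f (constStack V (blockMean x)) :=
      isMinOn_iff.mp hmin _ hmean.1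
    have h2 : primalObj f (constStack V (blockMean x)) - primalObj f x
        ≤ (|M| * ∑ k, ‖x k - blockMean x‖) / Fintype.card V := by
      unfold primalObj
      rw [← sub_div, ← Finset.sum_sub_distrib, Finset.mul_sum]
      gcongr with k
      have h3 := hM k _ hmean (x k) ⟨hx k, hxr k⟩
      rw [norm_sub_rev] at h3
      calc f k (blockMean x) - f k (x k) ≤ |f k (blockMean x) - f k (x k)| := le_abs_self _
        _ ≤ M * ‖x k - blockMean x‖ := h3
        _ ≤ _ := by gcongr; exact le_abs_self M
    have h4 := mul_le_mul_of_nonneg_left (sum_norm_sub_blockMean_le hG x)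
      (show 0 ≤ |M| / Fintype.card V by positivity)
    have h5 : (|M| * ∑ k, ‖x k - blockMean x‖) / Fintype.card V
      = |M| / Fintype.card V * ∑ k, ‖x k - blockMean x‖ := by ring
    linarith
  have hx0 : constStack V xs ∈ stackSet V Q := fun k => hxs
  set d := ‖x - constStack V xs‖ with hd
  -- Shrinking x towards the optimal constant stack by this factor puts every block in the ball.
  -- Convexity carries the bound back, since ‖√W x‖ scales by t as well.
  set t := r / (r + d) with ht
  have hd0 : 0 ≤ d := norm_nonneg _
  have ht0 : 0 < t := by positivity
  have ht1 : t ≤ 1 := by rw [ht, div_le_one (by positivity)]; linarith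
  have htd : t * d ≤ r := by
    rw [ht, div_mul_eq_mul_div, div_le_iff₀ (by positivity)]
    nlinarith
  have hmem := add_smul_sub_mem hconv.1 hx0 hx ht0.le ht1
  have h1 := hlocal _ hmem fun k => by
    rw [Metric.mem_closedBall, dist_eq_norm]
    have h2 : (constStack V xs + t • (x - constStack V xs)) k - xs
        = t • (x - constStack V xs) k := by simp [constStack]
    rw [h2, norm_smul, Real.norm_eq_abs, abs_of_pos ht0]
    exact (mul_le_mul_of_nonneg_left (PiLp.norm_apply_le _ k) ht0.le).trans htd
  have h2 : kron (sqrtLap G) (constStack V xs + t • (x - constStack V xs))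
      = t • kron (sqrtLap G) x := by
    rw [← kronLin_apply, map_add, map_smul, map_sub, kronLin_apply, kronLin_apply,
      kron_sqrtLap_const, sub_zero, zero_add]
  rw [h2, norm_smul, Real.norm_eq_abs, abs_of_pos ht0] at h1
  have h3 := hconv.2 hx0 hx (sub_nonneg.mpr ht1) ht0.le (sub_add_cancel 1 t)
  have h4 : (1 - t) • constStack V xs + t • x
      = constStack V xs + t • (x - constStack V xs) := by module
  rw [h4, smul_eq_mul, smul_eq_mul] at h3
  have h5 := h1.trans h3
  refine le_of_mul_le_mul_left ?_ ht0
  linarith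

/-- Existence of a dual solution, with the bound on its norm. -/
theorem exists_dual_solution [Nontrivial V] (hG : G.Connected) {M r : ℝ} {xs : Vec n}
    (hμ : 0 < μ) (hc : ∀ k, StrongConvexOn Q μ (f k)) (hxs : xs ∈ Q)
    (hmin : IsMinOn (fun x => (∑ k, f k x) / Fintype.card V) Q xs) (hr : 0 < r)
    (hM : ∀ k, ∀ x ∈ Q ∩ Metric.closedBall xs r, ∀ y ∈ Q ∩ Metric.closedBall xs r,
      |f k x - f k y| ≤ M * ‖x - y‖) (hs : ∀ k, ConjSpec Q (f k) μ) :
    ∃ y₀ : Stack V n, (∀ y, dualObj G Q f y₀ ≤ dualObj G Q f y) ∧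
      ‖y₀‖ ^ 2 ≤ M ^ 2 / (Fintype.card V * lamMinPos G) := by
  have hm : (0 : ℝ) < Fintype.card V := by exact_mod_cast Fintype.card_pos
  have hlam := (lamMinPos_pos_and_le hG).1
  obtain ⟨k0⟩ : Nonempty V := inferInstance
  have hconv := primalObj_convexOn (hc k0).1 fun k => strongConvexOn_convexOn hμ (hc k)
  obtain ⟨y₀, hy1, hy2⟩ := exists_multiplier (kronLin (sqrtLap G)) hconv
    (x₀ := constStack V xs) (fun k => hxs) (kron_sqrtLap_const G xs)
    (ρ := |M| / Fintype.card V * √(Fintype.card V / lamMinPos G)) (by positivity)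
    (fun x hx => primalObj_lower_bound hG hμ hc hxs hmin hr hM hx)
  refine ⟨y₀, fun y => ?_, ?_⟩
  · have h1 : dualObj G Q f y₀ ≤ - primalObj f (constStack V xs) := by
      have h2 := hy2 (response Q f (kron (sqrtLap G) y₀)) (response_mem hs _)
      rw [dualObj, conjObj_eq hs, inner_sqrtLap_left]
      rw [kronLin_apply] at h2
      linarith
    have h2 := le_conjObj hs (kron (sqrtLap G) y) (constStack V xs) (fun k => hxs)
    rw [inner_sqrtLap_left, kron_sqrtLap_const, inner_zero_right] at h2
    have h3 : 0 ≤ μ / Fintype.card V / 2 *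
      ‖constStack V xs - response Q f (kron (sqrtLap G) y)‖ ^ 2 := by positivity
    change _ ≤ conjObj Q f (kron (sqrtLap G) y)
    linarith
  · have h1 : ‖y₀‖ ^ 2 ≤ (|M| / Fintype.card V * √(Fintype.card V / lamMinPos G)) ^ 2 := by
      gcongr
    refine h1.trans_eq ?_
    rw [mul_pow, div_pow, sq_abs, Real.sq_sqrt (by positivity)]
    field_simp

/-- `Ψ(𝐲) + F(𝐱) ≥ ⟨𝐲, √W 𝐱⟩`. -/
theorem weak_duality [Nonempty V] (hμ : 0 < μ) (hs : ∀ k, ConjSpec Q (f k) μ) (y x : Stack V n)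
    (hx : ∀ k, x k ∈ Q) :
    inner ℝ y (kron (sqrtLap G) x) ≤ primalObj f x + dualObj G Q f y := by
  have h2 := le_conjObj hs (kron (sqrtLap G) y) x hx
  have h3 : 0 ≤ μ / Fintype.card V / 2 *
      ‖x - response Q f (kron (sqrtLap G) y)‖ ^ 2 := by positivity
  rw [inner_sqrtLap_left] at h2
  change _ ≤ _ + conjObj Q f (kron (sqrtLap G) y)
  linarith

/-- The primal-dual rate of PDSTM. -/
theorem pdstm_rate [Nontrivial V] (hG : G.Connected) (hμ : 0 < μ)
    (hc : ∀ k, StrongConvexOn Q μ (f k)) (hs : ∀ k, ConjSpec Q (f k) μ) {ys : Stack V n}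
    (hys : ∀ y, dualObj G Q f ys ≤ dualObj G Q f y) {N : ℕ} (hN : 1 ≤ N) :
    (∀ k, pdstmPrimal G Q f (dualL G μ) N k ∈ Q) ∧
    primalObj f (pdstmPrimal G Q f (dualL G μ) N)
      + dualObj G Q f (stm (gradient (dualObj G Q f)) (dualL G μ) 0 0 N).y ≤ 0 ∧
    ‖ys‖ * ‖kron (sqrtLap G) (pdstmPrimal G Q f (dualL G μ) N)‖
      ≤ 8 * (dualL G μ * ‖ys‖ ^ 2) / N ^ 2 := by
  obtain ⟨k0⟩ : Nonempty V := inferInstance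
  have hL := dualL_pos hG hμ
  have hN0 : (0 : ℝ) < N := by exact_mod_cast hN
  have hco := dual_cocoercive hG hμ hs
  have hconv := primalObj_convexOn (hc k0).1 fun k => strongConvexOn_convexOn hμ (hc k)
  -- The test point -A_N √W x minimises the linear term plus ‖y‖²/2, which leaves -A_N²‖√W x‖²/2 on
  -- the right.
  have hest := stm_estimate hco hL le_rfl 0 N
    (-(stmA (dualL G μ) 0 N • kron (sqrtLap G) (pdstmPrimal G Q f (dualL G μ) N)))
  have hA : 0 < stmA (dualL G μ) 0 N := by
    obtain ⟨j, rfl⟩ := Nat.exists_eq_add_of_le' hN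
    exact stmA_succ_pos hL le_rfl j
  have hAN := sq_le_stmA hL N
  have hα := fun k => stmAlpha_pos hL (le_refl (0 : ℝ)) k
  have hsum := sum_stmAlpha (dualL G μ) 0 N
  rw [gradient_dualObj hG hμ hs]
  unfold pdstmPrimal at *
  rw [gradient_dualObj hG hμ hs] at *
  set A := stmA (dualL G μ) 0 N
  set α := stmAlpha (dualL G μ) 0
  set t := fun k => (stm (dualGrad G Q f) (dualL G μ) 0 0 (k + 1)).t
  set X : ℕ → Stack V n := fun k => response Q f (kron (sqrtLap G) (t k)) with hX
  set x := A⁻¹ • ∑ k ∈ Finset.range N, α k • X k with hx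
  have hxs : x = ∑ k ∈ Finset.range N, (A⁻¹ * α k) • X k := by
    rw [hx, Finset.smul_sum]
    simp_rw [smul_smul]
  have hw0 : ∀ k ∈ Finset.range N, 0 ≤ A⁻¹ * α k := fun k _ =>
    mul_nonneg (inv_pos.mpr hA).le (hα k).le
  have hw1 : ∑ k ∈ Finset.range N, A⁻¹ * α k = 1 := by
    rw [← Finset.mul_sum, hsum, inv_mul_cancel₀ hA.ne']
  have hXQ : ∀ k ∈ Finset.range N, X k ∈ stackSet V Q := fun k _ => response_mem hs _
  have hxQ : x ∈ stackSet V Q := by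
    rw [hxs]; exact hconv.1.sum_mem hw0 hw1 hXQ
  have hjensen : A * primalObj f x ≤ ∑ k ∈ Finset.range N, α k * primalObj f (X k) := by
    have h1 := hconv.map_sum_le hw0 hw1 hXQ
    rw [← hxs] at h1
    have h2 := mul_le_mul_of_nonneg_left h1 hA.le
    refine h2.trans_eq ?_
    rw [Finset.mul_sum]
    refine Finset.sum_congr rfl fun k _ => ?_
    rw [smul_eq_mul]
    field_simp
  have hmodel : ∀ k y, model (dualObj G Q f) (dualGrad G Q f) 0 (t k) y
      = inner ℝ (kron (sqrtLap G) y) (X k) - primalObj f (X k) := fun k y => by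
    simp only [model, hX]
    rw [dualObj, conjObj_eq hs, inner_sqrtLap_left G (t k), inner_sqrtLap_left G y, dualGrad,
      real_inner_comm (y - t k), inner_sub_left]
    ring
  have hsumα : ∀ y : Stack V n, ∑ k ∈ Finset.range N, α k * model (dualObj G Q f)
      (dualGrad G Q f) 0 (t k) y ≤ A * inner ℝ (kron (sqrtLap G) y) x - A * primalObj f x :=
    fun y => by
    simp_rw [hmodel, mul_sub, Finset.sum_sub_distrib]
    have h1 : ∑ k ∈ Finset.range N, α k * inner ℝ (kron (sqrtLap G) y) (X k)
        = A * inner ℝ (kron (sqrtLap G) y) x := by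
      rw [hx, real_inner_smul_right, inner_sum, mul_inv_cancel_left₀ hA.ne']
      simp_rw [real_inner_smul_right]
    rw [h1]
    linarith
  set s := kron (sqrtLap G) x
  set yN := (stm (dualGrad G Q f) (dualL G μ) 0 0 N).y
  have h1 := hest.trans (add_le_add_left (hsumα _) _)
  rw [inner_sqrtLap_left, inner_neg_left, real_inner_smul_left, real_inner_self_eq_norm_sq,
    sub_zero, norm_neg, norm_smul, mul_pow, Real.norm_eq_abs, sq_abs] at h1
  have h2 : 0 ≤ (1 + A * 0) / 2 * ‖-(A • s) - (stm (dualGrad G Q f) (dualL G μ) 0 0 N).z‖ ^ 2 := by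
    rw [mul_zero]; positivity
  have h3 : A * (primalObj f x + dualObj G Q f yN + A / 2 * ‖s‖ ^ 2) ≤ A * 0 := by
    linarith
  have hgap := le_of_mul_le_mul_left h3 hA
  have hA2 : 0 ≤ A / 2 * ‖s‖ ^ 2 := by positivity
  refine ⟨hxQ, by linarith, ?_⟩
  -- Weak duality at the solution bounds the gap below by -‖ys‖‖√W x‖, against the upper bound
  -- -(A/2)‖√W x‖².
  have h4 := weak_duality (G := G) hμ hs ys x hxQ
  have h5 := hys yN
  have h6 := neg_le_of_abs_le (abs_real_inner_le_norm ys s)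
  have h7 : A / 2 * ‖s‖ ^ 2 ≤ ‖ys‖ * ‖s‖ := by linarith
  have h8 : A * ‖s‖ ≤ 2 * ‖ys‖ := by
    rcases (norm_nonneg s).eq_or_lt with h | h
    · rw [← h]; simp
    · nlinarith
  have h9 : (N : ℝ) ^ 2 / (4 * dualL G μ) * ‖s‖ ≤ 2 * ‖ys‖ :=
    (mul_le_mul_of_nonneg_right hAN (norm_nonneg s)).trans h8
  rw [div_mul_eq_mul_div, div_le_iff₀ (by positivity)] at h9
  rw [le_div_iff₀ (by positivity)]
  have h10 := mul_le_mul_of_nonneg_left h9 (norm_nonneg ys)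
  linarith

end Solution

/-! ### The programs compute the iterates -/

section States

variable {H E : Type*} [AddCommGroup H] [Module ℝ H] [AddCommGroup E] [Module ℝ E]

/-- Image of a state under a linear map. -/
def StmState.map (T : H →ₗ[ℝ] E) (s : StmState H) : StmState E := ⟨T s.y, T s.z, T s.t⟩

/-- Image of a state under a linear map. -/
def OgmState.map (T : H →ₗ[ℝ] E) (s : OgmState H) : OgmState E := ⟨T s.x, T s.y⟩

/-- Updates are linear combinations with scalar coefficients, so they commute with linear maps. This
justifies running the method on √W y. -/
theorem stmPre_map (T : H →ₗ[ℝ] E) (L μ : ℝ) (k : ℕ) (s : StmState H) :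
    stmPre L μ k (s.map T) = (stmPre L μ k s).map T := by
  simp [stmPre, StmState.map]

theorem stmPost_map (T : H →ₗ[ℝ] E) (L μ : ℝ) (k : ℕ) (g : H) (s : StmState H) :
    stmPost L μ k (T g) (s.map T) = (stmPost L μ k g s).map T := by
  simp [stmPost, StmState.map]

theorem ogmStep_map (T : H →ₗ[ℝ] E) (L : ℝ) (N i : ℕ) (g : H) (s : OgmState H) :
    ogmStep L N i (T g) (s.map T) = (ogmStep L N i g s).map T := by
  simp [ogmStep, OgmState.map]

end States

section Counts

variable {E σ : Type}

theorem commRounds_append (P P' : List (Instr E σ)) :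
    commRounds (P ++ P') = commRounds P + commRounds P' := List.countP_append

theorem oracleCalls_append (P P' : List (Instr E σ)) :
    oracleCalls (P ++ P') = oracleCalls P + oracleCalls P' := List.countP_append

theorem commRounds_flatMap (P : ℕ → List (Instr E σ)) (c : ℕ) (hP : ∀ i, commRounds (P i) = c)
    (N : ℕ) : commRounds ((List.range N).flatMap P) = N * c := by
  induction N with
  | zero => simp [commRounds]
  | succ N ih =>
    rw [List.range_succ, List.flatMap_append, commRounds_append, ih, List.flatMap_singleton, hP]
    ring

theorem oracleCalls_flatMap (P : ℕ → List (Instr E σ)) (c : ℕ) (hP : ∀ i, oracleCalls (P i) = c)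
    (N : ℕ) : oracleCalls ((List.range N).flatMap P) = N * c := by
  induction N with
  | zero => simp [oracleCalls]
  | succ N ih =>
    rw [List.range_succ, List.flatMap_append, oracleCalls_append, ih, List.flatMap_singleton, hP]
    ring

variable [AddCommGroup E] [Module ℝ E] (m L μ : ℝ) (N l : ℕ)

theorem counts_stmLoop : commRounds (stmLoop (E := E) m L μ N) = N ∧
    oracleCalls (stmLoop (E := E) m L μ N) = N := by
  constructor
  · exact (commRounds_flatMap _ 1 (fun _ => rfl) N).trans (mul_one N)
  · exact (oracleCalls_flatMap _ 1 (fun _ => rfl) N).trans (mul_one N)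

theorem counts_stmProgram : commRounds (stmProgram (E := E) m L μ N) = N ∧
    oracleCalls (stmProgram (E := E) m L μ N) = N + 1 := by
  unfold stmProgram
  rw [commRounds_append, oracleCalls_append, (counts_stmLoop m L μ N).1,
    (counts_stmLoop m L μ N).2]
  exact ⟨rfl, rfl⟩

theorem counts_pdstmProgram : commRounds (pdstmProgram (E := E) m L N) = N ∧
    oracleCalls (pdstmProgram (E := E) m L N) = N := by
  unfold pdstmProgram
  rw [commRounds_append, oracleCalls_append, (counts_stmLoop m L 0 N).1,
    (counts_stmLoop m L 0 N).2]
  exact ⟨rfl, rfl⟩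

theorem counts_ogmLoop : commRounds (ogmLoop (E := E) m L N) = 2 * N ∧
    oracleCalls (ogmLoop (E := E) m L N) = 2 * N := by
  have h1 : commRounds ((List.range N).flatMap (ogmIter (E := E) m L N)) = N :=
    (commRounds_flatMap _ 1 (fun _ => rfl) N).trans (mul_one N)
  have h2 : oracleCalls ((List.range N).flatMap (ogmIter (E := E) m L N)) = N :=
    (oracleCalls_flatMap _ 1 (fun _ => rfl) N).trans (mul_one N)
  unfold ogmLoop
  simp only [commRounds_append, oracleCalls_append, (counts_stmLoop m L 0 N).1,
    (counts_stmLoop m L 0 N).2, h1, h2]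
  constructor
  · change 0 + N + 0 + N = _; ring
  · change 0 + N + 0 + N = _; ring

theorem counts_rogmProgram : commRounds (rogmProgram (E := E) m L N l) = l * (2 * N) ∧
    oracleCalls (rogmProgram (E := E) m L N l) = l * (2 * N) + 1 := by
  have h : commRounds (List.replicate l (ogmLoop (E := E) m L N)).flatten = l * (2 * N) ∧
      oracleCalls (List.replicate l (ogmLoop (E := E) m L N)).flatten = l * (2 * N) := by
    induction l with
    | zero => simp [commRounds, oracleCalls]
    | succ l ih =>
      rw [List.replicate_succ, List.flatten_cons, commRounds_append, oracleCalls_append, ih.1,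
        ih.2, (counts_ogmLoop m L N).1, (counts_ogmLoop m L N).2]
      constructor <;> ring
  unfold rogmProgram
  rw [commRounds_append, oracleCalls_append, h.1, h.2]
  exact ⟨rfl, rfl⟩

end Counts

/-! ### Invariants of the program executions -/

section Run

variable {V : Type u} [Fintype V] {n : ℕ} (G : SimpleGraph V) [DecidableRel G.Adj]

theorem run_append {E σ : Type} (o : V → E → E) (P P' : List (Instr E σ)) (s : V → σ) :
    run G o (P ++ P') s = run G o P' (run G o P s) := List.foldl_append

theorem run_cons {E σ : Type} (o : V → E → E) (i : Instr E σ) (P : List (Instr E σ)) (s : V → σ) :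
    run G o (i :: P) s = run G o P (i.exec G o s) := rfl

variable [DecidableEq V]

/-- Multiplication by the Laplacian is local. -/
theorem kron_lap_apply (x : Stack V n) (k : V) :
    kron (G.lapMatrix ℝ) x k = ((G.neighborFinset k).val.map fun j => x j).card • x k
      - ((G.neighborFinset k).val.map fun j => x j).sum := by
  ext i
  have h1 := congrFun (col_kron (G.lapMatrix ℝ) x i) k
  rw [G.lapMatrix_mulVec_apply] at h1
  have h2 : ((G.neighborFinset k).val.map fun j => x j).sum = ∑ j ∈ G.neighborFinset k, x j := rfl
  rw [h2, Multiset.card_map, Finset.card_val, G.card_neighborFinset_eq_degree]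
  refine h1.trans ?_
  simp [col]

/-- Block `k` of `√W 𝐲`, as a linear map. -/
def blockMap (k : V) : Stack V n →ₗ[ℝ] Vec n where
  toFun y := kron (sqrtLap G) y k
  map_add' x y := by rw [kron_add]; rfl
  map_smul' c x := by
    rw [← kronLin_apply, map_smul]; rfl

theorem blockMap_apply (k : V) (y : Stack V n) : blockMap G k y = kron (sqrtLap G) y k := rfl

variable (Q : Set (Vec n)) (f : V → Vec n → ℝ)

/-- After the change of variables the gradient is √W √W x = W x, and the right side is what one
exchange with the neighbours produces. -/
theorem blockMap_dualGrad (y : Stack V n) (k : V) :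
    blockMap G k (dualGrad G Q f y)
      = ((G.neighborFinset k).val.map
          fun j => response Q f (kron (sqrtLap G) y) j).card • response Q f (kron (sqrtLap G) y) k
        - ((G.neighborFinset k).val.map fun j => response Q f (kron (sqrtLap G) y) j).sum := by
  rw [blockMap_apply, dualGrad, kron_sqrtLap_sqrtLap, kron_lap_apply]

/-- The oracles of the nodes. -/
def oracles (j : V) : Vec n → Vec n := gradient (conjFn Q (f j))

theorem run_stmIter (L μ : ℝ) (i : ℕ) (s : V → Mem (Vec n)) (st : StmState (Stack V n))
    (hs : ∀ k, (s k).stm = st.map (blockMap G k)) (k : V) :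
    (run G (oracles Q f) (stmIter (Fintype.card V) L μ i) s k).stm
      = (stmPost L μ i (dualGrad G Q f (stmPre L μ i st).t) (stmPre L μ i st)).map (blockMap G k) ∧
    (run G (oracles Q f) (stmIter (Fintype.card V) L μ i) s k).acc
      = (s k).acc + stmAlpha L μ i •
        response Q f (kron (sqrtLap G) (stmPre L μ i st).t) k := by
  have h1 : ∀ j, stmPre L μ i (s j).stm = (stmPre L μ i st).map (blockMap G j) := fun j => by
    rw [hs, stmPre_map]
  have h2 : ∀ j, oracles Q f j ((Fintype.card V : ℝ) • (stmPre L μ i (s j).stm).t)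
      = response Q f (kron (sqrtLap G) (stmPre L μ i st).t) j := fun j => by
    rw [h1]; rfl
  simp only [stmIter, run, List.foldl_cons, List.foldl_nil, Instr.exec, callAt, multiplyW]
  simp only [h2]
  refine ⟨?_, trivial⟩
  rw [← blockMap_dualGrad, h1, stmPost_map]

theorem run_stmLoop (L μ : ℝ) (N : ℕ) (s : V → Mem (Vec n)) (y0 : Stack V n)
    (hs : ∀ k, (s k).stm = StmState.map (blockMap G k) ⟨y0, y0, y0⟩) (k : V) :
    (run G (oracles Q f) (stmLoop (Fintype.card V) L μ N) s k).stm
      = (stm (dualGrad G Q f) L μ y0 N).map (blockMap G k) ∧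
    (run G (oracles Q f) (stmLoop (Fintype.card V) L μ N) s k).acc
      = (s k).acc + ∑ i ∈ Finset.range N, stmAlpha L μ i •
        response Q f (kron (sqrtLap G) (stm (dualGrad G Q f) L μ y0 (i + 1)).t) k := by
  induction N generalizing k with
  | zero => exact ⟨hs k, by simp [stmLoop, run]⟩
  | succ N ih =>
    have h1 : run G (oracles Q f) (stmLoop (Fintype.card V) L μ (N + 1)) s
        = run G (oracles Q f) (stmIter (Fintype.card V) L μ N)
          (run G (oracles Q f) (stmLoop (Fintype.card V) L μ N) s) := by
      rw [stmLoop, List.range_succ, List.flatMap_append, run_append, List.flatMap_singleton]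
      rfl
    obtain ⟨h2, h3⟩ := run_stmIter G Q f L μ N _ _ (fun j => (ih j).1) k
    rw [h1]
    refine ⟨h2, ?_⟩
    rw [h3, (ih k).2, Finset.sum_range_succ, add_assoc]
    rfl

theorem run_ogmIter (L : ℝ) (N i : ℕ) (s : V → Mem (Vec n)) (st : OgmState (Stack V n))
    (hs : ∀ k, (s k).ogm = st.map (blockMap G k)) (k : V) :
    (run G (oracles Q f) (ogmIter (Fintype.card V) L N i) s k).ogm
      = (ogmStep L N i (dualGrad G Q f st.x) st).map (blockMap G k) := by
  have h2 : ∀ j, oracles Q f j ((Fintype.card V : ℝ) • (s j).ogm.x)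
      = response Q f (kron (sqrtLap G) st.x) j := fun j => by
    rw [hs]; rfl
  simp only [ogmIter, run, List.foldl_cons, List.foldl_nil, Instr.exec, callAt, multiplyW]
  simp only [h2]
  rw [← blockMap_dualGrad, hs, ogmStep_map]

theorem run_ogmPhase (L : ℝ) (N i : ℕ) (s : V → Mem (Vec n)) (x0 : Stack V n)
    (hs : ∀ k, (s k).ogm = OgmState.map (blockMap G k) ⟨x0, x0⟩) (k : V) :
    (run G (oracles Q f) ((List.range i).flatMap (ogmIter (Fintype.card V) L N)) s k).ogm
      = (ogmPhase (dualGrad G Q f) L N x0 i).map (blockMap G k) := by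
  induction i generalizing k with
  | zero => exact hs k
  | succ i ih =>
    rw [List.range_succ, List.flatMap_append, run_append, List.flatMap_singleton]
    exact run_ogmIter G Q f L N i _ _ ih k

theorem run_ogmLoop (L : ℝ) (N : ℕ) (s : V → Mem (Vec n)) (x0 : Stack V n)
    (hs : ∀ k, (s k).ogm.x = blockMap G k x0) (k : V) :
    (run G (oracles Q f) (ogmLoop (Fintype.card V) L N) s k).ogm.x
      = blockMap G k (ogmG (dualGrad G Q f) L N x0) := by
  rw [ogmLoop, run_append, run_append, run_append]
  have h := run_ogmPhase G Q f L N N (run G (oracles Q f)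
    [.compute (fun s => { s with ogm := ⟨s.stm.y, s.stm.y⟩ })]
      (run G (oracles Q f) (stmLoop (Fintype.card V) L 0 N)
        (run G (oracles Q f) [.compute (fun s => { s with stm := ⟨s.ogm.x, s.ogm.x, s.ogm.x⟩ })]
          s))) (stm (dualGrad G Q f) L 0 x0 N).y (fun j => by
      have h1 := (run_stmLoop G Q f L 0 N (run G (oracles Q f)
        [.compute (fun s => { s with stm := ⟨s.ogm.x, s.ogm.x, s.ogm.x⟩ })] s) x0
        (fun j => by simp [run, Instr.exec, hs, StmState.map]) j).1
      change OgmState.mk _ _ = _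
      rw [h1]
      rfl) k
  rw [h]
  rfl

theorem computes_iff (P : List (Instr (Vec n) (Mem (Vec n)))) (y x : Stack V n) :
    Computes G Q f P y x ↔
      ∀ k, (run G (oracles Q f) P (fun _ => Mem.init) k).dual = blockMap G k y ∧
        (run G (oracles Q f) P (fun _ => Mem.init) k).primal = x k := Iff.rfl

/-- The oracle call overwrites the answer before the dual point is stored; `hp` says that reading
this point does not depend on the answer. -/
theorem computes_output (P : List (Instr (Vec n) (Mem (Vec n)))) (p : Mem (Vec n) → Vec n)
    (hp : ∀ s a, p { s with ans := a } = p s) (y : Stack V n)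
    (h : ∀ k, p (run G (oracles Q f) P (fun _ => Mem.init) k) = blockMap G k y) :
    Computes G Q f (P ++ output (Fintype.card V) p) y (response Q f (kron (sqrtLap G) y)) := by
  rw [computes_iff]
  intro k
  rw [run_append]
  simp only [output, callAt, run_cons, Instr.exec]
  simp only [run, List.foldl_nil]
  rw [hp]
  change p (run G (oracles Q f) P (fun _ => Mem.init) k) = _ ∧ oracles Q f k
    ((Fintype.card V : ℝ) • p (run G (oracles Q f) P (fun _ => Mem.init) k)) = _
  rw [h]
  exact ⟨rfl, rfl⟩

theorem init_stm (k : V) :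
    (Mem.init : Mem (Vec n)).stm = StmState.map (blockMap G k) ⟨0, 0, 0⟩ := by
  simp [Mem.init, StmState.map]

theorem computes_stm (L μ : ℝ) (N : ℕ) :
    Computes G Q f (stmProgram (Fintype.card V) L μ N) (stm (dualGrad G Q f) L μ 0 N).y
      (response Q f (kron (sqrtLap G) (stm (dualGrad G Q f) L μ 0 N).y)) :=
  computes_output G Q f _ _ (fun _ _ => rfl) _ fun k => by
    rw [(run_stmLoop G Q f L μ N _ 0 (init_stm G) k).1]
    rfl

theorem computes_rogm (L : ℝ) (N l : ℕ) :
    Computes G Q f (rogmProgram (Fintype.card V) L N l) (rogmG (dualGrad G Q f) L N 0 l)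
      (response Q f (kron (sqrtLap G) (rogmG (dualGrad G Q f) L N 0 l))) := by
  refine computes_output G Q f _ _ (fun _ _ => rfl) _ ?_
  induction l with
  | zero => exact fun k => (map_zero (blockMap G k)).symm
  | succ l ih =>
    intro k
    rw [List.replicate_succ', List.flatten_append, run_append, List.flatten_singleton]
    exact run_ogmLoop G Q f L N _ _ ih k

theorem computes_pdstm (L : ℝ) (N : ℕ) (hg : gradient (dualObj G Q f) = dualGrad G Q f) :
    Computes G Q f (pdstmProgram (Fintype.card V) L N) (stm (dualGrad G Q f) L 0 0 N).y
      (pdstmPrimal G Q f L N) := by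
  rw [computes_iff]
  intro k
  rw [pdstmProgram, run_append]
  obtain ⟨h1, h2⟩ := run_stmLoop G Q f L 0 N (fun _ => Mem.init) 0 (init_stm G) k
  simp only [run_cons, Instr.exec]
  simp only [run, List.foldl_nil] at *
  rw [h1, h2]
  refine ⟨rfl, ?_⟩
  rw [pdstmPrimal, hg]
  simp [Mem.init]

end Run

/-! ### The averaged objective and local Lipschitz bounds -/

section Average

variable {V : Type u} [Fintype V] {n : ℕ} {Q : Set (Vec n)} {f : V → Vec n → ℝ} {μ L : ℝ}

theorem strongConvexOn_average [Nonempty V] (hc : ∀ k, StrongConvexOn Q μ (f k)) :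
    StrongConvexOn Q μ fun x => (∑ k, f k x) / Fintype.card V := by
  have hm : (0 : ℝ) < Fintype.card V := by exact_mod_cast Fintype.card_pos
  obtain ⟨k0⟩ : Nonempty V := inferInstance
  refine ⟨(hc k0).1, fun x hx y hy a b ha hb hab => ?_⟩
  rw [smul_eq_mul, smul_eq_mul]
  have h1 : a * ((∑ k, f k x) / Fintype.card V) + b * ((∑ k, f k y) / Fintype.card V)
      - a * b * (μ / 2 * ‖x - y‖ ^ 2) = (∑ k, (a * f k x + b * f k y
        - a * b * (μ / 2 * ‖x - y‖ ^ 2))) / Fintype.card V := by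
    rw [Finset.sum_sub_distrib, Finset.sum_add_distrib, Finset.sum_const, Finset.card_univ,
      ← Finset.mul_sum, ← Finset.mul_sum, nsmul_eq_mul]
    field_simp
  refine le_of_le_of_eq ?_ h1.symm
  change (∑ k, f k (a • x + b • y)) / _ ≤ _
  gcongr with k
  exact (hc k).2 hx hy ha hb hab

theorem lipschitz_on_ball_of_smooth {h : Vec n → ℝ} (hd : Differentiable ℝ h) (hL0 : 0 ≤ L)
    (hL : ∀ x y, ‖gradient h x - gradient h y‖ ≤ L * ‖x - y‖) (xs : Vec n) {x y : Vec n}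
    (hx : x ∈ Metric.closedBall xs 1) (hy : y ∈ Metric.closedBall xs 1) :
    |h x - h y| ≤ (‖gradient h xs‖ + L) * ‖x - y‖ := by
  rw [← Real.norm_eq_abs]
  refine (convex_closedBall xs 1).norm_image_sub_le_of_norm_fderiv_le (𝕜 := ℝ)
    (fun z _ => hd z) (fun z hz => ?_) hy hx
  have h1 : ‖fderiv ℝ h z‖ = ‖gradient h z‖ := by
    rw [gradient, LinearIsometryEquiv.norm_map]
  have h2 := norm_add_le (gradient h z - gradient h xs) (gradient h xs)
  rw [sub_add_cancel] at h2
  rw [Metric.mem_closedBall, dist_eq_norm] at hz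
  have h3 := (hL z xs).trans (mul_le_mul_of_nonneg_left hz hL0)
  rw [h1]
  linarith

end Average

/-- Arithmetic of the restarts: p is the factor by which the gradient norm has shrunk and d the
distance to the solution. Strong convexity gives d ≤ p(Λ/m)R, so both d·g and R·g are at most ε/4.
-/
theorem gap_bounds {ε R g g0 d Λ m p : ℝ} (hε : 0 < ε) (hR : 0 ≤ R) (hg : 0 ≤ g) (hg0 : 0 ≤ g0)
    (hΛ : 0 < Λ) (hm : 0 < m) (hκ : 1 ≤ Λ / m) (hp : 0 < p)
    (hT : p * (2 + Λ / m * (g0 * R / ε)) ^ 2 ≤ 1) (h1 : g ≤ p * g0) (h0 : g0 ≤ Λ * R)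
    (h2 : m * d ≤ g) : (d + R) * g ≤ ε ∧ R * g ≤ ε := by
  set κ := Λ / m with hκdef
  set X := κ * (g0 * R / ε) with hX
  have hX0 : 0 ≤ X := by positivity
  have hXε : κ * (g0 * R) = X * ε := by rw [hX]; field_simp
  have hpX : 4 * (p * X) ≤ 1 := by
    have : 0 ≤ p * X ^ 2 := by positivity
    linarith [show p * (2 + X) ^ 2 = 4 * p + 4 * (p * X) + p * X ^ 2 by ring]
  have hp4 : 4 * p ≤ 1 := by
    have : 0 ≤ p * (4 * X + X ^ 2) := by positivity
    linarith [show p * (2 + X) ^ 2 = 4 * p + p * (4 * X + X ^ 2) by ring]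
  have hRg0 : g0 * R ≤ X * ε := by
    rw [← hXε]; exact le_mul_of_one_le_left (by positivity) hκ
  have hRg : R * g ≤ ε / 4 := by
    calc R * g ≤ R * (p * g0) := by gcongr
      _ = p * (g0 * R) := by ring
      _ ≤ p * (X * ε) := by gcongr
      _ = p * X * ε := by ring
      _ ≤ 1 / 4 * ε := by gcongr; linarith
      _ = ε / 4 := by ring
  have hD : d ≤ p * (κ * R) := by
    have h3 : d ≤ g / m := by rw [le_div_iff₀ hm, mul_comm]; exact h2
    have h4 : g ≤ p * (Λ * R) := h1.trans (by gcongr)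
    calc d ≤ g / m := h3
      _ ≤ p * (Λ * R) / m := by gcongr
      _ = p * (κ * R) := by rw [hκdef]; ring
  have hDg : d * g ≤ ε / 4 := by
    calc d * g ≤ p * (κ * R) * (p * g0) := by gcongr
      _ = p * (p * (κ * (g0 * R))) := by ring
      _ = p * (p * X * ε) := by rw [hXε]; ring
      _ ≤ 1 * (1 / 4 * ε) := by
        gcongr
        · linarith
        · linarith
      _ = ε / 4 := by ring
  constructor
  · linarith [add_mul d R g]
  · linarith

/-! ### Accuracy of each method -/

section Cases

variable {V : Type u} [Fintype V] [DecidableEq V] [Nontrivial V] {G : SimpleGraph V}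
  [DecidableRel G.Adj] {n : ℕ} {Q : Set (Vec n)} {f : V → Vec n → ℝ} {μ ε : ℝ}

theorem gapsLE_response (hs : ∀ k, ConjSpec Q (f k) μ) {R : ℝ} {y : Stack V n}
    (h1 : ‖y‖ * ‖dualGrad G Q f y‖ ≤ ε) (h2 : R * ‖dualGrad G Q f y‖ ≤ ε) :
    GapsLE G Q f R ε y (response Q f (kron (sqrtLap G) y)) :=
  ⟨response_mem hs _, by
    rw [gap_response hs]; exact (real_inner_le_norm _ _).trans h1, h2⟩

theorem ogm_case (hG : G.Connected) (hμ : 0 < μ) (hε : 0 < ε)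
    (hs : ∀ k, ConjSpec Q (f k) μ) {ys : Stack V n}
    (hys : ∀ y, dualObj G Q f ys ≤ dualObj G Q f y) {N : ℕ} (hN : 1 ≤ N)
    (hN2 : 39 * (dualL G μ * ‖ys‖ ^ 2 / ε) ≤ (N : ℝ) ^ 2) :
    GapsLE G Q f ‖ys‖ ε (ogmG (dualGrad G Q f) (dualL G μ) N 0)
      (response Q f (kron (sqrtLap G) (ogmG (dualGrad G Q f) (dualL G μ) N 0))) := by
  have hL := dualL_pos hG hμ
  have hco := dual_cocoercive hG hμ hs
  have hN0 : (0 : ℝ) < N := by exact_mod_cast hN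
  have h1 := norm_gradient_ogmG_le hco hL hys 0 hN
  have h2 := norm_ogmG_sub_le hco hL hys 0 hN
  rw [zero_sub, norm_neg] at h1 h2
  set y := ogmG (dualGrad G Q f) (dualL G μ) N 0
  set g := ‖dualGrad G Q f y‖
  have h3 : ‖y‖ ≤ 13 * ‖ys‖ := by
    have := norm_add_le (y - ys) ys
    rw [sub_add_cancel] at this
    linarith
  -- The output has norm at most (12 + 1)R and gradient at most 3L_ΨR/N², which explains 39 = 13 ·
  -- 3.
  have h4 : 13 * ‖ys‖ * g ≤ ε := by
    have h5 : 13 * ‖ys‖ * g ≤ 13 * ‖ys‖ * (3 * dualL G μ * ‖ys‖ / N ^ 2) := by gcongr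
    refine h5.trans ?_
    have h6 : 13 * ‖ys‖ * (3 * dualL G μ * ‖ys‖ / N ^ 2)
        = 39 * (dualL G μ * ‖ys‖ ^ 2 / ε) * ε / N ^ 2 := by field_simp; ring
    rw [h6, div_le_iff₀ (by positivity), mul_comm ε]
    gcongr
  have hg : 0 ≤ g := norm_nonneg _
  refine gapsLE_response hs ((mul_le_mul_of_nonneg_right h3 hg).trans h4) ?_
  have : 0 ≤ ‖ys‖ * g := by positivity
  change ‖ys‖ * g ≤ ε
  linarith

/-- Add the two strong convexity inequalities between y and the minimiser, where the gradient
vanishes, and apply Cauchy–Schwarz. -/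
theorem norm_sub_le_of_strongly_convex {L : ℝ} (hG : G.Connected) (hμ : 0 < μ) (hL0 : 0 < L)
    (hd : ∀ k, Differentiable ℝ (f k))
    (hL : ∀ k x y, ‖gradient (f k) x - gradient (f k) y‖ ≤ L * ‖x - y‖)
    (hs : ∀ k, ConjSpec Set.univ (f k) μ) {ys : Stack V n} (hysK : ys ∈ sumZero V n)
    (hys : ∀ y, dualObj G Set.univ f ys ≤ dualObj G Set.univ f y) {y : Stack V n}
    (hy : y ∈ sumZero V n) :
    dualMu G L * ‖y - ys‖ ≤ ‖dualGrad G Set.univ f y‖ := by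
  have h1 := dual_strongly_convex hG hμ hL0 hd hL hs ((sumZero V n).sub_mem hysK hy)
  have h2 := dual_strongly_convex hG hμ hL0 hd hL hs ((sumZero V n).sub_mem hy hysK)
  have h0 := (dual_cocoercive hG hμ hs).eq_zero_of_isMinOn (dualL_pos hG hμ) hys
  unfold model at h1 h2
  rw [h0, inner_zero_left] at h2
  rw [norm_sub_rev] at h1
  have h3 : inner ℝ (dualGrad G Set.univ f y) (ys - y)
      = - inner ℝ (dualGrad G Set.univ f y) (y - ys) := by rw [← inner_neg_right, neg_sub]
  have h4 := real_inner_le_norm (dualGrad G Set.univ f y) (y - ys)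
  rcases (norm_nonneg (y - ys)).eq_or_lt with h | h
  · rw [← h]; simp
  · refine le_of_mul_le_mul_right ?_ h
    linarith

/-- Accuracy of ROGM-G in the strongly convex smooth case. -/
theorem rogm_case {L : ℝ} (hG : G.Connected) (hμ : 0 < μ) (hε : 0 < ε) (hμL : μ ≤ L)
    (hd : ∀ k, Differentiable ℝ (f k))
    (hL : ∀ k x y, ‖gradient (f k) x - gradient (f k) y‖ ≤ L * ‖x - y‖)
    (hs : ∀ k, ConjSpec Set.univ (f k) μ) {ys : Stack V n} (hysK : ys ∈ sumZero V n)
    (hys : ∀ y, dualObj G Set.univ f ys ≤ dualObj G Set.univ f y) {N l : ℕ} (hN : 1 ≤ N)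
    (hN2 : 6 * (L / μ * chi G) ≤ (N : ℝ) ^ 2)
    (hl : (2 + L / μ * chi G * (‖dualGrad G Set.univ f 0‖ * ‖ys‖ / ε)) ^ 2 ≤ 2 ^ l) :
    GapsLE G Set.univ f ‖ys‖ ε (rogmG (dualGrad G Set.univ f) (dualL G μ) N 0 l)
      (response Set.univ f
        (kron (sqrtLap G) (rogmG (dualGrad G Set.univ f) (dualL G μ) N 0 l))) := by
  have hL0 : 0 < L := hμ.trans_le hμL
  have hLd := dualL_pos hG hμ
  have hMd := dualMu_pos hG hL0
  have hco := dual_cocoercive hG hμ hs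
  have hK := dualGrad_mem (Q := Set.univ) (f := f) G
  have hsc := fun y hy => norm_sub_le_of_strongly_convex hG hμ hL0 hd hL hs hysK hys (y := y) hy
  rw [← dualL_div_dualMu hG hμ hL0] at hN2 hl
  have h1 := norm_gradient_rogmG_le hco hLd hys hK hMd hsc (Submodule.zero_mem _) hN hN2 l
  have h2 := hsc _ (rogmG_mem hK (L := dualL G μ) (N := N) (Submodule.zero_mem _) l)
  have h0 := hco.lipschitz hLd 0 ys
  rw [hco.eq_zero_of_isMinOn hLd hys, sub_zero, zero_sub, norm_neg] at h0
  have hκ : 1 ≤ dualL G μ / dualMu G L := by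
    rw [dualL_div_dualMu hG hμ hL0]
    exact one_le_mul_of_one_le_of_one_le ((one_le_div hμ).mpr hμL) (one_le_chi hG)
  have hp : (1 / 2 : ℝ) ^ l *
      (2 + dualL G μ / dualMu G L * (‖dualGrad G Set.univ f 0‖ * ‖ys‖ / ε)) ^ 2 ≤ 1 := by
    rw [one_div, inv_pow, inv_mul_le_iff₀ (by positivity), mul_one]; exact hl
  obtain ⟨h3, h4⟩ := gap_bounds hε (norm_nonneg ys) (norm_nonneg _) (norm_nonneg _)
    hLd hMd hκ (by positivity) hp h1 h0 h2
  refine gapsLE_response hs (le_trans (mul_le_mul_of_nonneg_right ?_ (norm_nonneg _)) h3) h4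
  have := norm_add_le (rogmG (dualGrad G Set.univ f) (dualL G μ) N 0 l - ys) ys
  rwa [sub_add_cancel] at this

/-- Accuracy of STM in the strongly convex smooth case. -/
theorem stm_case {L : ℝ} (hG : G.Connected) (hμ : 0 < μ) (hε : 0 < ε) (hL0 : 0 < L)
    (hd : ∀ k, Differentiable ℝ (f k))
    (hL : ∀ k x y, ‖gradient (f k) x - gradient (f k) y‖ ≤ L * ‖x - y‖)
    (hs : ∀ k, ConjSpec Set.univ (f k) μ) {ys : Stack V n} (hysK : ys ∈ sumZero V n)
    (hys : ∀ y, dualObj G Set.univ f ys ≤ dualObj G Set.univ f y) {N : ℕ}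
    (hN : (2 * (dualL G μ * ‖ys‖ ^ 2 / ε)) ^ 2 ≤ (1 + √(dualMu G L / dualL G μ)) ^ N) :
    GapsLE G Set.univ f ‖ys‖ ε
      (stm (dualGrad G Set.univ f) (dualL G μ) (dualMu G L) 0 (N + 1)).y
      (response Set.univ f (kron (sqrtLap G)
        (stm (dualGrad G Set.univ f) (dualL G μ) (dualMu G L) 0 (N + 1)).y)) := by
  have hLd := dualL_pos hG hμ
  have hMd := dualMu_pos hG hL0
  have hco := dual_cocoercive hG hμ hs
  have hK := dualGrad_mem (Q := Set.univ) (f := f) G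
  have hm : ∀ k, model (dualObj G Set.univ f) (dualGrad G Set.univ f) (dualMu G L)
      (stm (dualGrad G Set.univ f) (dualL G μ) (dualMu G L) 0 (k + 1)).t ys
      ≤ dualObj G Set.univ f ys := fun k =>
    dual_strongly_convex hG hμ hL0 hd hL hs
      ((sumZero V n).sub_mem hysK (stm_mem hK (Submodule.zero_mem _) (k + 1)).2.2)
  have h1 := stm_rate hco hLd hMd.le 0 ys hm (N + 1)
  have h2 := norm_le_two_mul_of_norm_sub_le (stm_norm_sub_le hco hLd hMd.le 0 ys hys hm (N + 1))
  have h3 := pow_le_stmA hLd hMd.le N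
  have h4 := hco.norm_sq_le hLd hys
    (stm (dualGrad G Set.univ f) (dualL G μ) (dualMu G L) 0 (N + 1)).y
  have hA := stmA_succ_pos hLd hMd.le N
  rw [sub_zero] at h1
  have h5 : 0 ≤ (1 + stmA (dualL G μ) (dualMu G L) (N + 1) * dualMu G L) / 2 *
      ‖ys - (stm (dualGrad G Set.univ f) (dualL G μ) (dualMu G L) 0 (N + 1)).z‖ ^ 2 := by
    positivity
  set A := stmA (dualL G μ) (dualMu G L) (N + 1)
  set y := (stm (dualGrad G Set.univ f) (dualL G μ) (dualMu G L) 0 (N + 1)).y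
  set g := ‖dualGrad G Set.univ f y‖
  have hg : 0 ≤ g := norm_nonneg _
  have hRg : 2 * ‖ys‖ * g ≤ ε := by
    refine le_of_sq_le_sq ?_ hε.le
    -- The squared gradient is at most 2L_Ψ times the value gap, and the gap is at most R²/(2A).
    have h6 : A * g ^ 2 ≤ dualL G μ * ‖ys‖ ^ 2 := by
      have := mul_le_mul_of_nonneg_left h4 hA.le
      nlinarith
    have h7 : (2 * (dualL G μ * ‖ys‖ ^ 2 / ε)) ^ 2 / dualL G μ ≤ A :=
      le_trans (by gcongr) h3
    have h8 : (2 * (dualL G μ * ‖ys‖ ^ 2 / ε)) ^ 2 / dualL G μ * g ^ 2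
        ≤ dualL G μ * ‖ys‖ ^ 2 := le_trans (by gcongr) h6
    -- For R = 0 the bound `h8` cannot be divided by R², but the claim is trivial.
    rcases (norm_nonneg ys).eq_or_lt with h | h
    · rw [← h]; simp; positivity
    · have h9 : (2 * (dualL G μ * ‖ys‖ ^ 2 / ε)) ^ 2 / dualL G μ * g ^ 2
          = dualL G μ * ‖ys‖ ^ 2 * ((2 * ‖ys‖ * g) ^ 2 / ε ^ 2) := by field_simp
      rw [h9] at h8
      have h10 : (2 * ‖ys‖ * g) ^ 2 / ε ^ 2 ≤ 1 := by
        refine le_of_mul_le_mul_left ?_ (show 0 < dualL G μ * ‖ys‖ ^ 2 by positivity)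
        rw [mul_one]; exact h8
      rwa [div_le_one (by positivity)] at h10
  refine gapsLE_response hs ((mul_le_mul_of_nonneg_right h2 hg).trans hRg) ?_
  change ‖ys‖ * g ≤ ε
  have : 0 ≤ ‖ys‖ * g := by positivity
  linarith

end Cases

/-! ### Choice of iteration numbers and their cost -/

section Parameters

theorem log_two_add_ge {X : ℝ} (hX : 0 ≤ X) : 1 / 2 ≤ Real.log (2 + X) := by
  have h1 := Real.log_two_gt_d9
  have h2 : Real.log 2 ≤ Real.log (2 + X) := Real.log_le_log two_pos (by linarith)
  linarith

/-- The number of restarts. -/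
theorem sq_le_two_pow {T : ℝ} (hT : 2 ≤ T) {l : ℕ} (hl : 3 * Real.log T ≤ l) :
    T ^ 2 ≤ 2 ^ l := by
  have h1 := Real.log_two_gt_d9
  have hT0 : 0 < T := by linarith
  have hlog : 0 ≤ Real.log T := Real.log_nonneg (by linarith)
  rw [← Real.log_le_log_iff (by positivity) (by positivity), Real.log_pow, Real.log_pow]
  push_cast
  -- Here 3 log 2 ≥ 2.
  nlinarith

/-- The number of iterations with a linear rate. -/
theorem pow_four_le_pow {κ T : ℝ} (hκ : 1 ≤ κ) (hT : 2 ≤ T) {N : ℕ}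
    (hN : 8 * (√κ * Real.log T) ≤ N) : T ^ 4 ≤ (1 + √(κ⁻¹)) ^ N := by
  have hs : 1 ≤ √κ := Real.one_le_sqrt.mpr hκ
  have hs0 : 0 < √κ := by linarith
  have hT0 : 0 < T := by linarith
  have hlog : 0 ≤ Real.log T := Real.log_nonneg (by linarith)
  rw [Real.sqrt_inv, ← Real.log_le_log_iff (by positivity) (by positivity), Real.log_pow,
    Real.log_pow]
  push_cast
  have h1 := Real.one_sub_inv_le_log_of_pos (show 0 < 1 + (√κ)⁻¹ by positivity)
  -- With log(1 + 1/√κ) ≥ 1/(√κ + 1) ≥ 1/(2√κ), eight times √κ log T iterations yield the fourth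
  -- power.
  have h2 : 1 / (2 * √κ) ≤ 1 - (1 + (√κ)⁻¹)⁻¹ := by
    have : 1 - (1 + (√κ)⁻¹)⁻¹ = 1 / (√κ + 1) := by field_simp; ring
    rw [this]
    gcongr
    linarith
  have h3 : (N : ℝ) * (1 / (2 * √κ)) ≤ N * Real.log (1 + (√κ)⁻¹) := by
    gcongr
    exact h2.trans h1
  have h4 : 8 * (√κ * Real.log T) * (1 / (2 * √κ)) ≤ (N : ℝ) * (1 / (2 * √κ)) := by gcongr
  have h5 : 8 * (√κ * Real.log T) * (1 / (2 * √κ)) = 4 * Real.log T := by field_simp; ring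
  linarith

theorem rogm_count {κ T : ℝ} (hκ : 1 ≤ κ) (hT : 1 / 2 ≤ Real.log T) :
    (⌈3 * Real.log T⌉₊ : ℝ) * (2 * ⌈3 * √κ⌉₊) + 1 ≤ 50 * (√κ * Real.log T) := by
  have hs : 1 ≤ √κ := Real.one_le_sqrt.mpr hκ
  have h1 : (⌈3 * Real.log T⌉₊ : ℝ) ≤ 5 * Real.log T := by
    have := Nat.ceil_lt_add_one (show 0 ≤ 3 * Real.log T by linarith)
    linarith
  have h2 : (⌈3 * √κ⌉₊ : ℝ) ≤ 4 * √κ := by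
    have := Nat.ceil_lt_add_one (show 0 ≤ 3 * √κ by linarith)
    linarith
  have h3 : (⌈3 * Real.log T⌉₊ : ℝ) * (2 * ⌈3 * √κ⌉₊) ≤ 5 * Real.log T * (2 * (4 * √κ)) := by
    gcongr
  have h4 : 1 * (1 / 2) ≤ √κ * Real.log T := by gcongr
  linarith

theorem stm_count {κ T : ℝ} (hκ : 1 ≤ κ) (hT : 1 / 2 ≤ Real.log T) :
    ((⌈8 * (√κ * Real.log T)⌉₊ + 1 : ℕ) : ℝ) + 1 ≤ 50 * (√κ * Real.log T) := by
  have hs : 1 ≤ √κ := Real.one_le_sqrt.mpr hκ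
  have h4 : 1 * (1 / 2) ≤ √κ * Real.log T := by gcongr
  have := Nat.ceil_lt_add_one (show 0 ≤ 8 * (√κ * Real.log T) by linarith)
  push_cast
  linarith

/-- The factor 7 covers the constant 39 < 49 of OGM-G, and the extra iteration keeps N ≥ 1 when X =
0. Twice N plus one is the number of oracle calls of OGM-G. -/
theorem sqrt_count (X : ℝ) : 2 * ((⌈7 * √X⌉₊ + 1 : ℕ) : ℝ) + 1 ≤ 50 * (1 + √X) := by
  have h := Real.sqrt_nonneg X
  have := Nat.ceil_lt_add_one (show 0 ≤ 7 * √X by linarith)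
  push_cast
  linarith

theorem le_sq_of_ceil_sqrt_le {X : ℝ} (hX : 0 ≤ X) {N : ℕ} (hN : ⌈7 * √X⌉₊ + 1 ≤ N) :
    39 * X ≤ (N : ℝ) ^ 2 := by
  have h1 : 7 * √X ≤ N := (Nat.le_ceil _).trans (by exact_mod_cast (Nat.le_succ _).trans hN)
  have h2 : (7 * √X) ^ 2 ≤ (N : ℝ) ^ 2 := by gcongr
  rw [mul_pow, Real.sq_sqrt hX] at h2
  linarith

end Parameters

section Main

variable {V : Type u} [Fintype V] [DecidableEq V] [Nontrivial V] {G : SimpleGraph V}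
  [DecidableRel G.Adj] {n : ℕ} {f : V → Vec n → ℝ} {μ : ℝ}

/-- A dual solution of smallest norm in the strongly convex smooth case. -/
theorem exists_dualRadius_smooth {L : ℝ} (hG : G.Connected) (hμ : 0 < μ) (hL0 : 0 ≤ L)
    (hc : ∀ k, StrongConvexOn Set.univ μ (f k)) (hd : ∀ k, Differentiable ℝ (f k))
    (hL : ∀ k x y, ‖gradient (f k) x - gradient (f k) y‖ ≤ L * ‖x - y‖)
    (hs : ∀ k, ConjSpec Set.univ (f k) μ) :
    ∃ ys : Stack V n, (∀ y, dualObj G Set.univ f ys ≤ dualObj G Set.univ f y) ∧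
      ys ∈ sumZero V n ∧ IsDualRadius G Set.univ f ‖ys‖ := by
  have hcont : Continuous fun x => (∑ k, f k x) / Fintype.card V :=
    (continuous_finsetSum _ fun k _ => (hd k).continuous).div_const _
  obtain ⟨xs, -, hxs⟩ := exists_min_of_strongConvexOn isClosed_univ Set.univ_nonempty
    (strongConvexOn_average hc) hμ (hcont.lowerSemicontinuous.lowerSemicontinuousOn _)
  -- Only the existence of a dual minimiser is needed, so a crude Lipschitz constant on the unit
  -- ball around the solution will do.
  obtain ⟨y₀, hy₀, -⟩ := exists_dual_solution (M := ∑ k, (‖gradient (f k) xs‖ + L)) hG hμ hc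
    (Set.mem_univ xs) (fun x hx => hxs x hx) one_pos (fun k x hx y hy => by
      refine (lipschitz_on_ball_of_smooth (hd k) hL0 (hL k) xs hx.2 hy.2).trans ?_
      gcongr
      exact Finset.single_le_sum (f := fun k => ‖gradient (f k) xs‖ + L)
        (fun i _ => add_nonneg (norm_nonneg _) hL0) (Finset.mem_univ k)) hs
  obtain ⟨ys, h1, h2, h3, -⟩ := exists_dualRadius hG hμ hs hy₀
  exact ⟨ys, h1, h2, h3⟩

end Main

end DualDecentralized

end

/-! ### Assembly of the two cases -/

open DualDecentralized in
theorem mainTheorem3 :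
    ∃ C : ℝ, 0 < C ∧
      ∀ (V : Type*) [Fintype V] [DecidableEq V] [Nontrivial V] (G : SimpleGraph V)
        [DecidableRel G.Adj] (_ : G.Connected) (n : ℕ) (_ : 1 ≤ n) (f : V → Vec n → ℝ)
        (μ ε : ℝ) (_ : 0 < μ) (_ : 0 < ε),
      -- `f_k` is `μ`-strongly convex and `L`-smooth, `Q = ℝⁿ`
      (∀ L : ℝ, (∀ k, StrongConvexOn Set.univ μ (f k)) → (∀ k, Differentiable ℝ (f k)) →
        (∀ k x y, ‖gradient (f k) x - gradient (f k) y‖ ≤ L * ‖x - y‖) →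
        ∃ R : ℝ, IsDualRadius G Set.univ f R ∧
          -- ROGM-G
          (∃ N l : ℕ,
            (commRounds (rogmProgram (E := Vec n) (Fintype.card V) (dualL G μ) N l) : ℝ)
              ≤ C * (√(L / μ * chi G) * Real.log (2 + L / μ * chi G *
                  (‖gradient (dualObj G Set.univ f) 0‖ * R / ε))) ∧
            (oracleCalls (rogmProgram (E := Vec n) (Fintype.card V) (dualL G μ) N l) : ℝ)
              ≤ C * (√(L / μ * chi G) * Real.log (2 + L / μ * chi G *
                  (‖gradient (dualObj G Set.univ f) 0‖ * R / ε))) ∧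
            ∀ N' ≥ N, ∀ l' ≥ l, ∃ y x : Stack V n,
              y = rogmG (gradient (dualObj G Set.univ f)) (dualL G μ) N' 0 l' ∧
              x = response Set.univ f (kron (sqrtLap G) y) ∧
              Computes G Set.univ f
                (rogmProgram (Fintype.card V) (dualL G μ) N' l') y x ∧
              GapsLE G Set.univ f R ε y x) ∧
          -- PDSTM in its form for strongly convex dual functions, STM(`L_Ψ`, `μ_Ψ`, `0`)
          (∃ N : ℕ,
            (commRounds (stmProgram (E := Vec n) (Fintype.card V) (dualL G μ) (dualMu G L) N) : ℝ)
              ≤ C * (√(L / μ * chi G) * Real.log (2 + L / μ * chi G *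
                  (dualL G μ * R ^ 2 / ε))) ∧
            (oracleCalls (stmProgram (E := Vec n) (Fintype.card V) (dualL G μ) (dualMu G L) N) : ℝ)
              ≤ C * (√(L / μ * chi G) * Real.log (2 + L / μ * chi G *
                  (dualL G μ * R ^ 2 / ε))) ∧
            ∀ N' ≥ N, ∃ y x : Stack V n,
              y = (stm (gradient (dualObj G Set.univ f)) (dualL G μ) (dualMu G L) 0 N').y ∧
              x = response Set.univ f (kron (sqrtLap G) y) ∧
              Computes G Set.univ f
                (stmProgram (Fintype.card V) (dualL G μ) (dualMu G L) N') y x ∧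
              GapsLE G Set.univ f R ε y x)) ∧
      -- `f_k` is `μ`-strongly convex on `Q` and `M`-Lipschitz on `Q` near the solution `xs`
      (∀ (Q : Set (Vec n)) (M r : ℝ) (xs : Vec n), IsClosed Q →
        (∀ k, StrongConvexOn Q μ (f k)) → (∀ k, LowerSemicontinuousOn (f k) Q) →
        xs ∈ Q → IsMinOn (fun x => (∑ k, f k x) / Fintype.card V) Q xs → 0 < r →
        (∀ k, ∀ x ∈ Q ∩ Metric.closedBall xs r, ∀ y ∈ Q ∩ Metric.closedBall xs r,
          |f k x - f k y| ≤ M * ‖x - y‖) →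
        ∃ R : ℝ, IsDualRadius G Q f R ∧
          -- OGM-G
          (∃ N : ℕ,
            (commRounds (rogmProgram (E := Vec n) (Fintype.card V) (dualL G μ) N 1) : ℝ)
              ≤ C * (1 + √(M ^ 2 / (μ * ε) * chi G)) ∧
            (oracleCalls (rogmProgram (E := Vec n) (Fintype.card V) (dualL G μ) N 1) : ℝ)
              ≤ C * (1 + √(M ^ 2 / (μ * ε) * chi G)) ∧
            ∀ N' ≥ N, ∃ y x : Stack V n,
              y = ogmG (gradient (dualObj G Q f)) (dualL G μ) N' 0 ∧
              x = response Q f (kron (sqrtLap G) y) ∧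
              Computes G Q f (rogmProgram (Fintype.card V) (dualL G μ) N' 1) y x ∧
              GapsLE G Q f R ε y x) ∧
          -- PDSTM
          (∃ N : ℕ,
            (commRounds (pdstmProgram (E := Vec n) (Fintype.card V) (dualL G μ) N) : ℝ)
              ≤ C * (1 + √(M ^ 2 / (μ * ε) * chi G)) ∧
            (oracleCalls (pdstmProgram (E := Vec n) (Fintype.card V) (dualL G μ) N) : ℝ)
              ≤ C * (1 + √(M ^ 2 / (μ * ε) * chi G)) ∧
            ∀ N' ≥ N, ∃ y x : Stack V n,
              y = (stm (gradient (dualObj G Q f)) (dualL G μ) 0 0 N').y ∧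
              x = pdstmPrimal G Q f (dualL G μ) N' ∧
              Computes G Q f (pdstmProgram (Fintype.card V) (dualL G μ) N') y x ∧
              GapsLE G Q f R ε y x)) := by
  refine ⟨50, by norm_num, ?_⟩
  intro V _ _ _ G _ hG n hn f μ ε hμ hε
  refine ⟨?_, ?_⟩
  · intro L hc hd hL
    obtain ⟨k0⟩ : Nonempty V := inferInstance
    have hμL : μ ≤ L := strong_le_smooth hn (hc k0) hμ (hd k0) (hL k0)
    have hL0 : 0 < L := hμ.trans_le hμL
    have hs : ∀ k, ConjSpec Set.univ (f k) μ := fun k =>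
      conjSpec_of_strongConvexOn isClosed_univ Set.univ_nonempty (hc k) hμ
        ((hd k).continuous.lowerSemicontinuous.lowerSemicontinuousOn _)
    obtain ⟨ys, hys, hysK, hR⟩ := exists_dualRadius_smooth hG hμ hL0.le hc hd hL hs
    have hκ : 1 ≤ L / μ * chi G :=
      one_le_mul_of_one_le_of_one_le ((one_le_div hμ).mpr hμL) (one_le_chi hG)
    have hLd := dualL_pos hG hμ
    rw [gradient_dualObj hG hμ hs]
    refine ⟨‖ys‖, hR, ?_, ?_⟩
    · have hX : 0 ≤ L / μ * chi G * (‖dualGrad G Set.univ f 0‖ * ‖ys‖ / ε) := by positivity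
      set T := 2 + L / μ * chi G * (‖dualGrad G Set.univ f 0‖ * ‖ys‖ / ε) with hT
      have hlog : 1 / 2 ≤ Real.log T := log_two_add_ge hX
      have hcount := rogm_count hκ hlog
      -- This makes N² ≥ 9κ ≥ 6κ for κ = (L/μ)χ = L_Ψ/μ_Ψ, enough for each restart to halve the
      -- gradient.
      refine ⟨⌈3 * √(L / μ * chi G)⌉₊, ⌈3 * Real.log T⌉₊, ?_, ?_, fun N hN l hl => ?_⟩
      · rw [(counts_rogmProgram _ _ _ _).1]
        push_cast
        linarith
      · rw [(counts_rogmProgram _ _ _ _).2]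
        push_cast
        linarith
      · refine ⟨_, _, rfl, rfl, computes_rogm G _ f _ N l,
          rogm_case hG hμ hε hμL hd hL hs hysK hys ?_ ?_ ?_⟩
        · refine le_trans (Nat.ceil_pos.mpr ?_) hN
          have : 1 ≤ √(L / μ * chi G) := Real.one_le_sqrt.mpr hκ
          linarith
        · have h1 : 3 * √(L / μ * chi G) ≤ N := (Nat.le_ceil _).trans (by exact_mod_cast hN)
          have h2 : (3 * √(L / μ * chi G)) ^ 2 ≤ (N : ℝ) ^ 2 := by gcongr
          rw [mul_pow, Real.sq_sqrt (by linarith)] at h2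
          linarith
        · exact sq_le_two_pow (by linarith) ((Nat.le_ceil _).trans (by exact_mod_cast hl))
    · have hX : 0 ≤ L / μ * chi G * (dualL G μ * ‖ys‖ ^ 2 / ε) := by positivity
      set T := 2 + L / μ * chi G * (dualL G μ * ‖ys‖ ^ 2 / ε) with hT
      have hlog : 1 / 2 ≤ Real.log T := log_two_add_ge hX
      have hcount := stm_count hκ hlog
      -- The final + 1 matches the geometric bound, which is for A_{j+1} with exponent j.
      refine ⟨⌈8 * (√(L / μ * chi G) * Real.log T)⌉₊ + 1, ?_, ?_, fun N hN => ?_⟩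
      · rw [(counts_stmProgram _ _ _ _).1]
        linarith
      · rw [(counts_stmProgram _ _ _ _).2]
        push_cast at hcount ⊢
        linarith
      · obtain ⟨j, rfl⟩ := Nat.exists_eq_add_of_le' (Nat.le_trans (Nat.le_add_left 1 _) hN)
        refine ⟨_, _, rfl, rfl, computes_stm G _ f _ _ (j + 1),
          stm_case hG hμ hε hL0 hd hL hs hysK hys ?_⟩
        have h1 := pow_four_le_pow hκ (T := T) (by linarith) (N := j)
          ((Nat.le_ceil _).trans (by exact_mod_cast Nat.le_of_succ_le_succ hN))
        rw [← dualL_div_dualMu hG hμ hL0, inv_div] at h1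
        refine le_trans ?_ h1
        have h2 : dualL G μ * ‖ys‖ ^ 2 / ε ≤ T := by
          have : dualL G μ * ‖ys‖ ^ 2 / ε ≤ L / μ * chi G * (dualL G μ * ‖ys‖ ^ 2 / ε) :=
            le_mul_of_one_le_left (by positivity) hκ
          linarith
        -- T ≥ 2 absorbs the factor 2, hence the fourth power of T.
        have h3 : 2 * (dualL G μ * ‖ys‖ ^ 2 / ε) ≤ T ^ 2 := by
          rw [sq T]
          exact mul_le_mul (by linarith) h2 (by positivity) (by linarith)
        calc (2 * (dualL G μ * ‖ys‖ ^ 2 / ε)) ^ 2 ≤ (T ^ 2) ^ 2 := by gcongr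
          _ = T ^ 4 := by ring
  · intro Q M r xs hQ hc hl hxs hmin hr hM
    have hs : ∀ k, ConjSpec Q (f k) μ := fun k =>
      conjSpec_of_strongConvexOn hQ ⟨xs, hxs⟩ (hc k) hμ (hl k)
    obtain ⟨y₀, hy₀, hnorm⟩ := exists_dual_solution hG hμ hc hxs hmin hr hM hs
    obtain ⟨ys, hys, -, hR, hle⟩ := exists_dualRadius hG hμ hs hy₀
    have hLd := dualL_pos hG hμ
    have hlam := (lamMinPos_pos_and_le hG).1
    have hm : (0 : ℝ) < Fintype.card V := by exact_mod_cast Fintype.card_pos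
    -- The multiplier bound R² ≤ M²/(m λ_min⁺) meets L_Ψ = m λ_max/μ, and m cancels.
    have hLR : dualL G μ * ‖ys‖ ^ 2 / ε ≤ M ^ 2 / (μ * ε) * chi G := by
      have h1 : ‖ys‖ ^ 2 ≤ M ^ 2 / (Fintype.card V * lamMinPos G) :=
        le_trans (by gcongr) hnorm
      have h2 : dualL G μ * ‖ys‖ ^ 2 / ε
          ≤ dualL G μ * (M ^ 2 / (Fintype.card V * lamMinPos G)) / ε := by gcongr
      refine h2.trans_eq ?_
      unfold dualL chi
      field_simp
    have hX0 : 0 ≤ M ^ 2 / (μ * ε) * chi G := le_trans (by positivity) hLR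
    have hcount := sqrt_count (M ^ 2 / (μ * ε) * chi G)
    rw [gradient_dualObj hG hμ hs]
    refine ⟨‖ys‖, hR, ?_, ?_⟩
    · refine ⟨⌈7 * √(M ^ 2 / (μ * ε) * chi G)⌉₊ + 1, ?_, ?_, fun N hN => ?_⟩
      · rw [(counts_rogmProgram _ _ _ _).1]
        push_cast at hcount ⊢
        linarith
      · rw [(counts_rogmProgram _ _ _ _).2]
        push_cast at hcount ⊢
        linarith
      · have hN2 := le_sq_of_ceil_sqrt_le hX0 hN
        exact ⟨_, _, rfl, rfl, computes_rogm G Q f _ N 1,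
          ogm_case hG hμ hε hs hys (le_trans (Nat.le_add_left 1 _) hN) (by linarith)⟩
    · refine ⟨⌈7 * √(M ^ 2 / (μ * ε) * chi G)⌉₊ + 1, ?_, ?_, fun N hN => ?_⟩
      · rw [(counts_pdstmProgram _ _ _).1]
        push_cast at hcount ⊢
        linarith [Real.sqrt_nonneg (M ^ 2 / (μ * ε) * chi G)]
      · rw [(counts_pdstmProgram _ _ _).2]
        push_cast at hcount ⊢
        linarith [Real.sqrt_nonneg (M ^ 2 / (μ * ε) * chi G)]
      · have hN2 := le_sq_of_ceil_sqrt_le hX0 hN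
        have hN1 : 1 ≤ N := le_trans (Nat.le_add_left 1 _) hN
        have hN0 : (0 : ℝ) < N := by exact_mod_cast hN1
        have hg := gradient_dualObj hG hμ hs
        obtain ⟨h1, h2, h3⟩ := pdstm_rate hG hμ hc hs hys hN1
        rw [hg] at h2
        refine ⟨_, _, rfl, rfl, computes_pdstm G Q f _ N hg, h1, h2.trans hε.le, h3.trans ?_⟩
        -- PDSTM needs only N² ≥ 8 L_ΨR²/ε, which the choice made for OGM-G covers.
        rw [div_le_iff₀ (by positivity), mul_comm ε, ← div_le_iff₀ hε, mul_div_assoc]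
        have : 0 ≤ dualL G μ * ‖ys‖ ^ 2 / ε := by positivity
        linarith
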